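/- **Conventions.** Let $(M,g)$ be a smooth oriented four-dimensional Lorentzian manifold of signature $(+,-,-,-)$, with volume form $\epsilon_{\alpha\beta\gamma\delta}$, Hodge dual ${}^*T_{\alpha\beta}=\tfrac12\epsilon_{\alpha\beta}{}^{\gamma\delta}T_{\gamma\delta}$, Levi-Civita connection $\nabla$ and $\Box=g^{\alpha\beta}\nabla_\alpha\nabla_\beta$. The curvature is $(\nabla_\alpha\nabla_\beta-\nabla_\beta\nabla_\alpha)V^\gamma=R_{\alpha\beta\delta}{}^{\gamma}V^\delta$, $R_{\alpha\beta}=R_{\alpha\gamma\beta}{}^{\gamma}$, with Einstein tensor $G_{\alpha\beta}=R_{\alpha\beta}-\tfrac12Rg_{\alpha\beta}$ and Weyl tensor $C_{\alpha\beta\gamma\delta}$. Let $\lambda\in\mathbb R$ and assume $G_{\alpha\beta}+\lambda g_{\alpha\beta}=0$. Assume that the spacetime is of Petrov type D: at every point there is a null tetrad $(l,n,m,\bar m)$ ($l,n$ real, $l\cdot n=1$, $m\cdot\bar m=-1$, all other products zero, $\epsilon_{\alpha\beta\gamma\delta}l^\alpha n^\beta m^\gamma\bar m^\delta=-i$) for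 which $$\Psi_2=C_{\alpha\beta\gamma\delta}\,l^\alpha m^\beta\bar m^\gamma n^\delta\neq0$$ is the only nonvanishing Weyl scalar. Let $\Psi_2^{1/3}$ be a smooth branch of the cube root of $\Psi_2$ on $M$, let $k\in\mathbb C$ be a constant (the normalization used in the applications is $k=2$), and let $$K_{\alpha\beta}=k\,\Psi_2^{-1/3}\bigl(l_{[\alpha}n_{\beta]}+\bar m_{[\alpha}m_{\beta]}\bigr)$$ be the two-form of the Killing spinor $k\Psi_2^{-1/3}o_{(A}\iota_{B)}$, whose sign is chosen so that $K$ is smooth on $M$. Put $Y_{\alpha\beta}=iK_{\alpha\beta}-i\bar K_{\alpha\beta}$, so that ${}^*Y_{\alpha\beta}=K_{\alpha\beta}+\bar K_{\alpha\beta}$, and assume that the vector $\xi_\beta=\nabla^\alpha K_{\alpha\beta}$ is real. **Statement.** 1. Let $u,v$ be real functions such that $\Phi=u+iv$ is a smooth solution of the Fackerell–Ipser equation $(\Box+2\bar\Psi_2+\tfrac23\lambda)\Phi=0$. For a real function $w$ put $${}^*E_{\alpha\beta}(w)=-4\nabla_{[\alpha}\bigl(Y_{\beta]}{}^{\gamma}\nabla_\gamma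 w\bigr)+4\,\mathrm{Im}(\Psi_2)\,{}^*Y_{\alpha\beta}\,w ,$$ and let $E(w)=-{}^*({}^*E(w))$ be the two-form whose dual is ${}^*E(w)$. Then $F=E(u)-{}^*E(v)$ is a smooth solution of the Maxwell equations, $\nabla^\alpha F_{\alpha\beta}=0=\nabla^\alpha\,{}^*F_{\alpha\beta}$. 2. The operator $$\mathcal A(\Phi)=-(Y^{\alpha\beta}+i\,{}^*Y^{\alpha\beta})\nabla_\alpha\bigl(Y_\beta{}^{\gamma}\nabla_\gamma\Phi\bigr)-8i\,\bigl(\tfrac k2\bigr)^2\,\mathrm{Im}(\Psi_2)\,\Psi_2^{-2/3}\,\Phi$$ (with coefficient $-8i$ for $k=2$) maps smooth complex solutions of $(\Box+2\bar\Psi_2+\tfrac23\lambda)\Phi=0$ to smooth solutions of $(\Box+2\Psi_2+\tfrac23\lambda)\mathcal A(\Phi)=0$. 3. If $\Psi_2$ is real, with $\Psi_2^{1/3}$ its real cube root, and $k$ is real, then for every smooth $\Phi:M\to\mathbb C$ $$\mathcal A(\Phi)=-Y^{\alpha\beta}\nabla_\alpha\bigl(Y_\beta{}^{\gamma}\nabla_\gamma\Phi\bigr)=-\nabla_\alpha\bigl(H^{\alpha\gamma}\nabla_\gamma\Phi\bigr),\qquad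 H^{\alpha\gamma}=Y^{\alpha\beta}Y_\beta{}^{\gamma},$$ which is the Carter operator. -/

import Mathlib

open scoped Manifold ContDiff ComplexConjugate

noncomputable section

namespace TypeD

/-- The model space of a four-dimensional manifold. -/
abbrev E4 : Type := EuclideanSpace ℝ (Fin 4)

/-! ### Tensor calculus in one coordinate system

Components of tensor fields are functions of the coordinates with values in `ℂ`; real tensors are
regarded as complex ones. All tensor indices are written in the order in which they are printed. -/

/-- A field with one lower index, given by its components. -/
abbrev Tens1 : Type := Fin 4 → E4 → ℂ

/-- A field with two lower indices, given by its components. -/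
abbrev Tens2 : Type := Fin 4 → Fin 4 → E4 → ℂ

/-- A field with four lower indices, given by its components. -/
abbrev Tens4 : Type := Fin 4 → Fin 4 → Fin 4 → Fin 4 → E4 → ℂ

/-- The partial derivative `∂_a f`. -/
def pd (a : Fin 4) (f : E4 → ℂ) : E4 → ℂ :=
  fun x => fderiv ℝ f x (EuclideanSpace.single a 1)

/-- The inverse metric `g^{ab}`. -/
def ginv (g : Tens2) : Tens2 :=
  fun a b x => (Matrix.of fun i j => g i j x)⁻¹ a b

/-- The Christoffel symbols `Γ^c_{ab}`; the first argument is the upper index. -/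
def christoffel (g : Tens2) (c a b : Fin 4) : E4 → ℂ :=
  fun x => (1 / 2) * ∑ d, ginv g c d x * (pd a (g d b) x + pd b (g d a) x - pd d (g a b) x)

/-- The covariant derivative `∇_a α_b` of a one-form. -/
def cov1 (g : Tens2) (α : Tens1) : Tens2 :=
  fun a b x => pd a (α b) x - ∑ c, christoffel g c a b x * α c x

/-- The covariant derivative `∇_c T_{ab}`; the first argument is the derivative index. -/
def cov2 (g : Tens2) (T : Tens2) (c a b : Fin 4) : E4 → ℂ :=
  fun x => pd c (T a b) x - ∑ d, christoffel g d c a x * T d b x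
    - ∑ d, christoffel g d c b x * T a d x

/-- The gradient `∇_a f`. -/
def grad (f : E4 → ℂ) : Tens1 := fun a => pd a f

/-- The wave operator `□ f = g^{ab} ∇_a ∇_b f`. -/
def box (g : Tens2) (f : E4 → ℂ) : E4 → ℂ :=
  fun x => ∑ a, ∑ b, ginv g a b x * cov1 g (grad f) a b x

/-- The divergence `∇^a T_{ab}`. -/
def div2 (g : Tens2) (T : Tens2) : Tens1 :=
  fun b x => ∑ a, ∑ c, ginv g a c x * cov2 g T c a b x

/-- The divergence `∇_a V^a` of a vector field. -/
def divVec (g : Tens2) (V : Fin 4 → E4 → ℂ) : E4 → ℂ :=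
  fun x => ∑ a, (pd a (V a) x + ∑ b, christoffel g a a b x * V b x)

/-- Both indices raised: `T^{ab}`. -/
def up2 (g : Tens2) (T : Tens2) : Tens2 :=
  fun a b x => ∑ c, ∑ d, ginv g a c x * ginv g b d x * T c d x

/-- Second index raised: `T_a^b`. -/
def upSnd (g : Tens2) (T : Tens2) : Tens2 :=
  fun a b x => ∑ c, T a c x * ginv g c b x

/-- The antisymmetric part `T_{[ab]}`. -/
def alt2 (T : Tens2) : Tens2 := fun a b x => (1 / 2) * (T a b x - T b a x)

/-- The Hodge dual `*T_{ab} = ½ ε_{ab}^{cd} T_{cd}`, where `vol` has the components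
`ε_{abcd}`. -/
def hodge (g : Tens2) (vol : Tens4) (T : Tens2) : Tens2 :=
  fun a b x => (1 / 2) * ∑ c, ∑ d, vol a b c d x * up2 g T c d x

/-- The curvature `R_{abd}^c`, with the sign fixed by
`(∇_a ∇_b - ∇_b ∇_a) V^c = R_{abd}^c V^d`. The arguments are `a b d c`. -/
def riemUp (g : Tens2) (a b d c : Fin 4) : E4 → ℂ :=
  fun x => pd a (christoffel g c b d) x - pd b (christoffel g c a d) x
    + ∑ e, (christoffel g c a e x * christoffel g e b d x
        - christoffel g c b e x * christoffel g e a d x)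

/-- The curvature `R_{abcd} = R_{abc}^e g_{ed}`. -/
def riem (g : Tens2) : Tens4 :=
  fun a b c d x => ∑ e, riemUp g a b c e x * g e d x

/-- The Ricci tensor `R_{ab} = R_{acb}^c`. -/
def ricci (g : Tens2) : Tens2 := fun a b x => ∑ c, riemUp g a c b c x

/-- The curvature scalar. -/
def scalarCurv (g : Tens2) : E4 → ℂ :=
  fun x => ∑ a, ∑ b, ginv g a b x * ricci g a b x

/-- The Einstein tensor. -/
def einstein (g : Tens2) : Tens2 :=
  fun a b x => ricci g a b x - (1 / 2) * scalarCurv g x * g a b x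

/-- The Weyl tensor `C_{abcd}` in dimension four. -/
def weyl (g : Tens2) : Tens4 :=
  fun a b c d x => riem g a b c d x
    - (1 / 2) * (g a c x * ricci g b d x - g a d x * ricci g b c x
        - g b c x * ricci g a d x + g b d x * ricci g a c x)
    + (1 / 6) * scalarCurv g x * (g a c x * g b d x - g a d x * g b c x)

/-- Contraction `T_{ab} v^a w^b` at the point `x` with complex vectors. -/
def ev2 (T : Tens2) (x : E4) (v w : Fin 4 → ℂ) : ℂ :=
  ∑ a, ∑ b, T a b x * v a * w b

/-- Contraction `T_{abcd} v^a w^b y^c z^d` at the point `x` with complex vectors. -/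
def ev4 (T : Tens4) (x : E4) (v w y z : Fin 4 → ℂ) : ℂ :=
  ∑ a, ∑ b, ∑ c, ∑ d, T a b c d x * v a * w b * y c * z d

/-- Lowered index: `v_a`. -/
def lower (g : Tens2) (x : E4) (v : Fin 4 → ℂ) (a : Fin 4) : ℂ := ∑ b, g a b x * v b

/-- `(l, n, m, m̄)` is a null tetrad at `x`: `l` and `n` are real, `l·n = 1`, `m·m̄ = -1`, all other
products vanish, and the tetrad is positively oriented in the sense that
`ε_{abcd} l^a n^b m^c m̄^d = -i`, which holds for tetrads that come from spin dyads. -/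
structure IsNullTetrad (g : Tens2) (vol : Tens4) (x : E4) (l n m : Fin 4 → ℂ) : Prop where
  l_real : ∀ a, conj (l a) = l a
  n_real : ∀ a, conj (n a) = n a
  ll : ev2 g x l l = 0
  nn : ev2 g x n n = 0
  ln : ev2 g x l n = 1
  lm : ev2 g x l m = 0
  nm : ev2 g x n m = 0
  mm : ev2 g x m m = 0
  mmb : ev2 g x m (fun a => conj (m a)) = -1
  oriented : ev4 vol x l n m (fun a => conj (m a)) = -Complex.I

/-- `l`, `n` span the two repeated principal null directions at `x`, and `Ψ₂ = ψ ≠ 0` is the only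
nonvanishing Weyl scalar. -/
structure IsPrincipal (g : Tens2) (x : E4) (l n m : Fin 4 → ℂ) (ψ : ℂ) : Prop where
  psi0 : ev4 (weyl g) x l m l m = 0
  psi1 : ev4 (weyl g) x l m l n = 0
  psi2 : ev4 (weyl g) x l m (fun a => conj (m a)) n = ψ
  psi3 : ev4 (weyl g) x l n (fun a => conj (m a)) n = 0
  psi4 : ev4 (weyl g) x (fun a => conj (m a)) n (fun a => conj (m a)) n = 0
  ne_zero : ψ ≠ 0

/-- The components `o_{(A} ι_{B)} ε̄_{A'B'} = l_{[a} n_{b]} + m̄_{[a} m_{b]}`. -/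
def dyadForm (g : Tens2) (x : E4) (l n m : Fin 4 → ℂ) (a b : Fin 4) : ℂ :=
  (1 / 2) * (lower g x l a * lower g x n b - lower g x l b * lower g x n a)
    + (1 / 2) * (lower g x (fun c => conj (m c)) a * lower g x m b
        - lower g x (fun c => conj (m c)) b * lower g x m a)

/-! ### Spacetimes -/

section Manifold

variable (M : Type*) [TopologicalSpace M] [ChartedSpace E4 M]

/-- The coordinate systems of `M`: the charts of its maximal smooth atlas. -/
abbrev coords : Set (OpenPartialHomeomorph M E4) := IsManifold.maximalAtlas (𝓡 4) ∞ M

variable {M}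

/-- The coordinate vector `∂_a` of the chart `e` at the point with coordinates `x`. -/
def coordVec (e : OpenPartialHomeomorph M E4) (x : E4) (a : Fin 4) :
    TangentSpace (𝓡 4) (e.symm x) :=
  mfderiv (𝓡 4) (𝓡 4) e.symm x (EuclideanSpace.single a (1 : ℝ))

/-- The Minkowski metric of signature `(+,-,-,-)`. -/
def minkowski (a b : Fin 4) : ℝ := if a = b then (if a = 0 then 1 else -1) else 0

variable (M)

/-- An oriented four-dimensional spacetime: a smooth Lorentzian metric of signature `(+,-,-,-)`
together with a smooth volume form `ε`, which has the values `±1` on orthonormal frames. Smoothness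
is smoothness of the components in every coordinate system. -/
structure Spacetime where
  metric : ∀ p : M, TangentSpace (𝓡 4) p →L[ℝ] TangentSpace (𝓡 4) p →L[ℝ] ℝ
  vol : ∀ p : M, TangentSpace (𝓡 4) p [⋀^Fin 4]→L[ℝ] ℝ
  metric_symm : ∀ p v w, metric p v w = metric p w v
  lorentzian : ∀ p, ∃ b : Module.Basis (Fin 4) ℝ (TangentSpace (𝓡 4) p),
    ∀ i j, metric p (b i) (b j) = minkowski i j
  vol_orthonormal : ∀ (p : M) (b : Fin 4 → TangentSpace (𝓡 4) p),
    (∀ i j, metric p (b i) (b j) = minkowski i j) → |vol p b| = 1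
  metric_smooth : ∀ e ∈ coords M, ∀ a b, ContDiffOn ℝ ∞
    (fun x => metric (e.symm x) (coordVec e x a) (coordVec e x b)) e.target
  vol_smooth : ∀ e ∈ coords M, ∀ a b c d, ContDiffOn ℝ ∞
    (fun x => vol (e.symm x)
      ![coordVec e x a, coordVec e x b, coordVec e x c, coordVec e x d]) e.target

variable {M}

namespace Spacetime

variable (S : Spacetime M) (e : OpenPartialHomeomorph M E4)

/-- The components `g_{ab}` in the chart `e`. -/
def g : Tens2 :=
  fun a b x => ((S.metric (e.symm x) (coordVec e x a) (coordVec e x b) : ℝ) : ℂ)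

/-- The components `ε_{abcd}` in the chart `e`. -/
def volC : Tens4 :=
  fun a b c d x => ((S.vol (e.symm x)
    ![coordVec e x a, coordVec e x b, coordVec e x c, coordVec e x d] : ℝ) : ℂ)

/-- The vacuum Einstein equation `G_{ab} + lam g_{ab} = 0`. -/
def IsLambdaVacuum (lam : ℝ) : Prop :=
  ∀ e ∈ coords M, ∀ x ∈ e.target, ∀ a b, einstein (S.g e) a b x + lam * S.g e a b x = 0

/-- A smooth solution `f` of `(□ + 2 ψ + ⅔ lam) f = 0`. For `ψ = Ψ₂` and `ψ = Ψ̄₂` these are the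
Fackerell–Ipser equation and its conjugate. -/
def SolvesFI (lam : ℝ) (ψ f : M → ℂ) : Prop :=
  ContMDiff (𝓡 4) 𝓘(ℝ, ℂ) ∞ f ∧
  ∀ e ∈ coords M, ∀ x ∈ e.target,
    box (S.g e) (f ∘ e.symm) x + (2 * ψ (e.symm x) + 2 / 3 * lam) * f (e.symm x) = 0

/-- The two-form with components `F e a b` in the chart `e` is smooth and satisfies the source-free
Maxwell equations `∇^a F_{ab} = 0 = ∇^a *F_{ab}`. -/
def IsMaxwell (F : OpenPartialHomeomorph M E4 → Tens2) : Prop :=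
  ∀ e ∈ coords M,
    (∀ a b, ContDiffOn ℝ ∞ (F e a b) e.target) ∧
    ∀ x ∈ e.target, ∀ b,
      div2 (S.g e) (F e) b x = 0 ∧ div2 (S.g e) (hodge (S.g e) (S.volC e) (F e)) b x = 0

end Spacetime

/-- The principal structure of a spacetime of Petrov type D: a smooth branch `ζ = Ψ₂^{1/3}` and the
Killing spinor `K_{AB} = k Ψ₂^{-1/3} o_{(A} ι_{B)}`, represented by the smooth anti-self-dual two-form
`K_{AB} ε̄_{A'B'}`. The spacetime is of type D because at each point there is a principal tetrad. -/
structure TypeDStructure (S : Spacetime M) (k : ℂ) where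
  ζ : M → ℂ
  K : ∀ p : M, TangentSpace (𝓡 4) p →L[ℝ] TangentSpace (𝓡 4) p →L[ℝ] ℂ
  ζ_smooth : ContMDiff (𝓡 4) 𝓘(ℝ, ℂ) ∞ ζ
  K_smooth : ∀ e ∈ coords M, ∀ a b, ContDiffOn ℝ ∞
    (fun x => K (e.symm x) (coordVec e x a) (coordVec e x b)) e.target
  principal : ∀ e ∈ coords M, ∀ x ∈ e.target, ∃ l n m : Fin 4 → ℂ,
    IsNullTetrad (S.g e) (S.volC e) x l n m ∧
    IsPrincipal (S.g e) x l n m (ζ (e.symm x) ^ 3) ∧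
    ∀ a b, K (e.symm x) (coordVec e x a) (coordVec e x b)
      = k * (ζ (e.symm x))⁻¹ * dyadForm (S.g e) x l n m a b

namespace TypeDStructure

variable {S : Spacetime M} {k : ℂ} (D : TypeDStructure S k)

/-- The Weyl scalar `Ψ₂`. -/
def Ψ₂ (p : M) : ℂ := D.ζ p ^ 3

variable (e : OpenPartialHomeomorph M E4)

/-- The components of `K_{AB} ε̄_{A'B'}` in the chart `e`. -/
def KC : Tens2 := fun a b x => D.K (e.symm x) (coordVec e x a) (coordVec e x b)

/-- The vector `ξ^{AA'} = ∇^{BA'} K_B^A` with its index lowered, that is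
`ξ_b = ∇^a (K_{AB} ε̄_{A'B'})`. -/
def ξ : Tens1 := div2 (S.g e) (D.KC e)

/-- The vector `ξ` is real. -/
def XiReal : Prop := ∀ e ∈ coords M, ∀ x ∈ e.target, ∀ a, (D.ξ e a x).im = 0

/-- The Killing–Yano tensor `Y_{ab} = i K_{AB} ε̄_{A'B'} - i K̄_{A'B'} ε_{AB}`. -/
def Y : Tens2 := fun a b x => Complex.I * D.KC e a b x - Complex.I * conj (D.KC e a b x)

/-- The dual `*Y_{ab}`. -/
def starY : Tens2 := hodge (S.g e) (S.volC e) (D.Y e)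

/-- The one-form `Y_b^c ∇_c f`. -/
def Ygrad (f : E4 → ℂ) : Tens1 :=
  fun b x => ∑ c, upSnd (S.g e) (D.Y e) b c x * grad f c x

/-- The two-form `*E_{ab}(w) = -4 ∇_{[a} (Y_{b]}^c ∇_c w) + 4 Im(Ψ₂) *Y_{ab} w`. -/
def starE (w : M → ℝ) : Tens2 :=
  fun a b x => -4 * alt2 (cov1 (S.g e) (D.Ygrad e fun y => (w (e.symm y) : ℂ))) a b x
    + 4 * ((D.Ψ₂ (e.symm x)).im : ℂ) * D.starY e a b x * (w (e.symm x) : ℂ)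

/-- The two-form `E(w)` whose dual is `*E(w)`; since `** = -1` it is minus the dual of `*E(w)`. -/
def EForm (w : M → ℝ) : Tens2 :=
  fun a b x => -hodge (S.g e) (S.volC e) (D.starE e w) a b x

/-- The two-form `F = E(u) - *E(v)`. -/
def F (u v : M → ℝ) (e : OpenPartialHomeomorph M E4) : Tens2 :=
  fun a b x => D.EForm e u a b x - D.starE e v a b x

/-- `-(Y + i *Y)^{ab} ∇_a (Y_b^c ∇_c f) - 8 i (k/2)² Im(Ψ₂) Ψ₂^{-2/3} f` in the chart `e`. -/
def symOpIn (f : M → ℂ) : E4 → ℂ :=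
  fun x => -(∑ a, ∑ b, (up2 (S.g e) (D.Y e) a b x + Complex.I * up2 (S.g e) (D.starY e) a b x)
      * cov1 (S.g e) (D.Ygrad e (f ∘ e.symm)) a b x)
    - 8 * Complex.I * (k / 2) ^ 2 * ((D.Ψ₂ (e.symm x)).im : ℂ) * (D.ζ (e.symm x) ^ 2)⁻¹
      * f (e.symm x)

/-- The operator `A f = -(Y + i *Y)^{ab} ∇_a (Y_b^c ∇_c f) - 8 i (k/2)² Im(Ψ₂) Ψ₂^{-2/3} f` on
functions on `M`. -/
def symOp (f : M → ℂ) : M → ℂ :=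
  fun p => D.symOpIn (chartAt E4 p) f (chartAt E4 p p)

/-- `-Y^{ab} ∇_a (Y_b^c ∇_c f)` in the chart `e`. -/
def carterYIn (f : M → ℂ) : E4 → ℂ :=
  fun x => -(∑ a, ∑ b, up2 (S.g e) (D.Y e) a b x * cov1 (S.g e) (D.Ygrad e (f ∘ e.symm)) a b x)

/-- The Killing tensor `H^{ac} = Y^{ab} Y_b^c`. -/
def killingH : Tens2 :=
  fun a c x => ∑ b, up2 (S.g e) (D.Y e) a b x * upSnd (S.g e) (D.Y e) b c x

/-- The Carter operator `-∇_a (H^{ac} ∇_c f)` in the chart `e`. -/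
def carterIn (f : M → ℂ) : E4 → ℂ :=
  fun x => -divVec (S.g e) (fun a y => ∑ c, D.killingH e a c y * grad (f ∘ e.symm) c y) x

end TypeDStructure

end Manifold

end TypeD

end

set_option linter.unusedSectionVars false

noncomputable section

namespace TypeD

open Matrix

/-! ### Coordinate calculus over a ring of functions

Endomorphisms `M_a^b` of the covectors are matrices that act by `mulVec`. -/

/-! Two-forms are read as endomorphisms of covectors that are skew for the metric. In a chart, the
dyad two-form becomes an endomorphism `j` with `j² = 1`, with complex conjugate `j'`. Put `κ = k
Ψ₂^{-1/3}`, `p = dΨ₂/(3Ψ₂)` and `μ = λ/3`; then `κ j` is twice the form `K`, and a constant times `κ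
j - κ' j'` is `Y`. The complexified Lorentz algebra is the sum of two commuting copies of `sl₂`, and
`j` lies in one of them. A vacuum curvature of type D is then characterised by two facts: `R_ab -
(Ψ₂+μ) θ_a∧θ_b` commutes with `j`, and its component along `j` is a known multiple of `Ψ₂ j_ab`.

The second Bianchi identity together with these facts determines the derivative of `j`: `D_e j = [j,
θ_e∧p]`, which is the Killing spinor equation (`IsTypeD.Dm_j`). Its integrability condition says
that a certain symmetric tensor built from `∇p` is trace-free and commutes with `j`
(`IsTypeD.schouten_facts`). The trace gives `∇·p + p² = -2(Ψ₂+μ)` and then the rough Laplacian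
`Δ(κj) = 2(Ψ₂+μ) κj` (`IsTypeD.lapM_K`).

Two theorems carry the result. (a) If `F` is an anti-self-dual Maxwell field and `Fj + jF = s`, then
`κs` solves the Fackerell–Ipser equation: the divergence of `κ[j,F]` is `2F(κjp) - ∇(κs)`, and the
double divergence of a two-form vanishes (`IsTypeD.fackerell_ipser`). (b) If `Φ` solves the
conjugate equation and `V = (κj - κ'j')∇Φ`, then `dV + 2(Ψ₂-Ψ̄₂)Φ κj` is divergence-free
(`IsTypeD.divM_exd_Y`). This follows from the Weitzenböck formula for `V`; reality of `ξ` makes `κj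
- κ'j'` divergence-free and removes the cross terms with the Hessian of `Φ`. Since the dual of `dV`
is divergence-free as well, an anti-self-dual Maxwell field results (`IsTypeD.divM_asd`).

For the first assertion, `*F - iF` is a constant times the field of (b), so `div *F = i div F`; both
divergences are real, hence zero. For the second, `A(Φ)` is `-1/8` times the function `κs` of that
field, so (a) applies. For the third, real data give `(j+j')(j-j') = 0`, which removes the
contribution of `*Y`, while `div Y = 0` allows `Y` to be moved under the divergence.

The differential identities are proved over an abstract ring `Calc` and applied to the smooth
functions on the target of a chart. The algebraic hypotheses are checked point by point in a null
tetrad, so no smooth tetrad is needed. Chart independence of `A` comes from writing it with an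
exterior derivative. The case `k = 0`, where `j` cannot be recovered from `K`, is trivial and
separate. -/

/-- Square matrices of size four. -/
abbrev Mat (A : Type*) : Type _ := Matrix (Fin 4) (Fin 4) A

/-- Covectors. -/
abbrev Cov (A : Type*) : Type _ := Fin 4 → A

/-- A ring of functions with commuting partial derivatives `pa a`, a metric `g` with inverse `h`,
and its Levi-Civita connection, `G a b c = Γ^c_{ab}`. -/
structure Calc (A : Type*) [CommRing A] [Algebra ℂ A] where
  pa : Fin 4 → Derivation ℂ A A
  pa_comm : ∀ a b f, pa a (pa b f) = pa b (pa a f)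
  g : Mat A
  h : Mat A
  g_symm : gᵀ = g
  g_mul_h : g * h = 1
  G : Fin 4 → Mat A
  G_symm : ∀ a b c, G a b c = G b a c
  compat : ∀ c, g.map (pa c) = G c * g + g * (G c)ᵀ

namespace Calc

variable {A : Type*} [CommRing A] [Algebra ℂ A] (C : Calc A)

lemma h_mul_g : C.h * C.g = 1 := mul_eq_one_comm.mp C.g_mul_h

lemma h_symm : C.hᵀ = C.h := by
  have h1 : C.hᵀ * C.g = 1 := by
    have := congrArg transpose C.g_mul_h
    rwa [transpose_mul, C.g_symm, transpose_one] at this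
  calc C.hᵀ = C.hᵀ * (C.g * C.h) := by rw [C.g_mul_h, mul_one]
    _ = C.h := by rw [← mul_assoc, h1, one_mul]

lemma g_comm (a b : Fin 4) : C.g a b = C.g b a := congrFun (congrFun C.g_symm b) a

lemma h_comm (a b : Fin 4) : C.h a b = C.h b a := congrFun (congrFun C.h_symm b) a

/-- The partial derivative of a matrix. -/
def dm (c : Fin 4) (M : Mat A) : Mat A := M.map (C.pa c)

/-- The partial derivative of a covector. -/
def dv (c : Fin 4) (α : Cov A) : Cov A := fun a => C.pa c (α a)

lemma dm_apply (c : Fin 4) (M : Mat A) (a b : Fin 4) : C.dm c M a b = C.pa c (M a b) := rfl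

lemma dv_apply (c : Fin 4) (α : Cov A) (a : Fin 4) : C.dv c α a = C.pa c (α a) := rfl

lemma dm_add (c : Fin 4) (M N : Mat A) : C.dm c (M + N) = C.dm c M + C.dm c N := by
  ext a b; simp [dm_apply]

lemma dm_sub (c : Fin 4) (M N : Mat A) : C.dm c (M - N) = C.dm c M - C.dm c N := by
  ext a b; simp [dm_apply]

lemma dm_smul (c : Fin 4) (f : A) (M : Mat A) : C.dm c (f • M) = C.pa c f • M + f • C.dm c M := by
  ext a b; simp [dm_apply, mul_comm, add_comm]

lemma dm_mul (c : Fin 4) (M N : Mat A) : C.dm c (M * N) = C.dm c M * N + M * C.dm c N := by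
  ext a b
  simp only [dm_apply, Matrix.mul_apply, Matrix.add_apply, map_sum, Derivation.leibniz,
    smul_eq_mul, Finset.sum_add_distrib]
  rw [add_comm]
  congr 1
  exact Finset.sum_congr rfl fun i _ => mul_comm _ _

lemma dm_one (c : Fin 4) : C.dm c 1 = 0 := by
  ext a b
  by_cases hab : a = b <;> simp [dm_apply, hab]

lemma dm_transpose (c : Fin 4) (M : Mat A) : C.dm c Mᵀ = (C.dm c M)ᵀ := rfl

lemma dm_comm (a b : Fin 4) (M : Mat A) : C.dm a (C.dm b M) = C.dm b (C.dm a M) := by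
  ext i k; exact C.pa_comm _ _ _

lemma dv_comm (a b : Fin 4) (α : Cov A) : C.dv a (C.dv b α) = C.dv b (C.dv a α) := by
  ext i; exact C.pa_comm _ _ _

lemma dv_mulVec (c : Fin 4) (M : Mat A) (α : Cov A) :
    C.dv c (M *ᵥ α) = C.dm c M *ᵥ α + M *ᵥ C.dv c α := by
  ext a
  simp only [dv_apply, dm_apply, Matrix.mulVec, dotProduct, Pi.add_apply, map_sum,
    Derivation.leibniz, smul_eq_mul, Finset.sum_add_distrib]
  rw [add_comm]
  congr 1
  exact Finset.sum_congr rfl fun i _ => mul_comm _ _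

lemma dv_add (c : Fin 4) (α β : Cov A) : C.dv c (α + β) = C.dv c α + C.dv c β := by
  ext a; simp [dv_apply]

lemma dv_sub (c : Fin 4) (α β : Cov A) : C.dv c (α - β) = C.dv c α - C.dv c β := by
  ext a; simp [dv_apply]

lemma dv_smul (c : Fin 4) (f : A) (α : Cov A) : C.dv c (f • α) = C.pa c f • α + f • C.dv c α := by
  ext a; simp [dv_apply, mul_comm, add_comm]

lemma dm_g (c : Fin 4) : C.dm c C.g = C.G c * C.g + C.g * (C.G c)ᵀ := C.compat c

lemma dm_h (c : Fin 4) : C.dm c C.h = -(C.h * C.G c + (C.G c)ᵀ * C.h) := by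
  have h1 : C.dm c (C.g * C.h) = 0 := by rw [C.g_mul_h, C.dm_one]
  rw [dm_mul, dm_g] at h1
  calc C.dm c C.h = C.h * (C.g * C.dm c C.h) := by
        rw [← mul_assoc, C.h_mul_g, one_mul]
    _ = C.h * (-((C.G c * C.g + C.g * (C.G c)ᵀ) * C.h)) := by
        rw [eq_neg_of_add_eq_zero_right h1]
    _ = -(C.h * C.G c * (C.g * C.h) + (C.h * C.g) * (C.G c)ᵀ * C.h) := by noncomm_ring
    _ = _ := by rw [C.g_mul_h, C.h_mul_g, mul_one, one_mul]

/-- The covariant derivative of a covector in the direction `∂_c`. -/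
def Dv (c : Fin 4) (α : Cov A) : Cov A := C.dv c α - C.G c *ᵥ α

/-- The covariant derivative of an endomorphism in the direction `∂_c`. -/
def Dm (c : Fin 4) (M : Mat A) : Mat A := C.dm c M - (C.G c * M - M * C.G c)

lemma Dm_add (c : Fin 4) (M N : Mat A) : C.Dm c (M + N) = C.Dm c M + C.Dm c N := by
  simp only [Dm, dm_add]; noncomm_ring

lemma Dm_sub (c : Fin 4) (M N : Mat A) : C.Dm c (M - N) = C.Dm c M - C.Dm c N := by
  simp only [Dm, dm_sub]; noncomm_ring

lemma Dm_smul (c : Fin 4) (f : A) (M : Mat A) : C.Dm c (f • M) = C.pa c f • M + f • C.Dm c M := by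
  simp only [Dm, dm_smul, Matrix.mul_smul, Matrix.smul_mul, smul_sub]; abel

lemma Dm_mul (c : Fin 4) (M N : Mat A) : C.Dm c (M * N) = C.Dm c M * N + M * C.Dm c N := by
  simp only [Dm, dm_mul]; noncomm_ring

lemma Dm_one (c : Fin 4) : C.Dm c 1 = 0 := by simp [Dm, dm_one]

lemma Dm_zero (c : Fin 4) : C.Dm c 0 = 0 := by
  have := C.Dm_add c 0 0
  simpa using this

lemma Dv_add (c : Fin 4) (α β : Cov A) : C.Dv c (α + β) = C.Dv c α + C.Dv c β := by
  simp only [Dv, dv_add, Matrix.mulVec_add]; abel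

lemma Dv_sub (c : Fin 4) (α β : Cov A) : C.Dv c (α - β) = C.Dv c α - C.Dv c β := by
  simp only [Dv, dv_sub, Matrix.mulVec_sub]; abel

lemma Dv_smul (c : Fin 4) (f : A) (α : Cov A) : C.Dv c (f • α) = C.pa c f • α + f • C.Dv c α := by
  simp only [Dv, dv_smul, Matrix.mulVec_smul, smul_sub]; abel

lemma Dv_mulVec (c : Fin 4) (M : Mat A) (α : Cov A) :
    C.Dv c (M *ᵥ α) = C.Dm c M *ᵥ α + M *ᵥ C.Dv c α := by
  simp only [Dv, Dm, dv_mulVec, Matrix.mulVec_sub, Matrix.sub_mulVec, Matrix.mulVec_mulVec]; abel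

/-- The connection enters `Dm` through a commutator, which has no trace. -/
lemma pa_trace (c : Fin 4) (M : Mat A) : C.pa c M.trace = (C.Dm c M).trace := by
  rw [Dm, Matrix.trace_sub, Matrix.trace_sub, Matrix.trace_mul_comm (C.G c), sub_self, sub_zero]
  simp [Matrix.trace, dm_apply]

/-- The inner product of covectors. -/
def ip (α β : Cov A) : A := α ⬝ᵥ (C.h *ᵥ β)

lemma ip_comm (α β : Cov A) : C.ip α β = C.ip β α := by
  rw [ip, ip, Matrix.dotProduct_mulVec, dotProduct_comm, ← Matrix.mulVec_transpose, C.h_symm]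

lemma ip_add_left (α β γ : Cov A) : C.ip (α + β) γ = C.ip α γ + C.ip β γ := add_dotProduct _ _ _

lemma ip_sub_left (α β γ : Cov A) : C.ip (α - β) γ = C.ip α γ - C.ip β γ := sub_dotProduct _ _ _

lemma ip_smul_left (f : A) (α β : Cov A) : C.ip (f • α) β = f * C.ip α β := smul_dotProduct _ _ _

lemma ip_neg_left (α β : Cov A) : C.ip (-α) β = -C.ip α β := neg_dotProduct _ _

lemma ip_add_right (α β γ : Cov A) : C.ip α (β + γ) = C.ip α β + C.ip α γ := by
  simp only [C.ip_comm α, ip_add_left]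

lemma ip_sub_right (α β γ : Cov A) : C.ip α (β - γ) = C.ip α β - C.ip α γ := by
  simp only [C.ip_comm α, ip_sub_left]

lemma ip_smul_right (f : A) (α β : Cov A) : C.ip α (f • β) = f * C.ip α β := by
  simp only [C.ip_comm α, ip_smul_left]

lemma ip_neg_right (α β : Cov A) : C.ip α (-β) = -C.ip α β := by
  simp only [C.ip_comm α, ip_neg_left]

lemma ip_sum_right {ι : Type*} (s : Finset ι) (α : Cov A) (β : ι → Cov A) :
    C.ip α (∑ i ∈ s, β i) = ∑ i ∈ s, C.ip α (β i) := by
  classical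
  induction s using Finset.induction_on with
  | empty => simp [ip]
  | insert i s hi ih => rw [Finset.sum_insert hi, Finset.sum_insert hi, ip_add_right, ih]

/-- The lowered coordinate vector `∂_c`. -/
def θ (c : Fin 4) : Cov A := C.g c

lemma ip_θ (c : Fin 4) (α : Cov A) : C.ip (C.θ c) α = α c := by
  have : C.g *ᵥ (C.h *ᵥ α) = α := by rw [Matrix.mulVec_mulVec, C.g_mul_h, Matrix.one_mulVec]
  exact congrFun this c

lemma pa_ip (c : Fin 4) (α β : Cov A) :
    C.pa c (C.ip α β) = C.ip (C.Dv c α) β + C.ip α (C.Dv c β) := by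
  have h1 : C.pa c (C.ip α β) = C.dv c α ⬝ᵥ (C.h *ᵥ β) + α ⬝ᵥ C.dv c (C.h *ᵥ β) := by
    simp only [ip, dotProduct, map_sum, Derivation.leibniz, smul_eq_mul, Finset.sum_add_distrib,
      dv_apply]
    rw [add_comm]
    congr 1
    exact Finset.sum_congr rfl fun i _ => mul_comm _ _
  rw [h1, dv_mulVec, dm_h]
  have h2 : α ⬝ᵥ ((C.G c)ᵀ *ᵥ (C.h *ᵥ β)) = (C.G c *ᵥ α) ⬝ᵥ (C.h *ᵥ β) := by
    rw [Matrix.dotProduct_mulVec, ← Matrix.mulVec_transpose, Matrix.transpose_transpose]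
  simp only [ip, Dv, sub_dotProduct, Matrix.mulVec_sub, dotProduct_sub, Matrix.neg_mulVec,
    Matrix.add_mulVec, dotProduct_add, dotProduct_neg, ← Matrix.mulVec_mulVec, h2]
  ring

/-- The covector `α ⊗ β♯` as an endomorphism. -/
def tens (α β : Cov A) : Mat A := Matrix.vecMulVec α (C.h *ᵥ β)

lemma tens_mulVec (α β v : Cov A) : C.tens α β *ᵥ v = C.ip β v • α := by
  rw [ip_comm, ip, tens, dotProduct_comm]
  generalize C.h *ᵥ β = w
  ext a
  simp only [Matrix.mulVec, Matrix.vecMulVec_apply, dotProduct, Pi.smul_apply, smul_eq_mul,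
    Finset.sum_mul]
  exact Finset.sum_congr rfl fun i _ => by ring

/-- Two endomorphisms that agree on all covectors are equal. -/
lemma mat_ext {M N : Mat A} (hMN : ∀ v, M *ᵥ v = N *ᵥ v) : M = N :=
  Matrix.ext_of_mulVec_single fun _ => hMN _

/-- `α ∧ β` as an endomorphism. -/
def wedge (α β : Cov A) : Mat A := C.tens α β - C.tens β α

lemma wedge_mulVec (α β v : Cov A) : C.wedge α β *ᵥ v = C.ip β v • α - C.ip α v • β := by
  rw [wedge, Matrix.sub_mulVec, tens_mulVec, tens_mulVec]

lemma wedge_add_left (α β γ : Cov A) : C.wedge (α + β) γ = C.wedge α γ + C.wedge β γ :=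
  mat_ext fun v => by
    simp only [wedge_mulVec, Matrix.add_mulVec, ip_add_left]; module

lemma wedge_smul_left (f : A) (α β : Cov A) : C.wedge (f • α) β = f • C.wedge α β :=
  mat_ext fun v => by
    simp only [wedge_mulVec, Matrix.smul_mulVec, ip_smul_left]; module

lemma wedge_swap (α β : Cov A) : C.wedge α β = -C.wedge β α := by
  simp [wedge]

lemma wedge_self (α : Cov A) : C.wedge α α = 0 := by simp [wedge]

lemma wedge_add_right (α β γ : Cov A) : C.wedge α (β + γ) = C.wedge α β + C.wedge α γ := by
  rw [wedge_swap, wedge_add_left, wedge_swap, C.wedge_swap γ α]; abel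

lemma wedge_smul_right (f : A) (α β : Cov A) : C.wedge α (f • β) = f • C.wedge α β := by
  rw [wedge_swap, wedge_smul_left, C.wedge_swap β α]; simp

lemma wedge_neg_left (α β : Cov A) : C.wedge (-α) β = -C.wedge α β := by
  have := C.wedge_smul_left (-1) α β
  simpa using this

lemma wedge_sum_left {ι : Type*} (s : Finset ι) (α : ι → Cov A) (β : Cov A) :
    C.wedge (∑ i ∈ s, α i) β = ∑ i ∈ s, C.wedge (α i) β := by
  classical
  induction s using Finset.induction_on with
  | empty => simp [wedge, tens, Matrix.vecMulVec_zero, Matrix.zero_vecMulVec]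
  | insert i s hi ih => rw [Finset.sum_insert hi, Finset.sum_insert hi, wedge_add_left, ih]

lemma wedge_sum_right {ι : Type*} (s : Finset ι) (α : ι → Cov A) (β : Cov A) :
    C.wedge β (∑ i ∈ s, α i) = ∑ i ∈ s, C.wedge β (α i) := by
  rw [wedge_swap, wedge_sum_left, ← Finset.sum_neg_distrib]
  exact Finset.sum_congr rfl fun i _ => (C.wedge_swap _ _).symm

lemma Dm_tens (c : Fin 4) (α β : Cov A) :
    C.Dm c (C.tens α β) = C.tens (C.Dv c α) β + C.tens α (C.Dv c β) := by
  refine mat_ext fun v => ?_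
  have h1 := C.Dv_mulVec c (C.tens α β) v
  rw [tens_mulVec, Dv_smul, pa_ip, tens_mulVec] at h1
  rw [Matrix.add_mulVec, tens_mulVec, tens_mulVec, ← sub_eq_iff_eq_add.mpr h1]
  module

lemma Dm_wedge (c : Fin 4) (α β : Cov A) :
    C.Dm c (C.wedge α β) = C.wedge (C.Dv c α) β + C.wedge α (C.Dv c β) := by
  simp only [wedge, Dm_sub, Dm_tens]; abel

/-- Metric compatibility read row by row: one of its two Christoffel terms cancels against the
connection term of `Dv`. The other one acts on the label `a`, which `Dv` does not treat as an index.
-/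
lemma Dv_θ (c a : Fin 4) : C.Dv c (C.θ a) = ∑ e, C.G c a e • C.θ e := by
  ext b
  have h1 := congrFun (congrFun (C.dm_g c) a) b
  rw [dm_apply] at h1
  simp only [Dv, dv_apply, θ, Pi.sub_apply, h1, Matrix.mulVec, dotProduct, Matrix.add_apply,
    Matrix.mul_apply, Matrix.transpose_apply, Finset.sum_apply, Pi.smul_apply, smul_eq_mul]
  rw [add_sub_assoc, sub_eq_zero.mpr, add_zero]
  exact Finset.sum_congr rfl fun i _ => mul_comm _ _

/-- The endomorphisms that are skew for the metric: the two-forms. -/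
def Skew (M : Mat A) : Prop := Mᵀ * C.h = -(C.h * M)

variable {C}

lemma Skew.ip_mulVec {M : Mat A} (hM : C.Skew M) (α β : Cov A) :
    C.ip (M *ᵥ α) β = -C.ip α (M *ᵥ β) := by
  have h1 : (M *ᵥ α) ⬝ᵥ (C.h *ᵥ β) = α ⬝ᵥ ((Mᵀ * C.h) *ᵥ β) := by
    rw [← Matrix.mulVec_mulVec, Matrix.dotProduct_mulVec α, ← Matrix.mulVec_transpose,
      Matrix.transpose_transpose]
  rw [ip, ip, h1, hM, Matrix.neg_mulVec, dotProduct_neg, Matrix.mulVec_mulVec]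

lemma skew_of_ip {M : Mat A} (hM : ∀ α β, C.ip (M *ᵥ α) β = -C.ip α (M *ᵥ β)) : C.Skew M := by
  have h1 : ∀ α β : Cov A, α ⬝ᵥ ((Mᵀ * C.h) *ᵥ β) = α ⬝ᵥ ((-(C.h * M)) *ᵥ β) := by
    intro α β
    have := hM α β
    rw [ip, ip] at this
    rw [← Matrix.mulVec_mulVec, Matrix.dotProduct_mulVec α, ← Matrix.mulVec_transpose,
      Matrix.transpose_transpose, this, Matrix.neg_mulVec, dotProduct_neg, Matrix.mulVec_mulVec]
  exact mat_ext fun v => dotProduct_eq _ _ fun w => by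
    rw [dotProduct_comm, h1, dotProduct_comm]

lemma Skew.add {M N : Mat A} (hM : C.Skew M) (hN : C.Skew N) : C.Skew (M + N) := by
  rw [Skew, Matrix.transpose_add, add_mul, hM, hN]; noncomm_ring

lemma Skew.sub {M N : Mat A} (hM : C.Skew M) (hN : C.Skew N) : C.Skew (M - N) := by
  rw [Skew, Matrix.transpose_sub, sub_mul, hM, hN]; noncomm_ring

lemma Skew.neg {M : Mat A} (hM : C.Skew M) : C.Skew (-M) := by
  rw [Skew, Matrix.transpose_neg, neg_mul, hM]; noncomm_ring

lemma Skew.smul {M : Mat A} (hM : C.Skew M) (f : A) : C.Skew (f • M) := by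
  rw [Skew, Matrix.transpose_smul, Matrix.smul_mul, hM, Matrix.mul_smul, smul_neg]

lemma Skew.commutator {M N : Mat A} (hM : C.Skew M) (hN : C.Skew N) : C.Skew (M * N - N * M) := by
  refine skew_of_ip fun α β => ?_
  simp only [Matrix.sub_mulVec, ← Matrix.mulVec_mulVec, ip_sub_left, ip_sub_right, hM.ip_mulVec,
    hN.ip_mulVec]
  ring

lemma Skew.conjugate {M N : Mat A} (hM : C.Skew M) (hN : C.Skew N) : C.Skew (M * N * M) := by
  refine skew_of_ip fun α β => ?_
  simp only [← Matrix.mulVec_mulVec, hM.ip_mulVec, hN.ip_mulVec]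
  ring

lemma skew_wedge (α β : Cov A) : C.Skew (C.wedge α β) := by
  refine skew_of_ip fun u v => ?_
  simp only [wedge_mulVec, ip_sub_left, ip_smul_left, C.ip_comm u]
  ring

lemma Skew.Dm {M : Mat A} (hM : C.Skew M) (c : Fin 4) : C.Skew (C.Dm c M) := by
  refine skew_of_ip fun α β => ?_
  have h1 := congrArg (C.pa c) (hM.ip_mulVec α β)
  rw [map_neg, pa_ip, pa_ip, Dv_mulVec, Dv_mulVec, ip_add_left, ip_add_right, hM.ip_mulVec,
    hM.ip_mulVec] at h1
  linear_combination h1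

lemma mul_tens (M : Mat A) (α β : Cov A) : M * C.tens α β = C.tens (M *ᵥ α) β :=
  mat_ext fun v => by
    rw [← Matrix.mulVec_mulVec, tens_mulVec, tens_mulVec, Matrix.mulVec_smul]

lemma Skew.tens_mul {M : Mat A} (hM : C.Skew M) (α β : Cov A) :
    C.tens α β * M = -C.tens α (M *ᵥ β) :=
  mat_ext fun v => by
    rw [← Matrix.mulVec_mulVec, tens_mulVec, Matrix.neg_mulVec, tens_mulVec, hM.ip_mulVec, neg_smul,
      neg_neg]

/-- The Lie algebra of skew endomorphisms acts on two-forms as a derivation; this action is the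
commutator. -/
lemma Skew.commutator_wedge {M : Mat A} (hM : C.Skew M) (α β : Cov A) :
    M * C.wedge α β - C.wedge α β * M = C.wedge (M *ᵥ α) β + C.wedge α (M *ᵥ β) := by
  simp only [wedge, mul_sub, sub_mul, mul_tens, hM.tens_mul]; abel

lemma trace_tens (α β : Cov A) : (C.tens α β).trace = C.ip β α := by
  rw [tens, Matrix.trace_vecMulVec, ip_comm, ip]

lemma Skew.trace {M : Mat A} (hM : C.Skew M) : M.trace = -M.trace := by
  have h1 : (C.g * (Mᵀ * C.h)).trace = M.trace := by
    rw [← mul_assoc, Matrix.trace_mul_comm, ← mul_assoc, C.h_mul_g, one_mul, Matrix.trace_transpose]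
  have h2 : (C.g * (C.h * M)).trace = M.trace := by rw [← mul_assoc, C.g_mul_h, one_mul]
  rw [hM, mul_neg, Matrix.trace_neg, h2] at h1
  exact h1.symm

variable (C)

/-! ### Contractions -/

/-- The coordinate differential `dx^c`. -/
def δ (c : Fin 4) : Cov A := Pi.single c 1

lemma sum_smul_δ (v : Cov A) : ∑ c, v c • δ c = v := by
  ext a; simp [δ, Pi.single_apply]

lemma mulVec_δ (M : Mat A) (a c : Fin 4) : (M *ᵥ δ c) a = M a c := by simp [δ]

lemma ip_δ (v : Cov A) (c : Fin 4) : C.ip v (δ c) = (C.h *ᵥ v) c := by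
  rw [ip_comm, ip, δ, single_one_dotProduct]

/-- The families `δ` and `θ` are dual bases for `ip`. This resolution of the identity, with
`sum_smul_δ`, replaces index contractions below. -/
lemma sum_ip_δ_smul_θ (v : Cov A) : ∑ c, C.ip v (δ c) • C.θ c = v := by
  ext a
  have h1 : C.g *ᵥ (C.h *ᵥ v) = v := by rw [Matrix.mulVec_mulVec, C.g_mul_h, Matrix.one_mulVec]
  conv_rhs => rw [← h1]
  simp only [Finset.sum_apply, Pi.smul_apply, smul_eq_mul, ip_δ, θ, Matrix.mulVec, dotProduct,
    C.g_comm _ a]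
  exact Finset.sum_congr rfl fun i _ => mul_comm _ _

lemma sum_ip_θ_δ (M : Mat A) : ∑ c, C.ip (C.θ c) (M *ᵥ δ c) = M.trace := by
  simp only [ip_θ, mulVec_δ]; rfl

/-- An endomorphism of trace form: `∑ ⟨dx^c, M θ_c⟩ = tr M`. -/
lemma sum_ip_δ_θ (M : Mat A) : ∑ c, C.ip (M *ᵥ C.θ c) (δ c) = M.trace := by
  have h1 : ∀ c, C.ip (M *ᵥ C.θ c) (δ c) = (C.h * M * C.g) c c := by
    intro c
    have h2 : C.θ c = C.g *ᵥ δ c := by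
      ext a; rw [mulVec_δ, C.g_comm]; rfl
    rw [ip_δ, h2, Matrix.mulVec_mulVec, Matrix.mulVec_mulVec, mulVec_δ, mul_assoc]
  simp only [h1]
  change (C.h * M * C.g).trace = _
  rw [Matrix.trace_mul_comm, ← mul_assoc, C.g_mul_h, one_mul]

lemma θ_eq_mulVec_δ (c : Fin 4) : C.θ c = C.g *ᵥ δ c := by
  ext a; rw [mulVec_δ, C.g_comm]; rfl

lemma sum_h_smul_θ (c : Fin 4) : ∑ a, C.h c a • C.θ a = δ c := by
  have := C.sum_ip_δ_smul_θ (δ c)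
  simp only [ip_δ, mulVec_δ] at this
  simpa only [C.h_comm c] using this

/-- The gradient of a function. -/
def grd (f : A) : Cov A := fun a => C.pa a f

lemma Dv_grd_symm (f : A) (a b : Fin 4) : C.Dv a (C.grd f) b = C.Dv b (C.grd f) a := by
  simp only [Dv, dv, grd, Pi.sub_apply, C.pa_comm a b, Matrix.mulVec, dotProduct, C.G_symm a b]

/-! ### Curvature -/

/-- The curvature endomorphisms, `Rm a b c d = R_{abc}^d`. -/
def Rm (a b : Fin 4) : Mat A :=
  C.dm a (C.G b) - C.dm b (C.G a) - (C.G a * C.G b - C.G b * C.G a)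

lemma Rm_swap (a b : Fin 4) : C.Rm b a = -C.Rm a b := by
  simp only [Rm]; abel

lemma dm_neg (c : Fin 4) (M : Mat A) : C.dm c (-M) = -C.dm c M := by
  ext a b; simp [dm_apply]

/-- Jacobi identity for the commutators of the operators `∂_a - G_a`. The labels of `Rm` are not
differentiated, so absence of torsion plays no role here. -/
lemma bianchi_second (a b c : Fin 4) :
    C.Dm a (C.Rm b c) + C.Dm b (C.Rm c a) + C.Dm c (C.Rm a b) = 0 := by
  simp only [Dm, Rm, dm_sub, dm_mul]
  rw [C.dm_comm b a (C.G c), C.dm_comm c a (C.G b), C.dm_comm c b (C.G a)]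
  noncomm_ring

lemma bianchi_first (a b c d : Fin 4) : C.Rm a b c d + C.Rm b c a d + C.Rm c a b d = 0 := by
  simp only [Rm, Matrix.sub_apply, dm_apply, Matrix.mul_apply]
  rw [C.G_symm b a d, C.G_symm c b d, C.G_symm c a d]
  simp only [C.G_symm b a, C.G_symm c b, C.G_symm c a]
  ring

lemma Dv_Dv_sub (a b : Fin 4) (α : Cov A) :
    C.Dv a (C.Dv b α) - C.Dv b (C.Dv a α) = -(C.Rm a b *ᵥ α) := by
  simp only [Dv, Rm, dv_sub, dv_mulVec, Matrix.mulVec_sub, Matrix.sub_mulVec,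
    ← Matrix.mulVec_mulVec]
  rw [C.dv_comm b a]
  abel

lemma Dm_Dm_sub (a b : Fin 4) (M : Mat A) :
    C.Dm a (C.Dm b M) - C.Dm b (C.Dm a M) = -(C.Rm a b * M - M * C.Rm a b) := by
  simp only [Dm, Rm, dm_sub, dm_mul]
  rw [C.dm_comm b a]
  noncomm_ring

/-- The commutator of two derivatives annihilates the function `ip α β`; expanding by compatibility
leaves the skewness. -/
lemma skew_Rm (a b : Fin 4) : C.Skew (C.Rm a b) := by
  refine skew_of_ip fun α β => ?_
  have h1 := C.pa_comm a b (C.ip α β)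
  simp only [pa_ip, map_add] at h1
  have h2 := congrArg (fun v => C.ip v β) (C.Dv_Dv_sub a b α)
  have h3 := congrArg (fun v => C.ip α v) (C.Dv_Dv_sub a b β)
  simp only [ip_sub_left, ip_neg_left, ip_sub_right, ip_neg_right] at h2 h3
  linear_combination h2 + h3 - h1

/-- The second covariant derivative `∇_c ∇_a α`. -/
def DDv (c a : Fin 4) (α : Cov A) : Cov A := C.Dv c (C.Dv a α) - ∑ e, C.G c a e • C.Dv e α

/-- The second covariant derivative `∇_c ∇_a M`. -/
def DDm (c a : Fin 4) (M : Mat A) : Mat A := C.Dm c (C.Dm a M) - ∑ e, C.G c a e • C.Dm e M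

/-- Symmetry of the Christoffel symbols cancels the correction terms, which leaves the Ricci
identity. -/
lemma DDv_sub (c a : Fin 4) (α : Cov A) :
    C.DDv c a α - C.DDv a c α = -(C.Rm c a *ᵥ α) := by
  rw [← Dv_Dv_sub, DDv, DDv]
  simp only [C.G_symm c a]
  abel

lemma DDm_sub (c a : Fin 4) (M : Mat A) :
    C.DDm c a M - C.DDm a c M = -(C.Rm c a * M - M * C.Rm c a) := by
  rw [← Dm_Dm_sub, DDm, DDm]
  simp only [C.G_symm c a]
  abel

lemma DDv_mulVec (c a : Fin 4) (M : Mat A) (α : Cov A) :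
    C.DDv c a (M *ᵥ α) = C.DDm c a M *ᵥ α + C.Dm a M *ᵥ C.Dv c α + C.Dm c M *ᵥ C.Dv a α
      + M *ᵥ C.DDv c a α := by
  simp only [DDv, DDm, Dv_mulVec, Dv_add, Matrix.mulVec_sub, Matrix.sub_mulVec, smul_add,
    Finset.sum_add_distrib, Matrix.mulVec_sum, Matrix.sum_mulVec, Matrix.mulVec_smul,
    Matrix.smul_mulVec]
  abel

end Calc

namespace Calc

variable {A : Type*} [CommRing A] [Algebra ℂ A] (C : Calc A)

/-! ### Division by integers -/

lemma isUnit_natCast (n : ℕ) (hn : n ≠ 0) : IsUnit (n : A) := by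
  have h1 : IsUnit (n : ℂ) := (Nat.cast_ne_zero.mpr hn).isUnit
  simpa using h1.map (algebraMap ℂ A)

lemma isUnit_two : IsUnit (2 : A) := by simpa using isUnit_natCast (A := A) 2 two_ne_zero

lemma isUnit_four : IsUnit (4 : A) := by simpa using isUnit_natCast (A := A) 4 four_ne_zero

variable {C} in
lemma Skew.trace_eq_zero {M : Mat A} (hM : C.Skew M) : M.trace = 0 := by
  refine (isUnit_two (A := A)).mul_left_cancel ?_
  linear_combination hM.trace

lemma mul_g_cancel {M N : Mat A} (hMN : ∀ d, M *ᵥ C.θ d = N *ᵥ C.θ d) : M = N := by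
  have h1 : M * C.g = N * C.g := by
    refine Matrix.ext_of_mulVec_single fun d => ?_
    have := hMN d
    rwa [C.θ_eq_mulVec_δ, Matrix.mulVec_mulVec, Matrix.mulVec_mulVec] at this
  calc M = M * (C.g * C.h) := by rw [C.g_mul_h, mul_one]
    _ = N * (C.g * C.h) := by rw [← mul_assoc, h1, mul_assoc]
    _ = N := by rw [C.g_mul_h, mul_one]

/-! ### Type D backgrounds -/

/-- The algebraic content of a vacuum background of type D: `j` is twice the dyad two-form, `Ψ` the
Weyl scalar, `3 μ` the cosmological constant and `p = dΨ / (3 Ψ)`. -/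
structure IsTypeD (j : Mat A) (Ψ μ : A) (p : Cov A) : Prop where
  skew : C.Skew j
  sq : j * j = 1
  commute_of : ∀ X N : Mat A, C.Skew X → X * j = j * X → (X * j).trace = 0 → C.Skew N →
    N * j = -(j * N) → N * X = X * N
  dual_parallel : ∀ N T : Mat A, C.Skew N → N * j = -(j * N) → C.Skew T →
    (N * T).trace • j + (j * T).trace • N - (2 : A) • (N * T * j) - (2 : A) • (j * T * N) = 0
  commute_curv : ∀ a b, (C.Rm a b - (Ψ + μ) • C.wedge (C.θ a) (C.θ b)) * j
    = j * (C.Rm a b - (Ψ + μ) • C.wedge (C.θ a) (C.θ b))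
  trace_curv : ∀ a b, (C.Rm a b * j).trace = (4 * Ψ - 2 * μ) * (j *ᵥ C.θ b) a
  ricci : ∀ a, ∑ c, C.Rm a c *ᵥ δ c = (3 * μ) • C.θ a
  pa_Ψ : ∀ c, C.pa c Ψ = 3 * Ψ * p c
  pa_μ : ∀ c, C.pa c μ = 0
  closed : ∀ a b, C.Dv a p b = C.Dv b p a
  isUnit : IsUnit Ψ

variable {C}

lemma wedge_mul (M : Mat A) (hM : C.Skew M) (α β : Cov A) :
    M * C.wedge α β * M = -C.wedge (M *ᵥ α) (M *ᵥ β) := by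
  simp only [wedge, mul_sub, sub_mul, mul_tens, hM.tens_mul]; abel

lemma skew_θ {j : Mat A} (hj : C.Skew j) (a b : Fin 4) : (j *ᵥ C.θ b) a = -(j *ᵥ C.θ a) b := by
  have := hj.ip_mulVec (C.θ a) (C.θ b)
  rw [C.ip_comm, ip_θ, ip_θ] at this
  rw [this, neg_neg]

lemma trace_wedge_mul {j : Mat A} (hj : C.Skew j) (a b : Fin 4) :
    (C.wedge (C.θ a) (C.θ b) * j).trace = -2 * (j *ᵥ C.θ b) a := by
  rw [wedge, sub_mul, hj.tens_mul, hj.tens_mul, Matrix.trace_sub, Matrix.trace_neg,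
    Matrix.trace_neg,
    trace_tens, trace_tens, C.ip_comm, ip_θ, C.ip_comm, ip_θ, skew_θ hj b a]
  ring

/-- The derivative of `j² = 1`. In terms of duality it says that the derivative of `j` stays in the
same half of the two-forms as `j`. -/
lemma anticomm_of_sq {j : Mat A} (hj : j * j = 1) (e : Fin 4) :
    C.Dm e j * j = -(j * C.Dm e j) := by
  have h1 := C.Dm_mul e j j
  rw [hj, Dm_one] at h1
  exact eq_neg_of_add_eq_zero_left h1.symm

/-- Absence of torsion: the Christoffel terms on the labels are symmetric in two labels and cancel
against the antisymmetry of the wedge. -/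
lemma sum_cyclic_wedge_θ (a b c : Fin 4) :
    C.Dm a (C.wedge (C.θ b) (C.θ c)) + C.Dm b (C.wedge (C.θ c) (C.θ a))
      + C.Dm c (C.wedge (C.θ a) (C.θ b)) = 0 := by
  simp only [Dm_wedge, Dv_θ, C.G_symm b a, C.G_symm c a, C.G_symm c b]
  rw [C.wedge_swap (C.θ c) (∑ e, C.G a b e • C.θ e), C.wedge_swap (C.θ b) (∑ e, C.G a c e • C.θ e),
    C.wedge_swap (C.θ a) (∑ e, C.G b c e • C.θ e)]
  abel

/-- The Bianchi identity in the form of a cyclic identity for `j`. -/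
lemma IsTypeD.cyclic {j : Mat A} {Ψ μ : A} {p : Cov A} (H : C.IsTypeD j Ψ μ p) (e a b : Fin 4) :
    (j *ᵥ C.θ b) a • (C.Dm e j * j) + (j *ᵥ C.θ e) b • (C.Dm a j * j)
        + (j *ᵥ C.θ a) e • (C.Dm b j * j)
      = p e • (j * C.wedge (C.θ a) (C.θ b) - C.wedge (C.θ a) (C.θ b) * j)
        + p a • (j * C.wedge (C.θ b) (C.θ e) - C.wedge (C.θ b) (C.θ e) * j)
        + p b • (j * C.wedge (C.θ e) (C.θ a) - C.wedge (C.θ e) (C.θ a) * j) := by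
  -- `S a b` is a multiple of `j` plus a form of the opposite duality. The derivative of `j`
  -- commutes with the second part, so only the multiple of `j` contributes to the commutator
  -- `hcomm`.
  let S : Fin 4 → Fin 4 → Mat A := fun a b => C.Rm a b - (Ψ + μ) • C.wedge (C.θ a) (C.θ b)
  have hS : ∀ a b, C.Skew (S a b) := fun a b => (C.skew_Rm a b).sub ((skew_wedge _ _).smul _)
  have hSj : ∀ a b, S a b * j = j * S a b := H.commute_curv
  have htr : ∀ a b, (S a b * j).trace = 6 * Ψ * (j *ᵥ C.θ b) a := by
    intro a b
    simp only [S, sub_mul, Matrix.smul_mul, Matrix.trace_sub, Matrix.trace_smul, H.trace_curv,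
      trace_wedge_mul H.skew, smul_eq_mul]
    ring
  have hcomm : ∀ e a b, C.Dm e j * S a b - S a b * C.Dm e j
      = (3 * Ψ * (j *ᵥ C.θ b) a) • (C.Dm e j * j) := by
    intro e a b
    have h0 := anticomm_of_sq (C := C) H.sq e
    set z := (j *ᵥ C.θ b) a
    -- The coefficient of `j` is fixed by the trace condition: `2 S` has trace `12 Ψ z` against `j`,
    -- and `tr (j j) = 4`.
    have h1 := H.commute_of ((2 : A) • S a b - (3 * Ψ * z) • j) (C.Dm e j)
      (((hS a b).smul _).sub (H.skew.smul _))
      (by simp only [sub_mul, mul_sub, Matrix.smul_mul, Matrix.mul_smul, hSj])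
      (by
        simp only [sub_mul, Matrix.smul_mul, Matrix.trace_sub, Matrix.trace_smul, htr, H.sq,
          Matrix.trace_one, smul_eq_mul, Fintype.card_fin]
        push_cast; ring)
      (H.skew.Dm e) h0
    simp only [mul_sub, sub_mul, Matrix.mul_smul, Matrix.smul_mul] at h1
    have h2 : j * C.Dm e j = -(C.Dm e j * j) := by rw [h0, neg_neg]
    rw [h2] at h1
    refine (isUnit_two (A := A)).smul_left_cancel.mp ?_
    linear_combination (norm := module) h1
  have hD : ∀ e a b, C.Dm e (S a b) * j - j * C.Dm e (S a b)
      = (3 * Ψ * (j *ᵥ C.θ b) a) • (C.Dm e j * j) := by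
    intro e a b
    rw [← hcomm]
    have h1 := congrArg (C.Dm e) (hSj a b)
    rw [Dm_mul, Dm_mul] at h1
    linear_combination (norm := module) h1
  -- By the second Bianchi identity only the derivative `3 Ψ p` of the scalar `Ψ + μ` survives the
  -- cyclic sum.
  have hcyc : C.Dm e (S a b) + C.Dm a (S b e) + C.Dm b (S e a)
      = -((3 * Ψ) • (p e • C.wedge (C.θ a) (C.θ b) + p a • C.wedge (C.θ b) (C.θ e)
        + p b • C.wedge (C.θ e) (C.θ a))) := by
    have h1 := C.bianchi_second e a b
    have h2 := sum_cyclic_wedge_θ (C := C) e a b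
    simp only [S, Dm_sub, Dm_smul, map_add, H.pa_Ψ, H.pa_μ, add_zero]
    linear_combination (norm := module) h1 - (Ψ + μ) • h2
  have h3 : IsUnit (3 * Ψ) := by
    have : IsUnit (3 : A) := by simpa using isUnit_natCast (A := A) 3 (by norm_num)
    exact this.mul H.isUnit
  refine h3.smul_left_cancel.mp ?_
  have h4 := hD e a b
  have h5 := hD a b e
  have h6 := hD b e a
  have h7 := congrArg (fun X => X * j - j * X) hcyc
  simp only [add_mul, mul_add, Matrix.smul_mul, Matrix.mul_smul, neg_mul, mul_neg] at h7
  linear_combination (norm := module) h7 - h4 - h5 - h6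

end Calc

/-! ### The Killing spinor equation and its integrability condition -/

namespace Calc

variable {A : Type*} [CommRing A] [Algebra ℂ A] {C : Calc A}

lemma tens_θ_apply (a b c d : Fin 4) :
    C.tens (C.θ a) (C.θ b) c d = C.g c a * (1 : Mat A) b d := by
  have h1 : C.h *ᵥ C.θ b = δ b := by
    rw [θ_eq_mulVec_δ, Matrix.mulVec_mulVec, C.h_mul_g, Matrix.one_mulVec]
  rw [tens, Matrix.vecMulVec_apply, h1, Matrix.one_apply, δ, Pi.single_apply, θ, C.g_comm]
  simp only [eq_comm]

lemma sum_smul_tens_θ (U : Mat A) :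
    ∑ a, ∑ b, U a b • C.tens (C.θ a) (C.θ b) = C.g * U := by
  ext c d
  simp only [Matrix.sum_apply, Matrix.smul_apply, tens_θ_apply, smul_eq_mul, Matrix.mul_apply,
    Matrix.one_apply, mul_ite, mul_one, mul_zero, Finset.sum_ite_eq', Finset.mem_univ, if_true]
  exact Finset.sum_congr rfl fun i _ => mul_comm _ _

lemma sum_smul_wedge_θ {U : Mat A} (hU : Uᵀ = -U) :
    ∑ a, ∑ b, U a b • C.wedge (C.θ a) (C.θ b) = (2 : A) • (C.g * U) := by
  have h1 : ∑ a, ∑ b, U a b • C.tens (C.θ b) (C.θ a) = -(C.g * U) := by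
    rw [Finset.sum_comm, ← sum_smul_tens_θ, ← Finset.sum_neg_distrib]
    refine Finset.sum_congr rfl fun a _ => ?_
    rw [← Finset.sum_neg_distrib]
    refine Finset.sum_congr rfl fun b _ => ?_
    have := congrFun (congrFun hU a) b
    rw [Matrix.transpose_apply, Matrix.neg_apply] at this
    rw [this, neg_smul]
  simp only [wedge, smul_sub, Finset.sum_sub_distrib, h1, sum_smul_tens_θ]
  module

lemma Skew.h_mul_transpose {j : Mat A} (hj : C.Skew j) : (C.h * j)ᵀ = -(C.h * j) := by
  rw [Matrix.transpose_mul, C.h_symm, hj]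

/-- The conformal Killing–Yano equation of the dyad two-form. -/
theorem IsTypeD.Dm_j {j : Mat A} {Ψ μ : A} {p : Cov A} (H : C.IsTypeD j Ψ μ p) (e : Fin 4) :
    C.Dm e j = j * C.wedge (C.θ e) p - C.wedge (C.θ e) p * j := by
  let L : Mat A →ₗ[A] Mat A :=
    { toFun := fun w => (j * w - w * j) * j
      map_add' := fun x y => by noncomm_ring
      map_smul' := fun f x => by
        simp only [Matrix.mul_smul, Matrix.smul_mul, smul_sub, sub_mul, RingHom.id_apply] }
  have hL : ∀ w, L w = (j * w - w * j) * j := fun _ => rfl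
  set z : Mat A := j * C.g with hz
  have hzab : ∀ a b, (j *ᵥ C.θ b) a = z a b := fun a b => by
    rw [C.θ_eq_mulVec_δ, Matrix.mulVec_mulVec, mulVec_δ]
  have hcyc : ∀ a b, z a b • C.Dm e j + z b e • C.Dm a j + z e a • C.Dm b j
      = p e • L (C.wedge (C.θ a) (C.θ b)) + p a • L (C.wedge (C.θ b) (C.θ e))
        + p b • L (C.wedge (C.θ e) (C.θ a)) := by
    intro a b
    have h1 := congrArg (· * j) (H.cyclic e a b)
    simp only [add_mul, Matrix.smul_mul, mul_assoc, H.sq, mul_one, hzab] at h1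
    simp only [hL, sub_mul, mul_assoc] at h1 ⊢
    exact h1
  -- `U` is the inverse of `z`. Contracting the cyclic identity with it gives the coefficients `-4 +
  -- 1 + 1 = -2` for `D_e j`, so the identity can be solved for this derivative.
  set U : Mat A := C.h * j with hU
  have hUt : Uᵀ = -U := H.skew.h_mul_transpose
  have hUz : U * z = 1 := by
    rw [hU, hz, mul_assoc, ← mul_assoc j, H.sq, one_mul, C.h_mul_g]
  have hzU : z * U = 1 := by
    rw [hU, hz, mul_assoc, ← mul_assoc C.g, C.g_mul_h, one_mul, H.sq]
  have hgU : C.g * U = j := by rw [hU, ← mul_assoc, C.g_mul_h, one_mul]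
  have h1 : ∑ a, ∑ b, U a b * z a b = -4 := by
    have : ∑ a, ∑ b, U a b * z a b = (Uᵀ * z).trace := by
      simp only [Matrix.trace, Matrix.diag, Matrix.mul_apply, Matrix.transpose_apply]
      exact Finset.sum_comm
    rw [this, hUt, neg_mul, hUz, Matrix.trace_neg, Matrix.trace_one, Fintype.card_fin]
    norm_num
  have h2 : ∑ a, ∑ b, (U a b * z b e) • C.Dm a j = C.Dm e j := by
    simp only [← Finset.sum_smul, ← Matrix.mul_apply, hUz, Matrix.one_apply, ite_smul, one_smul,
      zero_smul, Finset.sum_ite_eq', Finset.mem_univ, if_true]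
  have h3 : ∑ a, ∑ b, (U a b * z e a) • C.Dm b j = C.Dm e j := by
    rw [Finset.sum_comm]
    simp only [← Finset.sum_smul, mul_comm (U _ _), ← Matrix.mul_apply, hzU, Matrix.one_apply,
      ite_smul, one_smul, zero_smul, Finset.sum_ite_eq, Finset.mem_univ, if_true]
  have hθ : ∑ a, ∑ b, (U a b * p b) • C.θ a = j *ᵥ p := by
    rw [← hgU, ← Matrix.mulVec_mulVec]
    ext c
    simp only [Finset.sum_apply, Pi.smul_apply, smul_eq_mul, θ, Matrix.mulVec, dotProduct,
      ← Finset.sum_mul]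
    exact Finset.sum_congr rfl fun i _ => by rw [mul_comm, C.g_comm]
  have hθ' : ∑ a, ∑ b, (U a b * p a) • C.θ b = -(j *ᵥ p) := by
    rw [Finset.sum_comm, ← hθ, ← Finset.sum_neg_distrib]
    refine Finset.sum_congr rfl fun a _ => ?_
    rw [← Finset.sum_neg_distrib]
    refine Finset.sum_congr rfl fun b _ => ?_
    have := congrFun (congrFun hUt a) b
    rw [Matrix.transpose_apply, Matrix.neg_apply] at this
    rw [this, neg_mul, neg_smul]
  have h4 : ∑ a, ∑ b, (U a b * p a) • L (C.wedge (C.θ b) (C.θ e))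
      = -L (C.wedge (j *ᵥ p) (C.θ e)) := by
    rw [← map_neg, ← wedge_neg_left, ← hθ', wedge_sum_left, map_sum]
    simp only [wedge_sum_left, wedge_smul_left, map_sum, map_smul]
  have h5 : ∑ a, ∑ b, (U a b * p b) • L (C.wedge (C.θ e) (C.θ a))
      = -L (C.wedge (j *ᵥ p) (C.θ e)) := by
    rw [C.wedge_swap (j *ᵥ p), map_neg, neg_neg, ← hθ, wedge_sum_right, map_sum]
    simp only [wedge_sum_right, wedge_smul_right, map_sum, map_smul]
  -- The `p_e` term contracts to the commutator of `j` with `2 j`.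
  have h6 : ∑ a, ∑ b, (U a b * p e) • L (C.wedge (C.θ a) (C.θ b)) = 0 := by
    have : L (∑ a, ∑ b, U a b • C.wedge (C.θ a) (C.θ b)) = 0 := by
      rw [sum_smul_wedge_θ hUt, hgU, hL, Matrix.mul_smul, Matrix.smul_mul, sub_self, zero_mul]
    have h7 : ∑ a, ∑ b, (U a b * p e) • L (C.wedge (C.θ a) (C.θ b))
        = p e • L (∑ a, ∑ b, U a b • C.wedge (C.θ a) (C.θ b)) := by
      simp only [map_sum, map_smul, Finset.smul_sum, smul_smul, mul_comm]
    rw [h7, this, smul_zero]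
  have h8 : ∑ a, ∑ b, U a b • (z a b • C.Dm e j + z b e • C.Dm a j + z e a • C.Dm b j)
      = ∑ a, ∑ b, U a b • (p e • L (C.wedge (C.θ a) (C.θ b)) + p a • L (C.wedge (C.θ b) (C.θ e))
        + p b • L (C.wedge (C.θ e) (C.θ a))) := by
    simp only [hcyc]
  simp only [smul_add, smul_smul, Finset.sum_add_distrib, h2, h3, h4, h5, h6] at h8
  simp only [← Finset.sum_smul, h1] at h8
  have h9 : C.Dm e j = L (C.wedge (j *ᵥ p) (C.θ e)) := by
    refine (isUnit_two (A := A)).smul_left_cancel.mp ?_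
    linear_combination (norm := module) -h8
  have h10 : j *ᵥ (j *ᵥ p) = p := by rw [Matrix.mulVec_mulVec, H.sq, Matrix.one_mulVec]
  rw [h9, hL, sub_mul, wedge_mul j H.skew, h10, mul_assoc (C.wedge _ _), H.sq, mul_one,
    H.skew.commutator_wedge, C.wedge_swap p, C.wedge_swap (j *ᵥ p)]
  abel

/-- The covariant derivative of a covector as an endomorphism, `∂_d ↦ ∇_d α`. -/
def nab (C : Calc A) (α : Cov A) : Mat A := (Matrix.of fun a d => C.Dv d α a) * C.h

lemma nab_θ (α : Cov A) (d : Fin 4) : C.nab α *ᵥ C.θ d = C.Dv d α := by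
  rw [nab, θ_eq_mulVec_δ, Matrix.mulVec_mulVec, mul_assoc, C.h_mul_g, mul_one]
  ext a
  rw [mulVec_δ, Matrix.of_apply]

/-- The divergence of a covector. -/
def dvg (C : Calc A) (α : Cov A) : A := (C.nab α).trace

lemma dvg_eq (α : Cov A) : C.dvg α = ∑ c, C.ip (C.Dv c α) (δ c) := by
  rw [dvg, ← sum_ip_δ_θ (C := C)]
  simp only [nab_θ]

/-- Closed covectors have selfadjoint derivative. -/
lemma ip_nab {α : Cov A} (hα : ∀ a b, C.Dv a α b = C.Dv b α a) (u v : Cov A) :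
    C.ip (C.nab α *ᵥ u) v = C.ip u (C.nab α *ᵥ v) := by
  have h1 : ∀ u v : Cov A, C.ip (C.nab α *ᵥ u) v
      = (C.h *ᵥ v) ⬝ᵥ ((Matrix.of fun a d => C.Dv d α a) *ᵥ (C.h *ᵥ u)) := by
    intro u v
    rw [ip, nab, Matrix.mulVec_mulVec, dotProduct_comm]
  have h2 : (Matrix.of fun a d => C.Dv d α a)ᵀ = Matrix.of fun a d => C.Dv d α a := by
    ext a d
    simp only [Matrix.transpose_apply, Matrix.of_apply, hα a d]
  rw [h1, C.ip_comm u, h1, Matrix.dotProduct_mulVec, dotProduct_comm, ← Matrix.mulVec_transpose, h2]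

/-- The symmetric tensor `2 ∇p - 2 p ⊗ p + (p² + Ψ + μ) g`. -/
def schouten (C : Calc A) (Ψ μ : A) (p : Cov A) : Mat A :=
  (2 : A) • C.nab p - (2 : A) • C.tens p p + (C.ip p p + Ψ + μ) • (1 : Mat A)

lemma schouten_θ (Ψ μ : A) (p : Cov A) (d : Fin 4) : C.schouten Ψ μ p *ᵥ C.θ d
    = (2 : A) • C.Dv d p - (2 * p d) • p + (C.ip p p + Ψ + μ) • C.θ d := by
  simp only [schouten, Matrix.add_mulVec, Matrix.sub_mulVec, Matrix.smul_mulVec, nab_θ, tens_mulVec,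
    Matrix.one_mulVec, C.ip_comm p (C.θ d), ip_θ, smul_smul]

lemma ip_schouten {Ψ μ : A} {p : Cov A} (hp : ∀ a b, C.Dv a p b = C.Dv b p a) (u v : Cov A) :
    C.ip (C.schouten Ψ μ p *ᵥ u) v = C.ip u (C.schouten Ψ μ p *ᵥ v) := by
  simp only [schouten, Matrix.add_mulVec, Matrix.sub_mulVec, Matrix.smul_mulVec, tens_mulVec,
    Matrix.one_mulVec, ip_add_left, ip_add_right, ip_sub_left, ip_sub_right, ip_smul_left,
    ip_smul_right, ip_nab hp, C.ip_comm u p]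
  ring

/-- The integrability condition of the conformal Killing–Yano equation. -/
lemma IsTypeD.commutator_schouten {j : Mat A} {Ψ μ : A} {p : Cov A} (H : C.IsTypeD j Ψ μ p)
    (c d : Fin 4) :
    C.wedge (j *ᵥ C.θ c) (C.schouten Ψ μ p *ᵥ C.θ d)
      + C.wedge (C.θ c) (j *ᵥ (C.schouten Ψ μ p *ᵥ C.θ d))
      - C.wedge (j *ᵥ C.θ d) (C.schouten Ψ μ p *ᵥ C.θ c)
      - C.wedge (C.θ d) (j *ᵥ (C.schouten Ψ μ p *ᵥ C.θ c)) = 0 := by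
  let a : Fin 4 → Mat A := fun c => C.wedge (C.θ c) p
  have hN : ∀ c, C.Dm c j = j * a c - a c * j := H.Dm_j
  have hDa : ∀ d c, C.Dm d (a c) = ∑ e, C.G d c e • a e + C.wedge (C.θ c) (C.Dv d p) := by
    intro d c
    simp only [a, Dm_wedge, Dv_θ, wedge_sum_left, wedge_smul_left]
  have haa : a d * a c - a c * a d
      = p c • C.wedge (C.θ d) p + C.ip p p • C.wedge (C.θ c) (C.θ d)
        - p d • C.wedge (C.θ c) p := by
    have h1 : a d *ᵥ C.θ c = p c • C.θ d - C.ip (C.θ d) (C.θ c) • p := by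
      rw [wedge_mulVec, C.ip_comm p, ip_θ]
    have h2 : a d *ᵥ p = C.ip p p • C.θ d - p d • p := by
      rw [wedge_mulVec, ip_θ]
    rw [(skew_wedge (C := C) (C.θ d) p).commutator_wedge]
    change C.wedge (a d *ᵥ C.θ c) p + C.wedge (C.θ c) (a d *ᵥ p) = _
    rw [h1, h2, sub_eq_add_neg, sub_eq_add_neg, wedge_add_left, wedge_add_right, ← neg_smul,
      ← neg_smul]
    simp only [wedge_smul_left, wedge_smul_right, wedge_self]
    module
  have hDD := C.Dm_Dm_sub d c j
  have hcurv := H.commute_curv d c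
  -- The Christoffel terms in `hDa` are symmetric in the two labels and drop out of the
  -- antisymmetrised second derivative.
  have h3 : C.Dm d (C.Dm c j) - C.Dm c (C.Dm d j)
      = j * (a d * a c - a c * a d) - (a d * a c - a c * a d) * j
        + (j * (C.wedge (C.θ c) (C.Dv d p) - C.wedge (C.θ d) (C.Dv c p))
          - (C.wedge (C.θ c) (C.Dv d p) - C.wedge (C.θ d) (C.Dv c p)) * j) := by
    rw [hN c, hN d]
    simp only [Dm_sub, Dm_mul, hN, hDa, C.G_symm d c]
    noncomm_ring
  -- The factor two and the terms of `schouten` are chosen so that the Ricci identity for `j`, after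
  -- subtraction of the part of the curvature that commutes with `j`, reads `[j, w] = 0`.
  set w : Mat A := C.wedge (C.θ c) (C.schouten Ψ μ p *ᵥ C.θ d)
      - C.wedge (C.θ d) (C.schouten Ψ μ p *ᵥ C.θ c) with hw
  have hwe : w = (2 : A) • ((a d * a c - a c * a d)
      + (C.wedge (C.θ c) (C.Dv d p) - C.wedge (C.θ d) (C.Dv c p))
      - (Ψ + μ) • C.wedge (C.θ d) (C.θ c)) := by
    rw [haa, hw, schouten_θ, schouten_θ]
    simp only [sub_eq_add_neg, ← neg_smul, wedge_add_right, wedge_smul_right]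
    rw [C.wedge_swap (C.θ d) (C.θ c)]
    module
  have hjw : j * w - w * j = 0 := by
    rw [hwe]
    rw [sub_mul, mul_sub, Matrix.smul_mul, Matrix.mul_smul] at hcurv
    rw [h3] at hDD
    simp only [mul_add, add_mul, mul_sub, sub_mul, Matrix.smul_mul, Matrix.mul_smul] at hDD ⊢
    linear_combination (norm := module) (2 : A) • hDD - (2 : A) • hcurv
  have h4 := H.skew.commutator_wedge (C.θ c) (C.schouten Ψ μ p *ᵥ C.θ d)
  have h5 := H.skew.commutator_wedge (C.θ d) (C.schouten Ψ μ p *ᵥ C.θ c)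
  rw [hw, mul_sub, sub_mul] at hjw
  linear_combination (norm := module) hjw - h4 + h5

/-- A skew endomorphism is trace-orthogonal to a selfadjoint one, and `schouten` is selfadjoint
because `p` is closed. -/
lemma IsTypeD.trace_j_mul {j : Mat A} {Ψ μ : A} {p : Cov A} (H : C.IsTypeD j Ψ μ p) :
    (j * C.schouten Ψ μ p).trace = 0 := by
  have h1 : (j * C.schouten Ψ μ p).trace = -(j * C.schouten Ψ μ p).trace := by
    conv_lhs => rw [← sum_ip_δ_θ (C := C)]
    rw [Matrix.trace_mul_comm j]
    rw [← sum_ip_θ_δ (C := C), ← Finset.sum_neg_distrib]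
    refine Finset.sum_congr rfl fun c _ => ?_
    rw [← Matrix.mulVec_mulVec, ← Matrix.mulVec_mulVec, H.skew.ip_mulVec, ip_schouten H.closed]
  refine (isUnit_two (A := A)).mul_left_cancel ?_
  linear_combination h1

/-- Contracting the integrability condition over one label gives `[B, j] = (tr B) j`. Multiplied by
`j` and traced, the left side vanishes by cyclicity and the right side is `4 tr B`; so both sides
are zero. -/
lemma IsTypeD.schouten_facts {j : Mat A} {Ψ μ : A} {p : Cov A} (H : C.IsTypeD j Ψ μ p) :
    C.schouten Ψ μ p * j = j * C.schouten Ψ μ p ∧ (C.schouten Ψ μ p).trace = 0 := by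
  set B := C.schouten Ψ μ p with hB
  have h1 : B * j - j * B = B.trace • j := by
    refine C.mul_g_cancel fun d => ?_
    have h2 : ∑ c, (C.wedge (j *ᵥ C.θ c) (B *ᵥ C.θ d) + C.wedge (C.θ c) (j *ᵥ (B *ᵥ C.θ d))
        - C.wedge (j *ᵥ C.θ d) (B *ᵥ C.θ c) - C.wedge (C.θ d) (j *ᵥ (B *ᵥ C.θ c))) *ᵥ δ c = 0 :=
      Finset.sum_eq_zero fun c _ => by rw [H.commutator_schouten, Matrix.zero_mulVec]
    have e1 : ∑ c, C.ip (B *ᵥ C.θ d) (δ c) • (j *ᵥ C.θ c) = j *ᵥ (B *ᵥ C.θ d) := by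
      conv_rhs => rw [← C.sum_ip_δ_smul_θ (B *ᵥ C.θ d)]
      simp only [Matrix.mulVec_sum, Matrix.mulVec_smul]
    have e2 : ∑ c, C.ip (j *ᵥ C.θ c) (δ c) = 0 := by rw [sum_ip_δ_θ, H.skew.trace_eq_zero]
    have e3 := C.sum_ip_δ_smul_θ (j *ᵥ (B *ᵥ C.θ d))
    have e4 : ∑ c, C.ip (C.θ c) (δ c) = 4 := by
      have := C.sum_ip_θ_δ 1
      simpa using this
    have e5 : ∑ c, C.ip (B *ᵥ C.θ c) (δ c) = B.trace := C.sum_ip_δ_θ B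
    have e6 : ∑ c, C.ip (j *ᵥ C.θ d) (δ c) • (B *ᵥ C.θ c) = B *ᵥ (j *ᵥ C.θ d) := by
      conv_rhs => rw [← C.sum_ip_δ_smul_θ (j *ᵥ C.θ d)]
      simp only [Matrix.mulVec_sum, Matrix.mulVec_smul]
    have e7 : ∑ c, C.ip (j *ᵥ (B *ᵥ C.θ c)) (δ c) = 0 := by
      have := C.sum_ip_δ_θ (j * B)
      simp only [← Matrix.mulVec_mulVec] at this
      rw [this, H.trace_j_mul]
    have e8 : ∑ c, C.ip (C.θ d) (δ c) • (j *ᵥ (B *ᵥ C.θ c)) = j *ᵥ (B *ᵥ C.θ d) := by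
      conv_rhs => rw [← C.sum_ip_δ_smul_θ (C.θ d)]
      simp only [Matrix.mulVec_sum, Matrix.mulVec_smul]
    simp only [Matrix.sub_mulVec, Matrix.add_mulVec, wedge_mulVec, Finset.sum_sub_distrib,
      Finset.sum_add_distrib, e1, e3, e6, e8] at h2
    simp only [← Finset.sum_smul, e2, e4, e5, e7] at h2
    rw [Matrix.sub_mulVec, ← Matrix.mulVec_mulVec, ← Matrix.mulVec_mulVec, Matrix.smul_mulVec]
    linear_combination (norm := module) h2
  have h2 : B.trace = 0 := by
    have h3 := congrArg (fun X => (X * j).trace) h1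
    simp only [sub_mul, mul_assoc, H.sq, mul_one, Matrix.smul_mul, Matrix.trace_smul,
      Matrix.trace_sub, Matrix.trace_one, Fintype.card_fin, smul_eq_mul] at h3
    rw [Matrix.trace_mul_comm j, mul_assoc, H.sq, mul_one, sub_self] at h3
    refine (isUnit_four (A := A)).mul_left_cancel ?_
    push_cast at h3
    linear_combination -h3
  refine ⟨?_, h2⟩
  rw [h2, zero_smul] at h1
  exact sub_eq_zero.mp h1

/-- The wave equation of the Weyl scalar: `∇·p + p² = -2 (Ψ + μ)`. -/
lemma IsTypeD.dvg_p {j : Mat A} {Ψ μ : A} {p : Cov A} (H : C.IsTypeD j Ψ μ p) :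
    C.dvg p + C.ip p p = -2 * (Ψ + μ) := by
  have h1 := H.schouten_facts.2
  simp only [schouten, Matrix.trace_add, Matrix.trace_sub, Matrix.trace_smul, trace_tens,
    Matrix.trace_one, Fintype.card_fin, smul_eq_mul] at h1
  push_cast at h1
  refine (isUnit_two (A := A)).mul_left_cancel ?_
  rw [dvg]
  linear_combination h1

end Calc

namespace Calc

variable {A : Type*} [CommRing A] [Algebra ℂ A] {C : Calc A}

/-! ### Divergences -/

/-- The divergence `∇_c M_a^c` of an endomorphism. -/
def divM (C : Calc A) (M : Mat A) : Cov A := ∑ c, C.Dm c M *ᵥ δ c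

lemma divM_add (M N : Mat A) : C.divM (M + N) = C.divM M + C.divM N := by
  simp only [divM, Dm_add, Matrix.add_mulVec, Finset.sum_add_distrib]

lemma divM_sub (M N : Mat A) : C.divM (M - N) = C.divM M - C.divM N := by
  simp only [divM, Dm_sub, Matrix.sub_mulVec, Finset.sum_sub_distrib]

lemma divM_smul (f : A) (M : Mat A) : C.divM (f • M) = M *ᵥ C.grd f + f • C.divM M := by
  simp only [divM, Dm_smul, Matrix.add_mulVec, Matrix.smul_mulVec, Finset.sum_add_distrib,
    ← Finset.smul_sum]
  congr 1
  conv_rhs => rw [← sum_smul_δ (C.grd f)]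
  simp only [Matrix.mulVec_sum, Matrix.mulVec_smul, grd]

lemma Dv_δ (d c : Fin 4) : C.Dv d (δ c) = -∑ a, C.G d a c • (δ a : Cov A) := by
  have h1 : C.dv d (δ c) = 0 := by
    ext a
    by_cases hac : a = c <;> simp [dv_apply, δ, hac]
  have h2 : ∑ a, C.G d a c • (δ a : Cov A) = C.G d *ᵥ δ c := by
    rw [← sum_smul_δ (C.G d *ᵥ δ c)]
    simp only [mulVec_δ]
  rw [Dv, h1, h2, zero_sub]

lemma Skew.sum_smul {ι : Type*} (s : Finset ι) (f : ι → A) (M : ι → Mat A)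
    (hM : ∀ i, C.Skew (M i)) : C.Skew (∑ i ∈ s, f i • M i) := by
  classical
  induction s using Finset.induction_on with
  | empty => simp [Skew]
  | insert i s hi ih => rw [Finset.sum_insert hi]; exact ((hM i).smul _).add ih

lemma Skew.DDm {M : Mat A} (hM : C.Skew M) (c a : Fin 4) : C.Skew (C.DDm c a M) :=
  ((hM.Dm a).Dm c).sub (Skew.sum_smul _ _ _ fun e => hM.Dm e)

lemma Dv_sum (d : Fin 4) (v : Fin 4 → Cov A) : C.Dv d (∑ c, v c) = ∑ c, C.Dv d (v c) := by
  simp only [Fin.sum_univ_four, Dv_add]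

/-- The coordinate differentials `δ c` are not parallel; their Christoffel terms are the ones that
complete the iterated derivative to `DDm`. -/
lemma Dv_divM (d : Fin 4) (M : Mat A) : C.Dv d (C.divM M) = ∑ c, C.DDm d c M *ᵥ δ c := by
  rw [divM, Dv_sum]
  simp only [Dv_mulVec, Dv_δ, DDm, Matrix.sub_mulVec, Finset.sum_add_distrib,
    Finset.sum_sub_distrib, Matrix.mulVec_neg, Matrix.mulVec_sum, Matrix.sum_mulVec,
    Matrix.smul_mulVec, Matrix.mulVec_smul, Finset.sum_neg_distrib]
  rw [Finset.sum_comm (f := fun x i => C.G d i x • C.Dm x M *ᵥ δ i), sub_eq_add_neg]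

lemma ip_mul_δ_comm {M : Mat A} (hM : C.Skew M) (c d : Fin 4) :
    C.ip (M *ᵥ δ c) (δ d) = -C.ip (M *ᵥ δ d) (δ c) := by
  rw [hM.ip_mulVec, C.ip_comm]

lemma sum_ip_δ_mul (v w : Cov A) : ∑ c, C.ip v (δ c) * w c = C.ip v w := by
  conv_rhs => rw [← sum_smul_δ w]
  rw [ip_sum_right]
  exact Finset.sum_congr rfl fun c _ => by rw [ip_smul_right, mul_comm]

/-- The double divergence of a two-form vanishes. -/
lemma dvg_divM {μ : A} (hRic : ∀ a, ∑ c, C.Rm a c *ᵥ δ c = (3 * μ) • C.θ a) {M : Mat A}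
    (hM : C.Skew M) : C.dvg (C.divM M) = 0 := by
  rw [dvg_eq]
  simp only [Dv_divM]
  have h0 : ∀ d, C.ip (∑ c, C.DDm d c M *ᵥ δ c) (δ d) = ∑ c, C.ip (C.DDm d c M *ᵥ δ c) (δ d) := by
    intro d
    rw [C.ip_comm, ip_sum_right]
    exact Finset.sum_congr rfl fun c _ => C.ip_comm _ _
  simp only [h0]
  -- Skewness of `M` makes the exchange of the derivatives change the sign of the sum. The Ricci
  -- identity, with a Ricci tensor proportional to the metric, shows that the exchange changes
  -- nothing.
  have h1 : ∑ d, ∑ c, C.ip (C.DDm d c M *ᵥ δ c) (δ d)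
      = -∑ d, ∑ c, C.ip (C.DDm c d M *ᵥ δ c) (δ d) := by
    rw [Finset.sum_comm, ← Finset.sum_neg_distrib]
    refine Finset.sum_congr rfl fun d _ => ?_
    rw [← Finset.sum_neg_distrib]
    exact Finset.sum_congr rfl fun c _ => ip_mul_δ_comm (hM.DDm c d) d c
  have h2 : ∑ d, ∑ c, C.ip (C.DDm d c M *ᵥ δ c) (δ d)
      - ∑ d, ∑ c, C.ip (C.DDm c d M *ᵥ δ c) (δ d)
      = -(∑ d, ∑ c, C.ip (C.Rm d c *ᵥ (M *ᵥ δ c)) (δ d))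
        + ∑ d, ∑ c, C.ip (M *ᵥ (C.Rm d c *ᵥ δ c)) (δ d) := by
    rw [← Finset.sum_sub_distrib, ← Finset.sum_neg_distrib, ← Finset.sum_add_distrib]
    refine Finset.sum_congr rfl fun d _ => ?_
    rw [← Finset.sum_sub_distrib, ← Finset.sum_neg_distrib, ← Finset.sum_add_distrib]
    refine Finset.sum_congr rfl fun c _ => ?_
    rw [← ip_sub_left, ← Matrix.sub_mulVec, DDm_sub, Matrix.neg_mulVec, Matrix.sub_mulVec,
      ip_neg_left, ip_sub_left, Matrix.mulVec_mulVec, Matrix.mulVec_mulVec]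
    ring
  have h3 : ∑ d, ∑ c, C.ip (M *ᵥ (C.Rm d c *ᵥ δ c)) (δ d) = 0 := by
    have : ∀ d, ∑ c, C.ip (M *ᵥ (C.Rm d c *ᵥ δ c)) (δ d)
        = 3 * μ * C.ip (M *ᵥ C.θ d) (δ d) := by
      intro d
      rw [← ip_smul_left, ← Matrix.mulVec_smul, ← hRic, Matrix.mulVec_sum, C.ip_comm, ip_sum_right]
      exact Finset.sum_congr rfl fun c _ => C.ip_comm _ _
    simp only [this, ← Finset.mul_sum]
    rw [sum_ip_δ_θ, hM.trace_eq_zero, mul_zero]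
  have h4 : ∑ d, ∑ c, C.ip (C.Rm d c *ᵥ (M *ᵥ δ c)) (δ d) = 0 := by
    rw [Finset.sum_comm]
    have : ∀ c, ∑ d, C.ip (C.Rm d c *ᵥ (M *ᵥ δ c)) (δ d)
        = 3 * μ * C.ip (C.θ c) (M *ᵥ δ c) := by
      intro c
      rw [← ip_smul_left, ← hRic, C.ip_comm, ip_sum_right]
      refine Finset.sum_congr rfl fun d _ => ?_
      rw [(C.skew_Rm d c).ip_mulVec, C.Rm_swap c d, Matrix.neg_mulVec, ip_neg_right, neg_neg]
    simp only [this, ← Finset.mul_sum]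
    rw [sum_ip_θ_δ, hM.trace_eq_zero, mul_zero]
  rw [h3, h4] at h2
  refine (isUnit_two (A := A)).mul_left_cancel ?_
  linear_combination h1 + h2

/-- The wave operator. -/
def bx (C : Calc A) (f : A) : A := C.dvg (C.grd f)

lemma dvg_sub (α β : Cov A) : C.dvg (α - β) = C.dvg α - C.dvg β := by
  simp only [dvg_eq, Dv_sub, ip_sub_left, Finset.sum_sub_distrib]

lemma trace_skew_mul_selfadjoint {j T : Mat A} (hj : C.Skew j)
    (hT : ∀ u v, C.ip (T *ᵥ u) v = C.ip u (T *ᵥ v)) : (j * T).trace = 0 := by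
  have h1 : (j * T).trace = -(j * T).trace := by
    conv_lhs => rw [← sum_ip_δ_θ (C := C)]
    rw [Matrix.trace_mul_comm j]
    rw [← sum_ip_θ_δ (C := C), ← Finset.sum_neg_distrib]
    refine Finset.sum_congr rfl fun c _ => ?_
    rw [← Matrix.mulVec_mulVec, ← Matrix.mulVec_mulVec, hj.ip_mulVec, hT]
  refine (isUnit_two (A := A)).mul_left_cancel ?_
  linear_combination h1

variable {j : Mat A} {Ψ μ κ : A} {p : Cov A}

/-- The derivative of `κ` completes the right side to the conformal Killing–Yano form: the first and
last terms make up a totally antisymmetric tensor, `p` wedged with `j`, and the middle one is pure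
trace. -/
lemma IsTypeD.Dm_K (H : C.IsTypeD j Ψ μ p) (hκ : ∀ c, C.pa c κ = -(κ * p c)) (c : Fin 4) :
    C.Dm c (κ • j)
      = κ • (C.wedge (j *ᵥ C.θ c) p + C.wedge (C.θ c) (j *ᵥ p) - p c • j) := by
  rw [Dm_smul, hκ, H.Dm_j, H.skew.commutator_wedge]
  module

/-- Contraction of the covariant derivative of the Killing spinor with an endomorphism `T` with
adjoint `T'`. -/
lemma IsTypeD.sum_Dm_K (H : C.IsTypeD j Ψ μ p) (hκ : ∀ c, C.pa c κ = -(κ * p c)) (T T' : Mat A)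
    (hT : ∀ u v, C.ip u (T *ᵥ v) = C.ip (T' *ᵥ u) v) :
    ∑ c, C.Dm c (κ • j) *ᵥ (T *ᵥ δ c) = κ • (j *ᵥ (T' *ᵥ p) + (j * T).trace • p
      + T' *ᵥ (j *ᵥ p) - T.trace • (j *ᵥ p) - j *ᵥ (T *ᵥ p)) := by
  have e1 : ∑ c, C.ip p (T *ᵥ δ c) • (j *ᵥ C.θ c) = j *ᵥ (T' *ᵥ p) := by
    conv_rhs => rw [← C.sum_ip_δ_smul_θ (T' *ᵥ p)]
    simp only [Matrix.mulVec_sum, Matrix.mulVec_smul, hT]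
  have e2 : ∑ c, C.ip (j *ᵥ C.θ c) (T *ᵥ δ c) = -(j * T).trace := by
    rw [← sum_ip_θ_δ (C := C), ← Finset.sum_neg_distrib]
    refine Finset.sum_congr rfl fun c _ => ?_
    rw [H.skew.ip_mulVec, Matrix.mulVec_mulVec]
  have e3 : ∑ c, C.ip (j *ᵥ p) (T *ᵥ δ c) • C.θ c = T' *ᵥ (j *ᵥ p) := by
    conv_rhs => rw [← C.sum_ip_δ_smul_θ (T' *ᵥ (j *ᵥ p))]
    simp only [hT]
  have e4 : ∑ c, C.ip (C.θ c) (T *ᵥ δ c) = T.trace := C.sum_ip_θ_δ T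
  have e5 : ∑ c, p c • (j *ᵥ (T *ᵥ δ c)) = j *ᵥ (T *ᵥ p) := by
    conv_rhs => rw [← sum_smul_δ p]
    simp only [Matrix.mulVec_sum, Matrix.mulVec_smul]
  simp only [H.Dm_K hκ, Matrix.smul_mulVec, Matrix.sub_mulVec, Matrix.add_mulVec, wedge_mulVec,
    ← Finset.smul_sum, Finset.sum_sub_distrib, Finset.sum_add_distrib, e1, e3, e5]
  simp only [← Finset.sum_smul, e2, e4]
  module

lemma IsTypeD.divM_K (H : C.IsTypeD j Ψ μ p) (hκ : ∀ c, C.pa c κ = -(κ * p c)) :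
    C.divM (κ • j) = -((3 * κ) • (j *ᵥ p)) := by
  have h1 := H.sum_Dm_K hκ 1 1 (fun u v => by simp only [Matrix.one_mulVec])
  simp only [Matrix.one_mulVec, mul_one, H.skew.trace_eq_zero, Matrix.trace_one,
    Fintype.card_fin] at h1
  rw [divM, h1]
  push_cast
  module

/-! ### The Fackerell–Ipser equation of a Maxwell field -/

/-- The covector `κ j p` is, up to a constant, the divergence `ξ` of the Killing spinor. The second
derivatives of `Ψ` enter its gradient only through `schouten`, about which everything needed is
known. -/
lemma IsTypeD.nab_K_p (H : C.IsTypeD j Ψ μ p) (hκ : ∀ c, C.pa c κ = -(κ * p c)) :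
    (2 : A) • C.nab (κ • (j *ᵥ p)) = κ • (j * C.schouten Ψ μ p - (2 : A) • C.tens (j *ᵥ p) p
      + (2 : A) • C.tens p (j *ᵥ p) + (C.ip p p - Ψ - μ) • j) := by
  refine C.mul_g_cancel fun d => ?_
  have h0 : C.ip p (j *ᵥ p) = 0 := by
    refine (isUnit_two (A := A)).mul_left_cancel ?_
    have := H.skew.ip_mulVec p p
    rw [C.ip_comm] at this
    linear_combination this
  have h0' : C.ip p (j *ᵥ C.θ d) = -(j *ᵥ p) d := by
    rw [C.ip_comm, H.skew.ip_mulVec, ip_θ]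
  have h1 : C.Dv d (κ • (j *ᵥ p)) = C.Dm d (κ • j) *ᵥ p + κ • (j *ᵥ C.Dv d p) := by
    rw [← Matrix.smul_mulVec κ j p, Dv_mulVec, Matrix.smul_mulVec]
  simp only [Matrix.smul_mulVec, Matrix.add_mulVec, Matrix.sub_mulVec, nab_θ, h1, H.Dm_K hκ,
    ← Matrix.mulVec_mulVec, schouten_θ, tens_mulVec, wedge_mulVec, H.skew.ip_mulVec, h0, h0', ip_θ,
    C.ip_comm _ (C.θ d), Matrix.mulVec_add, Matrix.mulVec_sub, Matrix.mulVec_smul]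
  module

/-- The middle component of an anti-self-dual Maxwell field satisfies the Fackerell–Ipser
equation. -/
theorem IsTypeD.fackerell_ipser (H : C.IsTypeD j Ψ μ p) (hκ : ∀ c, C.pa c κ = -(κ * p c))
    {F : Mat A} {s : A} (hF : C.Skew F) (hs : F * j + j * F = s • (1 : Mat A))
    (hdiv : C.divM F = 0) : C.bx (κ * s) = -2 * (Ψ + μ) * (κ * s) := by
  have htr : (j * F).trace = 2 * s := by
    have h1 := congrArg Matrix.trace hs
    rw [Matrix.trace_add, Matrix.trace_mul_comm F, Matrix.trace_smul, Matrix.trace_one,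
      Fintype.card_fin, smul_eq_mul] at h1
    refine (isUnit_two (A := A)).mul_left_cancel ?_
    push_cast at h1
    linear_combination h1
  have hsv : ∀ v, F *ᵥ (j *ᵥ v) = s • v - j *ᵥ (F *ᵥ v) := by
    intro v
    have := congrArg (fun X => X *ᵥ v) hs
    simp only [Matrix.add_mulVec, ← Matrix.mulVec_mulVec, Matrix.smul_mulVec,
      Matrix.one_mulVec] at this
    rw [← this]; abel
  -- the gradient as a divergence
  have hq : κ • (j * F - F * j) = (2 : A) • ((κ • j) * F) - (κ * s) • (1 : Mat A) := by
    rw [mul_smul κ s, ← hs, Matrix.smul_mul]; module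
  have h1 : C.divM (κ • (j * F - F * j))
      = (2 : A) • (F *ᵥ (κ • (j *ᵥ p))) - C.grd (κ * s) := by
    have e1 : C.divM ((κ • j) * F) = ∑ c, C.Dm c (κ • j) *ᵥ (F *ᵥ δ c) := by
      have : (κ • j) *ᵥ C.divM F = 0 := by rw [hdiv, Matrix.mulVec_zero]
      rw [divM, Matrix.mulVec_sum] at this
      simp only [divM, Dm_mul, Matrix.add_mulVec, Finset.sum_add_distrib, ← Matrix.mulVec_mulVec,
        this, add_zero]
    have e2 := H.sum_Dm_K hκ F (-F) (fun u v => by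
      rw [Matrix.neg_mulVec, ip_neg_left, hF.ip_mulVec, neg_neg])
    have e3 : C.divM ((2 : A) • ((κ • j) * F)) = (2 : A) • C.divM ((κ • j) * F) := by
      rw [divM_smul]
      have : C.grd (2 : A) = 0 := by
        ext a
        exact_mod_cast (C.pa a).map_natCast 2
      rw [this, Matrix.mulVec_zero, zero_add]
    have e4 : C.divM (1 : Mat A) = 0 := by
      simp [divM, Dm_one]
    rw [hq, divM_sub, e3, e1, e2, divM_smul, e4, smul_zero, add_zero, Matrix.one_mulVec,
      hF.trace_eq_zero, htr]
    simp only [Matrix.neg_mulVec, Matrix.mulVec_neg, Matrix.mulVec_smul, hsv]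
    module
  -- The field equation comes from here: the divergence of `h1` vanishes, which expresses the wave
  -- operator on `κ s` by `F` and the gradient of `κ j p`.
  have h2 := dvg_divM H.ricci ((H.skew.commutator hF).smul κ)
  rw [h1, dvg_sub] at h2
  have h3 : ∀ η, C.dvg ((2 : A) • (F *ᵥ η)) = (F * ((2 : A) • C.nab η)).trace := by
    intro η
    have e0 : ∀ c, C.pa c (2 : A) = 0 := fun c => by exact_mod_cast (C.pa c).map_natCast 2
    have e1 : ∑ c, C.ip (C.Dm c F *ᵥ η) (δ c) = 0 := by
      have : ∑ c, C.ip (C.Dm c F *ᵥ η) (δ c) = -C.ip η (C.divM F) := by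
        rw [divM, ip_sum_right, ← Finset.sum_neg_distrib]
        exact Finset.sum_congr rfl fun c _ => (hF.Dm c).ip_mulVec _ _
      rw [this, hdiv]; simp [ip]
    have e2 : ∑ c, C.ip (F *ᵥ C.Dv c η) (δ c) = (F * C.nab η).trace := by
      rw [← sum_ip_δ_θ (C := C)]
      exact Finset.sum_congr rfl fun c _ => by rw [← Matrix.mulVec_mulVec, nab_θ]
    simp only [dvg_eq, Dv_smul, Dv_mulVec, e0, zero_smul, zero_add, ip_smul_left, ip_add_left,
      ← Finset.mul_sum, Finset.sum_add_distrib]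
    rw [Matrix.mul_smul, Matrix.trace_smul, smul_eq_mul, ← e2, e1, zero_add]
  -- Since `schouten` commutes with `j`, this trace is half of `tr ((F j + j F) B) = s tr B`, and
  -- `tr B = 0`.
  have h4 : (F * (j * C.schouten Ψ μ p)).trace = 0 := by
    have hc := H.schouten_facts
    refine (isUnit_two (A := A)).mul_left_cancel ?_
    have e1 : (F * (j * C.schouten Ψ μ p)).trace = (j * F * C.schouten Ψ μ p).trace := by
      rw [← hc.1, ← mul_assoc, Matrix.trace_mul_comm, mul_assoc]
    have e2 := congrArg (fun X => (X * C.schouten Ψ μ p).trace) hs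
    simp only [add_mul, Matrix.trace_add, Matrix.smul_mul, one_mul, Matrix.trace_smul, hc.2,
      smul_zero, mul_assoc] at e2
    rw [mul_assoc] at e1
    linear_combination e1 + e2
  have h5 : C.ip p (F *ᵥ (j *ᵥ p)) - C.ip (j *ᵥ p) (F *ᵥ p) = s * C.ip p p := by
    rw [hsv, ip_sub_right, ip_smul_right, H.skew.ip_mulVec]; ring
  rw [h3, H.nab_K_p hκ, Matrix.mul_smul, Matrix.trace_smul, smul_eq_mul] at h2
  simp only [mul_add, mul_sub, Matrix.mul_smul, Matrix.trace_add, Matrix.trace_sub,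
    Matrix.trace_smul, h4, mul_tens, trace_tens, Matrix.trace_mul_comm F j, htr, smul_eq_mul] at h2
  rw [bx]
  linear_combination -h2 - 2 * κ * h5

end Calc

namespace Calc

variable {A : Type*} [CommRing A] [Algebra ℂ A] {C : Calc A}

/-! ### Exterior derivative of a one-form -/

/-- The covariant derivative of a tensor with two lower indices. -/
def Dl (C : Calc A) (c : Fin 4) (T : Mat A) : Mat A := C.dm c T - C.G c * T - T * (C.G c)ᵀ

lemma Dm_mul_h (c : Fin 4) (T : Mat A) : C.Dm c (T * C.h) = C.Dl c T * C.h := by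
  rw [Dm, dm_mul, dm_h, Dl]; noncomm_ring

lemma Dl_transpose {T : Mat A} (hT : Tᵀ = -T) (c : Fin 4) : (C.Dl c T)ᵀ = -C.Dl c T := by
  simp only [Dl, Matrix.transpose_sub, Matrix.transpose_mul, ← C.dm_transpose, hT,
    Matrix.transpose_transpose, C.dm_neg]
  noncomm_ring

/-- The exterior derivative `∇_a V_b - ∇_b V_a`. -/
def exd (C : Calc A) (V : Cov A) : Mat A := Matrix.of fun a b => C.Dv a V b - C.Dv b V a

lemma exd_transpose (V : Cov A) : (C.exd V)ᵀ = -C.exd V := by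
  ext a b; simp [exd]

lemma skew_mul_h {T : Mat A} (hT : Tᵀ = -T) : C.Skew (T * C.h) := by
  rw [Skew, Matrix.transpose_mul, C.h_symm, hT]; noncomm_ring

lemma Dl_exd (c a b : Fin 4) (V : Cov A) :
    C.Dl c (C.exd V) a b = C.DDv c a V b - C.DDv c b V a := by
  simp only [Dl, DDv, Matrix.sub_apply, dm_apply, Matrix.mul_apply, Matrix.transpose_apply, exd,
    Matrix.of_apply, Pi.sub_apply, Finset.sum_apply, Pi.smul_apply, smul_eq_mul, map_sub]
  rw [show C.Dv c (C.Dv a V) b = C.pa c (C.Dv a V b) - ∑ d, C.G c b d * C.Dv a V d from rfl,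
    show C.Dv c (C.Dv b V) a = C.pa c (C.Dv b V a) - ∑ d, C.G c a d * C.Dv b V d from rfl]
  simp only [mul_sub, sub_mul, Finset.sum_sub_distrib, mul_comm (C.Dv _ V _)]
  ring

/-- This is `d² = 0` in covariant form: the Ricci identity produces the cyclic sum of the curvature,
which vanishes by the first Bianchi identity. -/
lemma Dl_exd_cyclic (a b c : Fin 4) (V : Cov A) :
    C.Dl a (C.exd V) b c + C.Dl b (C.exd V) c a + C.Dl c (C.exd V) a b = 0 := by
  have h1 := congrFun (C.DDv_sub a b V) c
  have h2 := congrFun (C.DDv_sub b c V) a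
  have h3 := congrFun (C.DDv_sub c a V) b
  have h4 : (C.Rm a b *ᵥ V) c + (C.Rm b c *ᵥ V) a + (C.Rm c a *ᵥ V) b = 0 := by
    simp only [Matrix.mulVec, dotProduct, ← Finset.sum_add_distrib, ← add_mul]
    exact Finset.sum_eq_zero fun d _ => by rw [C.bianchi_first, zero_mul]
  simp only [Pi.sub_apply, Pi.neg_apply] at h1 h2 h3
  rw [Dl_exd, Dl_exd, Dl_exd]
  linear_combination h1 + h2 + h3 - h4

lemma Dl_exd_antisymm (a b c : Fin 4) (V : Cov A) :
    C.Dl a (C.exd V) b c = -C.Dl a (C.exd V) c b := by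
  rw [Dl_exd, Dl_exd]; ring

/-- The trace of `∇∇V` over the first derivative index and the form index. -/
lemma sum_ip_DDv {μ : A} (hRic : ∀ a, ∑ c, C.Rm a c *ᵥ δ c = (3 * μ) • C.θ a) (b : Fin 4)
    (V : Cov A) : ∑ c, C.ip (C.DDv c b V) (δ c) = C.pa b (C.dvg V) - 3 * μ * V b := by
  have h1 : C.pa b (C.dvg V) = ∑ c, C.ip (C.DDv b c V) (δ c) := by
    rw [dvg_eq, map_sum]
    simp only [pa_ip, Dv_δ, DDv, ip_sub_left, ip_neg_right, ip_sum_right, ip_smul_right,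
      Finset.sum_add_distrib, Finset.sum_sub_distrib, Finset.sum_neg_distrib]
    rw [sub_eq_add_neg, Finset.sum_comm (f := fun x i => C.G b i x * C.ip (C.Dv x V) (δ i))]
    congr 2
    refine Finset.sum_congr rfl fun c _ => ?_
    rw [C.ip_comm, ip_sum_right]
    exact Finset.sum_congr rfl fun e _ => by rw [ip_smul_right, C.ip_comm]
  have h2 : ∑ c, C.ip (C.Rm c b *ᵥ V) (δ c) = 3 * μ * V b := by
    rw [← C.ip_θ b V, ← ip_smul_left, ← hRic, C.ip_comm, ip_sum_right]
    refine Finset.sum_congr rfl fun c _ => ?_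
    rw [(C.skew_Rm c b).ip_mulVec, C.Rm_swap b c, Matrix.neg_mulVec, ip_neg_right, neg_neg]
  rw [h1, ← h2, ← Finset.sum_sub_distrib]
  refine Finset.sum_congr rfl fun c _ => ?_
  rw [← ip_sub_left]
  congr 1
  rw [eq_sub_iff_add_eq, ← sub_eq_zero]
  linear_combination (norm := module) C.DDv_sub c b V

/-! ### Rough Laplacians and the Weitzenböck formula -/

/-- The rough Laplacian of a covector. -/
def lapV (C : Calc A) (V : Cov A) : Cov A := ∑ c, ∑ a, C.h c a • C.DDv c a V

/-- The rough Laplacian of an endomorphism. -/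
def lapM (C : Calc A) (M : Mat A) : Mat A := ∑ c, ∑ a, C.h c a • C.DDm c a M

/-- The Weitzenböck formula for one-forms; the Ricci term comes from commuting the divergence past a
derivative in `sum_ip_DDv`. -/
lemma divM_exd {μ : A} (hRic : ∀ a, ∑ c, C.Rm a c *ᵥ δ c = (3 * μ) • C.θ a) (V : Cov A) :
    C.divM (C.exd V * C.h) = C.grd (C.dvg V) - (3 * μ) • V - C.lapV V := by
  ext b
  have h1 := sum_ip_DDv hRic b V
  simp only [divM, Dm_mul_h, Finset.sum_apply, Pi.sub_apply, mulVec_δ, grd, Pi.smul_apply,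
    smul_eq_mul, lapV]
  rw [← h1, ← Finset.sum_sub_distrib]
  refine Finset.sum_congr rfl fun c _ => ?_
  rw [ip_δ]
  simp only [Matrix.mul_apply, Matrix.mulVec, dotProduct, ← Finset.sum_sub_distrib, Dl_exd]
  exact Finset.sum_congr rfl fun a _ => by rw [C.h_comm a c]; ring

/-- The Weitzenböck formula for a closed form, whose exterior derivative drops out. -/
lemma lapV_grd {μ : A} (hRic : ∀ a, ∑ c, C.Rm a c *ᵥ δ c = (3 * μ) • C.θ a) (f : A) :
    C.lapV (C.grd f) = C.grd (C.bx f) - (3 * μ) • C.grd f := by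
  have h0 : C.exd (C.grd f) = 0 := by
    ext a b
    simp [exd, C.Dv_grd_symm f a b]
  have h1 := divM_exd hRic (C.grd f)
  rw [h0, zero_mul] at h1
  simp only [divM, Dm_zero, Matrix.zero_mulVec, Finset.sum_const_zero] at h1
  rw [bx]
  linear_combination (norm := module) h1

lemma lapV_mulVec (M : Mat A) (α : Cov A) :
    C.lapV (M *ᵥ α) = C.lapM M *ᵥ α + (2 : A) • ∑ c, C.Dm c M *ᵥ (C.nab α *ᵥ δ c)
      + M *ᵥ C.lapV α := by
  have e1 : ∀ c, ∑ a, C.h c a • C.Dv a α = C.nab α *ᵥ δ c := by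
    intro c
    rw [← C.sum_h_smul_θ, Matrix.mulVec_sum]
    simp only [Matrix.mulVec_smul, nab_θ]
  have e2 : ∑ c, ∑ a, C.h c a • (C.Dm c M *ᵥ C.Dv a α) = ∑ c, C.Dm c M *ᵥ (C.nab α *ᵥ δ c) := by
    simp only [← e1, Matrix.mulVec_sum, Matrix.mulVec_smul]
  have e3 : ∑ c, ∑ a, C.h c a • (C.Dm a M *ᵥ C.Dv c α) = ∑ c, C.Dm c M *ᵥ (C.nab α *ᵥ δ c) := by
    rw [← e2, Finset.sum_comm]
    exact Finset.sum_congr rfl fun c _ => Finset.sum_congr rfl fun a _ => by rw [C.h_comm]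
  simp only [lapV, lapM, DDv_mulVec, smul_add, Finset.sum_add_distrib, e2, e3, Matrix.sum_mulVec,
    Matrix.smul_mulVec, Matrix.mulVec_sum, Matrix.mulVec_smul]
  module

variable {j j' : Mat A} {Ψ Ψ' μ κ κ' : A} {p p' : Cov A}

/-- The antisymmetric part of `∇p` is zero because `p` is closed. -/
lemma sum_wedge_δ_Dv (hp : ∀ a b, C.Dv a p b = C.Dv b p a) :
    ∑ c, C.wedge (δ c) (C.Dv c p) = 0 := by
  refine mat_ext fun v => ?_
  have e1 : ∑ c, C.ip (C.Dv c p) v • (δ c : Cov A) = C.nab p *ᵥ v := by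
    conv_rhs => rw [← sum_smul_δ (C.nab p *ᵥ v)]
    refine Finset.sum_congr rfl fun c _ => ?_
    rw [← nab_θ, ip_nab hp, ip_θ]
  have e2 : ∑ c, C.ip (δ c) v • C.Dv c p = C.nab p *ᵥ v := by
    conv_rhs => rw [← C.sum_ip_δ_smul_θ v]
    simp only [Matrix.mulVec_sum, Matrix.mulVec_smul, nab_θ, C.ip_comm v]
  simp only [Matrix.sum_mulVec, wedge_mulVec, Finset.sum_sub_distrib, e1, e2, sub_self,
    Matrix.zero_mulVec]

/-- A contraction of the square of `∂_c ∧ p`. -/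
lemma sum_wedge_wedge (X : Mat A) (ε : A) (hX : ∀ u v, C.ip u (X *ᵥ v) = ε * C.ip (X *ᵥ u) v)
    (v : Cov A) :
    ∑ c, C.wedge (C.θ c) p *ᵥ (X *ᵥ (C.wedge (δ c) p *ᵥ v))
      = (ε * C.ip p v) • (X *ᵥ p) - (X.trace * C.ip p v) • p - C.ip p (X *ᵥ p) • v
        + C.ip v (X *ᵥ p) • p := by
  have e1 : ∑ c, C.ip p (X *ᵥ δ c) • C.θ c = ε • (X *ᵥ p) := by
    conv_rhs => rw [← C.sum_ip_δ_smul_θ (X *ᵥ p)]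
    simp only [hX, Finset.smul_sum, smul_smul]
  have e2 : ∑ c, (X *ᵥ δ c) c = X.trace := by
    have := C.sum_ip_θ_δ X
    simpa only [ip_θ] using this
  have e3 := C.sum_ip_δ_smul_θ v
  have e4 := sum_ip_δ_mul (C := C) v (X *ᵥ p)
  have e5 : ∀ c, C.wedge (C.θ c) p *ᵥ (X *ᵥ (C.wedge (δ c) p *ᵥ v))
      = C.ip p v • (C.ip p (X *ᵥ δ c) • C.θ c) - (C.ip p v * (X *ᵥ δ c) c) • p
        - C.ip p (X *ᵥ p) • (C.ip v (δ c) • C.θ c) + (C.ip v (δ c) * (X *ᵥ p) c) • p := by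
    intro c
    simp only [wedge_mulVec, Matrix.mulVec_sub, Matrix.mulVec_smul, ip_θ, C.ip_comm (δ c) v]
    module
  simp only [e5, Finset.sum_add_distrib, Finset.sum_sub_distrib, ← Finset.smul_sum, e1, e3]
  simp only [← Finset.sum_smul, ← Finset.mul_sum, e2, e4]
  module

/-- The companion of `sum_wedge_wedge` with the raised and lowered labels exchanged. Both are
applied with `X = 1`, `ε = 1` and with `X = j`, `ε = -1`. -/
lemma sum_wedge_wedge' (X : Mat A) (ε : A) (hX : ∀ u v, C.ip u (X *ᵥ v) = ε * C.ip (X *ᵥ u) v)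
    (v : Cov A) :
    ∑ c, C.wedge (δ c) p *ᵥ (X *ᵥ (C.wedge (C.θ c) p *ᵥ v))
      = (ε * C.ip p v) • (X *ᵥ p) - (X.trace * C.ip p v) • p - C.ip p (X *ᵥ p) • v
        + C.ip v (X *ᵥ p) • p := by
  have e1 : ∑ c, C.ip p (X *ᵥ C.θ c) • (δ c : Cov A) = ε • (X *ᵥ p) := by
    conv_rhs => rw [← sum_smul_δ (X *ᵥ p)]
    rw [Finset.smul_sum]
    exact Finset.sum_congr rfl fun c _ => by rw [hX, C.ip_comm, ip_θ, smul_smul]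
  have e2 : ∑ c, C.ip (δ c) (X *ᵥ C.θ c) = X.trace := by
    simpa only [C.ip_comm (δ _)] using C.sum_ip_δ_θ X
  have e3 := sum_smul_δ v
  have e4 : ∑ c, v c * C.ip (δ c) (X *ᵥ p) = C.ip v (X *ᵥ p) := by
    rw [C.ip_comm v, ← sum_ip_δ_mul]
    exact Finset.sum_congr rfl fun c _ => by rw [C.ip_comm, mul_comm]
  have e5 : ∀ c, C.wedge (δ c) p *ᵥ (X *ᵥ (C.wedge (C.θ c) p *ᵥ v))
      = C.ip p v • (C.ip p (X *ᵥ C.θ c) • δ c) - (C.ip p v * C.ip (δ c) (X *ᵥ C.θ c)) • p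
        - C.ip p (X *ᵥ p) • (v c • δ c) + (v c * C.ip (δ c) (X *ᵥ p)) • p := by
    intro c
    simp only [wedge_mulVec, Matrix.mulVec_sub, Matrix.mulVec_smul, ip_θ]
    module
  simp only [e5, Finset.sum_add_distrib, Finset.sum_sub_distrib, ← Finset.smul_sum, e1, e3]
  simp only [← Finset.sum_smul, ← Finset.mul_sum, e2, e4]
  module

lemma ip_skew_self {j : Mat A} (hj : C.Skew j) (p : Cov A) : C.ip p (j *ᵥ p) = 0 := by
  refine (isUnit_two (A := A)).mul_left_cancel ?_
  have := hj.ip_mulVec p p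
  rw [C.ip_comm] at this
  linear_combination this

/-- The double commutator expands into four sandwiches, each of them given by `sum_wedge_wedge` or
`sum_wedge_wedge'`. Everything except the terms with `p²` cancels. -/
lemma sum_double_commutator {j : Mat A} (hj : C.Skew j) (p : Cov A) :
    ∑ c, ((j * C.wedge (C.θ c) p - C.wedge (C.θ c) p * j) * C.wedge (δ c) p
      - C.wedge (δ c) p * (j * C.wedge (C.θ c) p - C.wedge (C.θ c) p * j))
      = (-2 * C.ip p p) • j := by
  refine mat_ext fun v => ?_
  have e1 := sum_wedge_wedge (C := C) (p := p) 1 1 (fun u v => by simp) v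
  have e2 := sum_wedge_wedge' (C := C) (p := p) 1 1 (fun u v => by simp) (j *ᵥ v)
  have e3 := sum_wedge_wedge (C := C) (p := p) j (-1) (fun u v => by rw [hj.ip_mulVec]; ring) v
  have e4 := sum_wedge_wedge' (C := C) (p := p) j (-1) (fun u v => by rw [hj.ip_mulVec]; ring) v
  have e1' := congrArg (j *ᵥ ·) e1
  simp only [Matrix.mulVec_sum] at e1'
  have h0 := ip_skew_self hj p
  have h1 : C.ip p (j *ᵥ v) = -C.ip v (j *ᵥ p) := by
    rw [← neg_eq_iff_eq_neg, ← hj.ip_mulVec, C.ip_comm]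
  simp only [Matrix.one_mulVec, Matrix.trace_one, Fintype.card_fin, hj.trace_eq_zero, h0,
    Matrix.mulVec_sub, Matrix.mulVec_add, Matrix.mulVec_smul, h1, C.ip_comm (j *ᵥ v) p,
    C.ip_comm v p] at e1' e2 e3 e4
  push_cast at e1' e2
  simp only [Matrix.sum_mulVec, sub_mul, mul_sub, Matrix.sub_mulVec, Finset.sum_sub_distrib,
    ← Matrix.mulVec_mulVec, Matrix.smul_mulVec]
  rw [e1', e2, e3, e4]
  module

/-- The rough Laplacian of the Killing spinor. -/
theorem IsTypeD.lapM_K (H : C.IsTypeD j Ψ μ p) (hκ : ∀ c, C.pa c κ = -(κ * p c)) :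
    C.lapM (κ • j) = (2 * (Ψ + μ) * κ) • j := by
  let a : Fin 4 → Mat A := fun c => C.wedge (C.θ c) p
  let N : Fin 4 → Mat A := fun c => j * a c - a c * j
  have hN : ∀ c, C.Dm c j = N c := H.Dm_j
  have hDK : ∀ c, C.Dm c (κ • j) = κ • (N c - p c • j) := by
    intro c
    rw [Dm_smul, hκ, hN]; module
  have hDN : ∀ c b, C.Dm c (N b) = N c * a b - a b * N c + ∑ e, C.G c b e • N e
      + (j * C.wedge (C.θ b) (C.Dv c p) - C.wedge (C.θ b) (C.Dv c p) * j) := by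
    intro c b
    have h1 : C.Dm c (a b) = ∑ e, C.G c b e • a e + C.wedge (C.θ b) (C.Dv c p) := by
      simp only [a, Dm_wedge, Dv_θ, wedge_sum_left, wedge_smul_left]
    have h2 : ∑ e, C.G c b e • N e
        = j * (∑ e, C.G c b e • a e) - (∑ e, C.G c b e • a e) * j := by
      simp only [N, smul_sub, Finset.sum_sub_distrib, Finset.mul_sum, Finset.sum_mul,
        Matrix.mul_smul, Matrix.smul_mul]
    rw [h2]
    change C.Dm c (j * a b - a b * j) = _
    rw [Dm_sub, Dm_mul, Dm_mul, hN, h1]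
    noncomm_ring
  have hpp : ∀ c b, C.pa c (p b) = C.Dv c p b + ∑ e, C.G c b e * p e := by
    intro c b
    simp [Dv, dv_apply, Matrix.mulVec, dotProduct]
  have hDD : ∀ c b, C.DDm c b (κ • j) = κ • (-(p c • N b) + (p c * p b) • j
      + (N c * a b - a b * N c)
      + (j * C.wedge (C.θ b) (C.Dv c p) - C.wedge (C.θ b) (C.Dv c p) * j)
      - C.Dv c p b • j - p b • N c) := by
    intro c b
    have h1 : ∑ e, C.G c b e • C.Dm e (κ • j)
        = κ • (∑ e, C.G c b e • N e) - (κ * ∑ e, C.G c b e * p e) • j := by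
      simp only [hDK, Finset.smul_sum, Finset.mul_sum, Finset.sum_smul, ← Finset.sum_sub_distrib]
      exact Finset.sum_congr rfl fun e _ => by module
    rw [DDm, h1, hDK, Dm_smul, hκ, Dm_sub, Dm_smul, hDN, hpp, hN]
    module
  -- This trace is the commutator of `j` with `p ∧ p`.
  have s1 : ∑ c, ∑ b, C.h c b • (p c • N b) = 0 := by
    have h1 : ∑ c, ∑ b, C.h c b • (p c • a b) = 0 := by
      have : ∑ c, ∑ b, C.h c b • (p c • a b) = C.wedge p p := by
        conv_rhs => rw [← C.sum_ip_δ_smul_θ p]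
        rw [Finset.sum_comm, wedge_sum_left]
        refine Finset.sum_congr rfl fun b _ => ?_
        simp only [a]
        rw [C.sum_ip_δ_smul_θ p, wedge_smul_left, ip_δ]
        simp only [Matrix.mulVec, dotProduct, Finset.sum_smul, smul_smul]
        exact Finset.sum_congr rfl fun c _ => by rw [C.h_comm]
      rw [this, wedge_self]
    have h2 : ∑ c, ∑ b, C.h c b • (p c • N b)
        = j * (∑ c, ∑ b, C.h c b • (p c • a b)) - (∑ c, ∑ b, C.h c b • (p c • a b)) * j := by
      simp only [N, smul_sub, Finset.sum_sub_distrib, Finset.mul_sum, Finset.sum_mul,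
        Matrix.mul_smul, Matrix.smul_mul]
    rw [h2, h1, mul_zero, zero_mul, sub_zero]
  have s2 : ∑ c, ∑ b, C.h c b • (p b • N c) = 0 := by
    rw [← s1, Finset.sum_comm]
    exact Finset.sum_congr rfl fun c _ => Finset.sum_congr rfl fun b _ => by rw [C.h_comm]
  have s3 : ∑ c, ∑ b, C.h c b * (p c * p b) = C.ip p p := by
    simp only [ip, dotProduct, Matrix.mulVec, Finset.mul_sum]
    exact Finset.sum_congr rfl fun c _ => Finset.sum_congr rfl fun b _ => by ring
  have s4 : ∑ c, ∑ b, C.h c b • (N c * a b - a b * N c) = (-2 * C.ip p p) • j := by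
    rw [← sum_double_commutator H.skew p]
    refine Finset.sum_congr rfl fun c _ => ?_
    have : C.wedge (δ c) p = ∑ b, C.h c b • a b := by
      simp only [a, ← C.sum_h_smul_θ c, wedge_sum_left, wedge_smul_left]
    rw [this]
    simp only [Finset.mul_sum, Finset.sum_mul, Matrix.mul_smul, Matrix.smul_mul, smul_sub,
      Finset.sum_sub_distrib, N, a]
  have s5 : ∑ c, ∑ b, C.h c b • (j * C.wedge (C.θ b) (C.Dv c p) - C.wedge (C.θ b) (C.Dv c p) * j)
      = 0 := by
    have h1 : ∑ c, ∑ b, C.h c b • C.wedge (C.θ b) (C.Dv c p) = 0 := by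
      rw [← sum_wedge_δ_Dv H.closed]
      refine Finset.sum_congr rfl fun c _ => ?_
      simp only [← C.sum_h_smul_θ c, wedge_sum_left, wedge_smul_left]
    have h2 : ∑ c, ∑ b, C.h c b
          • (j * C.wedge (C.θ b) (C.Dv c p) - C.wedge (C.θ b) (C.Dv c p) * j)
        = j * (∑ c, ∑ b, C.h c b • C.wedge (C.θ b) (C.Dv c p))
          - (∑ c, ∑ b, C.h c b • C.wedge (C.θ b) (C.Dv c p)) * j := by
      simp only [smul_sub, Finset.sum_sub_distrib, Finset.mul_sum, Finset.sum_mul,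
        Matrix.mul_smul, Matrix.smul_mul]
    rw [h2, h1, mul_zero, zero_mul, sub_zero]
  have s6 : ∑ c, ∑ b, C.h c b * C.Dv c p b = C.dvg p := by
    rw [dvg_eq]
    refine Finset.sum_congr rfl fun c _ => ?_
    rw [ip_δ]; rfl
  -- What survives is `p² - 2 p² - ∇·p`, and this is `2 (Ψ + μ)` by `IsTypeD.dvg_p`.
  have hsum : C.lapM (κ • j) = κ • (-(∑ c, ∑ b, C.h c b • (p c • N b))
      + (∑ c, ∑ b, C.h c b * (p c * p b)) • j + ∑ c, ∑ b, C.h c b • (N c * a b - a b * N c)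
      + ∑ c, ∑ b, C.h c b • (j * C.wedge (C.θ b) (C.Dv c p) - C.wedge (C.θ b) (C.Dv c p) * j)
      - (∑ c, ∑ b, C.h c b * C.Dv c p b) • j - ∑ c, ∑ b, C.h c b • (p b • N c)) := by
    simp only [lapM, hDD, Finset.smul_sum, Finset.sum_smul, ← Finset.sum_add_distrib,
      ← Finset.sum_sub_distrib, ← Finset.sum_neg_distrib]
    refine Finset.sum_congr rfl fun c _ => Finset.sum_congr rfl fun b _ => ?_
    module
  rw [hsum, s1, s2, s3, s4, s5, s6]
  have := H.dvg_p
  have h7 : C.dvg p = -2 * (Ψ + μ) - C.ip p p := by linear_combination this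
  rw [h7]
  module

end Calc

namespace Calc

variable {A : Type*} [CommRing A] [Algebra ℂ A] {C : Calc A}
variable {j j' : Mat A} {Ψ Ψ' μ κ κ' : A} {p p' : Cov A}

/-! ### The Maxwell field of a solution of the conjugate Fackerell–Ipser equation -/

lemma pa_two (c : Fin 4) : C.pa c (2 : A) = 0 := by exact_mod_cast (C.pa c).map_natCast 2

lemma divM_two_smul (M : Mat A) : C.divM ((2 : A) • M) = (2 : A) • C.divM M := by
  have : C.grd (2 : A) = 0 := by
    ext a; exact pa_two a
  rw [divM_smul, this, Matrix.mulVec_zero, zero_add]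

/-- The divergences of `κ j` and `κ' j'` are `-3` times the two sides of `hreal`. Without trace
part, the conformal Killing–Yano equation becomes the Killing–Yano equation for the difference. -/
lemma IsTypeD.divM_Y (H : C.IsTypeD j Ψ μ p) (H' : C.IsTypeD j' Ψ' μ p')
    (hκ : ∀ c, C.pa c κ = -(κ * p c)) (hκ' : ∀ c, C.pa c κ' = -(κ' * p' c))
    (hreal : κ • (j *ᵥ p) = κ' • (j' *ᵥ p')) : C.divM (κ • j - κ' • j') = 0 := by
  rw [divM_sub, H.divM_K hκ, H'.divM_K hκ', mul_smul, mul_smul, hreal, sub_self]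

/-- One term contains `div Y`, the other pairs the skew `Y` with the symmetric Hessian. -/
lemma Skew.dvg_mulVec {Y : Mat A} (hY : C.Skew Y) (hdiv : C.divM Y = 0) (f : A) :
    C.dvg (Y *ᵥ C.grd f) = 0 := by
  have e1 : ∑ c, C.ip (C.Dm c Y *ᵥ C.grd f) (δ c) = -C.ip (C.grd f) (C.divM Y) := by
    rw [divM, ip_sum_right, ← Finset.sum_neg_distrib]
    exact Finset.sum_congr rfl fun c _ => (hY.Dm c).ip_mulVec _ _
  have e2 : ∑ c, C.ip (Y *ᵥ C.Dv c (C.grd f)) (δ c) = (Y * C.nab (C.grd f)).trace := by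
    rw [← sum_ip_δ_θ (C := C)]
    exact Finset.sum_congr rfl fun c _ => by rw [← Matrix.mulVec_mulVec, nab_θ]
  rw [dvg_eq]
  simp only [Dv_mulVec, ip_add_left, Finset.sum_add_distrib, e1, e2, hdiv]
  rw [trace_skew_mul_selfadjoint hY (ip_nab (C.Dv_grd_symm f))]
  simp [ip]

/-- The Weitzenböck formula for `Y ∇Φ`, which has no divergence. The Laplacians of `κ j`, `κ' j'`
and `∇Φ` are all known; the mismatch between `Ψ` and `Ψ'` is a multiple of `κ j ∇Φ`, and the term
with `κ j` is chosen to compensate it. The remaining terms in `p` and `p'` cancel by `hreal`. -/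
theorem IsTypeD.divM_exd_Y (H : C.IsTypeD j Ψ μ p) (H' : C.IsTypeD j' Ψ' μ p')
    (hκ : ∀ c, C.pa c κ = -(κ * p c)) (hκ' : ∀ c, C.pa c κ' = -(κ' * p' c))
    (hreal : κ • (j *ᵥ p) = κ' • (j' *ᵥ p')) {Φ : A} (hΦ : C.bx Φ = -2 * (Ψ' + μ) * Φ) :
    C.divM (C.exd ((κ • j - κ' • j') *ᵥ C.grd Φ) * C.h
      + (2 * (Ψ - Ψ') * Φ) • (κ • j)) = 0 := by
  set Y := κ • j - κ' • j' with hYdef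
  have hY : C.Skew Y := (H.skew.smul _).sub (H'.skew.smul _)
  have hdY : C.divM Y = 0 := H.divM_Y H' hκ hκ' hreal
  have hself := ip_nab (C.Dv_grd_symm Φ)
  -- The cross term of the Laplacian. For the selfadjoint Hessian two terms of `IsTypeD.sum_Dm_K`
  -- cancel and the trace with `j` vanishes. The rest depends only on `κ j p`, hence agrees for `j`
  -- and `j'`.
  have h1 : ∑ c, C.Dm c Y *ᵥ (C.nab (C.grd Φ) *ᵥ δ c) = 0 := by
    have e1 := H.sum_Dm_K hκ (C.nab (C.grd Φ)) _ (fun u v => (hself u v).symm)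
    have e2 := H'.sum_Dm_K hκ' (C.nab (C.grd Φ)) _ (fun u v => (hself u v).symm)
    simp only [hYdef, Dm_sub, Matrix.sub_mulVec, Finset.sum_sub_distrib, e1, e2,
      trace_skew_mul_selfadjoint H.skew hself, trace_skew_mul_selfadjoint H'.skew hself]
    have e3 := congrArg (C.nab (C.grd Φ) *ᵥ ·) hreal
    simp only [Matrix.mulVec_smul] at e3
    linear_combination (norm := module) e3 - (C.nab (C.grd Φ)).trace • hreal
  have h2 : C.lapM Y = (2 * (Ψ + μ) * κ) • j - (2 * (Ψ' + μ) * κ') • j' := by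
    have : C.lapM Y = C.lapM (κ • j) - C.lapM (κ' • j') := by
      simp only [lapM, DDm, hYdef, Dm_sub, smul_sub, Finset.sum_sub_distrib]
      abel
    rw [this, H.lapM_K hκ, H'.lapM_K hκ']
  have h3 : C.grd (C.bx Φ) = (-2 * (Ψ' + μ)) • C.grd Φ - (6 * Ψ' * Φ) • p' := by
    ext a
    have : -2 * (Ψ' + μ) * Φ = -(2 * ((Ψ' + μ) * Φ)) := by ring
    simp only [grd, hΦ, this, map_neg, pa_two, Derivation.leibniz, map_add, H'.pa_Ψ, H'.pa_μ,
      smul_eq_mul, Pi.sub_apply, Pi.smul_apply]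
    ring
  have h4 : C.grd (2 * (Ψ - Ψ') * Φ)
      = (2 * (Ψ - Ψ')) • C.grd Φ + (6 * Ψ * Φ) • p - (6 * Ψ' * Φ) • p' := by
    ext a
    simp only [grd, mul_assoc, pa_two, Derivation.leibniz, map_sub, H.pa_Ψ, H'.pa_Ψ,
      smul_eq_mul, Pi.sub_apply, Pi.add_apply, Pi.smul_apply]
    ring
  have h5 : C.grd (0 : A) = 0 := by ext a; simp [grd]
  rw [divM_add, divM_exd H.ricci, hY.dvg_mulVec hdY, h5, lapV_mulVec, h1, h2, lapV_grd H.ricci, h3,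
    divM_smul, H.divM_K hκ, h4]
  simp only [hYdef, Matrix.sub_mulVec, Matrix.smul_mulVec, Matrix.mulVec_add, Matrix.mulVec_sub,
    Matrix.mulVec_smul]
  linear_combination (norm := module) (6 * Ψ' * Φ) • hreal

/-- Twice `i` times the Hodge dual, in terms of the dyad two-form `j`. -/
def dual (j T : Mat A) : Mat A := (j * T).trace • j - (2 : A) • (j * T * j)

/-- Although written with `j`, the dual depends only on the duality class of `j`; varying `j` within
this class does not change it, which is the field `dual_parallel` with the derivative of `j` as
direction. -/
lemma IsTypeD.Dm_dual (H : C.IsTypeD j Ψ μ p) {T : Mat A} (hT : C.Skew T) (c : Fin 4) :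
    C.Dm c (dual j T) = dual j (C.Dm c T) := by
  have h1 := H.dual_parallel (C.Dm c j) T (H.skew.Dm c) (anticomm_of_sq H.sq c) hT
  rw [dual, dual, Dm_sub, Dm_smul, Dm_smul, pa_two, pa_trace, Dm_mul, Dm_mul, Dm_mul,
    Matrix.trace_add]
  simp only [add_mul]
  linear_combination (norm := module) h1

/-- The divergence of the dual of `dV` is `d²V` in disguise. The dual is parallel, so the claim
reduces to `Dl_exd_cyclic` contracted with `j`. -/
lemma IsTypeD.divM_dual_exd (H : C.IsTypeD j Ψ μ p) (V : Cov A) :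
    C.divM (dual j (C.exd V * C.h)) = 0 := by
  have hskew : C.Skew (C.exd V * C.h) := skew_mul_h (exd_transpose V)
  let t : Fin 4 → Mat A := fun c => C.Dl c (C.exd V)
  have ht : ∀ c a b, t c a b = -t c b a := fun c a b => Dl_exd_antisymm c a b V
  have hcyc : ∀ a b c, t a b c + t b c a + t c a b = 0 := fun a b c => Dl_exd_cyclic a b c V
  set U : Mat A := C.h * j with hU
  have hUt : ∀ a b, U a b = -U b a := fun a b => by
    have := congrFun (congrFun H.skew.h_mul_transpose b) a
    rwa [Matrix.transpose_apply, Matrix.neg_apply] at this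
  have h1 : ∀ e, (j * (t e * C.h)).trace = ∑ a, ∑ b, U a b * t e b a := by
    intro e
    rw [← mul_assoc, Matrix.trace_mul_comm, ← mul_assoc]
    rfl
  have h2 : ∀ e, (∑ c, (t c * C.h) *ᵥ (j *ᵥ δ c)) e = ∑ a, ∑ b, U a b * t b e a := by
    intro e
    simp only [Matrix.mulVec_mulVec, Finset.sum_apply, mulVec_δ, mul_assoc, ← hU]
    simp only [Matrix.mul_apply]
    rw [Finset.sum_comm]
    exact Finset.sum_congr rfl fun a _ => Finset.sum_congr rfl fun b _ => mul_comm _ _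
  -- The cyclic identity contracted with the skew `U`: two of its three terms become equal.
  have h3 : ∀ e, ∑ a, ∑ b, U a b * t e b a = 2 * ∑ a, ∑ b, U a b * t b e a := by
    intro e
    have e1 : ∑ a, ∑ b, U a b * t a e b = -∑ a, ∑ b, U a b * t b e a := by
      rw [Finset.sum_comm, ← Finset.sum_neg_distrib]
      refine Finset.sum_congr rfl fun a _ => ?_
      rw [← Finset.sum_neg_distrib]
      exact Finset.sum_congr rfl fun b _ => by rw [hUt b a]; ring
    have e2 : ∑ a, ∑ b, (U a b * t e b a + U a b * t a e b - U a b * t b e a) = 0 := by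
      refine Finset.sum_eq_zero fun a _ => Finset.sum_eq_zero fun b _ => ?_
      have := hcyc e b a
      rw [ht b a e] at this
      linear_combination U a b * this
    simp only [Finset.sum_add_distrib, Finset.sum_sub_distrib, e1] at e2
    linear_combination e2
  have h4 : ∑ c, (j * (t c * C.h)).trace • (δ c : Cov A)
      = (2 : A) • ∑ c, (t c * C.h) *ᵥ (j *ᵥ δ c) := by
    ext e
    rw [Pi.smul_apply, h2, smul_eq_mul, ← h3, ← h1]
    exact congrFun (sum_smul_δ fun c => (j * (t c * C.h)).trace) e
  have h5 := congrArg (j *ᵥ ·) h4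
  simp only [Matrix.mulVec_sum, Matrix.mulVec_smul] at h5
  simp only [divM, H.Dm_dual hskew, Dm_mul_h]
  simp only [dual, Matrix.sub_mulVec, Matrix.smul_mulVec, Finset.sum_sub_distrib,
    ← Matrix.mulVec_mulVec, ← Finset.smul_sum]
  simp only [← Matrix.mulVec_mulVec] at h5
  rw [sub_eq_zero]
  simp only [t] at h5
  exact h5

lemma IsTypeD.skew_dual (H : C.IsTypeD j Ψ μ p) {T : Mat A} (hT : C.Skew T) :
    C.Skew (dual j T) :=
  (H.skew.smul _).sub ((H.skew.conjugate hT).smul _)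

/-- The anti-self-dual part of the field generated by a solution satisfies the Maxwell equations. -/
theorem IsTypeD.divM_asd (H : C.IsTypeD j Ψ μ p) (H' : C.IsTypeD j' Ψ' μ p')
    (hκ : ∀ c, C.pa c κ = -(κ * p c)) (hκ' : ∀ c, C.pa c κ' = -(κ' * p' c))
    (hreal : κ • (j *ᵥ p) = κ' • (j' *ᵥ p')) {Φ : A} (hΦ : C.bx Φ = -2 * (Ψ' + μ) * Φ)
    {T : Mat A} (hT : T = C.exd ((κ • j - κ' • j') *ᵥ C.grd Φ) * C.h) :
    C.divM ((2 : A) • T + dual j T + (4 * (Ψ - Ψ') * Φ) • (κ • j)) = 0 := by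
  have h1 := H.divM_exd_Y H' hκ hκ' hreal hΦ
  have h2 := H.divM_dual_exd ((κ • j - κ' • j') *ᵥ C.grd Φ)
  have h3 : (2 : A) • T + dual j T + (4 * (Ψ - Ψ') * Φ) • (κ • j)
      = (2 : A) • (T + (2 * (Ψ - Ψ') * Φ) • (κ • j)) + dual j T := by module
  rw [h3, divM_add, divM_two_smul, hT, h1, h2, smul_zero, add_zero]

/-- The symmetry operator maps solutions to solutions. -/
theorem IsTypeD.symmetry_operator (H : C.IsTypeD j Ψ μ p) (H' : C.IsTypeD j' Ψ' μ p')
    (hκ : ∀ c, C.pa c κ = -(κ * p c)) (hκ' : ∀ c, C.pa c κ' = -(κ' * p' c))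
    (hreal : κ • (j *ᵥ p) = κ' • (j' *ᵥ p')) {Φ : A} (hΦ : C.bx Φ = -2 * (Ψ' + μ) * Φ)
    {T : Mat A} (hT : T = C.exd ((κ • j - κ' • j') *ᵥ C.grd Φ) * C.h) :
    C.bx (κ * (2 * (j * T).trace + 8 * (Ψ - Ψ') * Φ * κ))
      = -2 * (Ψ + μ) * (κ * (2 * (j * T).trace + 8 * (Ψ - Ψ') * Φ * κ)) := by
  have h1 := H.divM_asd H' hκ hκ' hreal hΦ hT
  have hskew : C.Skew T := hT ▸ skew_mul_h (exd_transpose _)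
  -- In the anticommutator with `j` the terms `j T` and `T j` cancel between `2 T` and its dual.
  -- What remains is the scalar `s = 2 tr (j T) + 8 (Ψ - Ψ') Φ κ`.
  refine H.fackerell_ipser hκ
    (((hskew.smul _).add (H.skew_dual hskew)).add ((H.skew.smul _).smul _)) ?_ h1
  have e1 : j * T * j * j = j * T := by rw [mul_assoc, H.sq, mul_one]
  have e2 : j * (j * T * j) = T * j := by
    rw [← mul_assoc, ← mul_assoc, H.sq, one_mul]
  simp only [dual, add_mul, mul_add, sub_mul, mul_sub, Matrix.smul_mul, Matrix.mul_smul, H.sq, e1,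
    e2]
  module

/-! ### The Carter operator -/

/-- In the real case the dual part of the symmetry operator vanishes. -/
theorem IsTypeD.carter (H : C.IsTypeD j Ψ μ p) (H' : C.IsTypeD j' Ψ' μ p)
    (hκ : ∀ c, C.pa c κ = -(κ * p c)) (hjj : j * j' = j' * j) (Φ : A) :
    ∑ c, C.ip ((κ • j + κ • j') *ᵥ C.Dv c ((κ • j - κ • j') *ᵥ C.grd Φ)) (δ c) = 0 := by
  set T := κ • j + κ • j' with hTdef
  set Y := κ • j - κ • j' with hYdef
  have hT : C.Skew T := (H.skew.smul _).add (H'.skew.smul _)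
  have hY : C.Skew Y := (H.skew.smul _).sub (H'.skew.smul _)
  -- Both `j` and `j'` square to one and commute, so `(j + j')(j - j') = 0`. Hence the second
  -- derivatives of `Φ` do not contribute, and only the derivative of `Y` is left.
  have hTY : T * Y = 0 := by
    simp only [hTdef, hYdef, add_mul, mul_sub, Matrix.smul_mul, Matrix.mul_smul, H.sq, H'.sq, hjj]
    module
  have hT' : ∀ u v, C.ip u (T *ᵥ v) = C.ip (-T *ᵥ u) v := fun u v => by
    rw [Matrix.neg_mulVec, ip_neg_left, hT.ip_mulVec, neg_neg]
  have hjjv : ∀ v, j' *ᵥ (j *ᵥ v) = j *ᵥ (j' *ᵥ v) := fun v => by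
    rw [Matrix.mulVec_mulVec, Matrix.mulVec_mulVec, hjj]
  have hj2 : ∀ v, j *ᵥ (j *ᵥ v) = v := fun v => by
    rw [Matrix.mulVec_mulVec, H.sq, Matrix.one_mulVec]
  have hj2' : ∀ v, j' *ᵥ (j' *ᵥ v) = v := fun v => by
    rw [Matrix.mulVec_mulVec, H'.sq, Matrix.one_mulVec]
  have h1 : ∑ c, C.Dm c Y *ᵥ (T *ᵥ δ c) = 0 := by
    have e1 := H.sum_Dm_K hκ T _ hT'
    have e2 := H'.sum_Dm_K hκ T _ hT'
    simp only [hYdef, Dm_sub, Matrix.sub_mulVec, Finset.sum_sub_distrib]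
    rw [e1, e2, hT.trace_eq_zero]
    simp only [hTdef, mul_add, Matrix.mul_smul, H.sq, H'.sq, hjj, Matrix.neg_mulVec,
      Matrix.mulVec_neg, Matrix.add_mulVec, Matrix.smul_mulVec, Matrix.mulVec_add,
      Matrix.mulVec_smul, hjjv, hj2, hj2', Matrix.trace_add]
    module
  have h2 : ∀ c, C.ip (T *ᵥ C.Dv c (Y *ᵥ C.grd Φ)) (δ c)
      = C.ip (C.grd Φ) (C.Dm c Y *ᵥ (T *ᵥ δ c)) := by
    intro c
    rw [Dv_mulVec, Matrix.mulVec_add, Matrix.mulVec_mulVec _ T Y, hTY, Matrix.zero_mulVec, add_zero,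
      hT.ip_mulVec, (hY.Dm c).ip_mulVec, neg_neg]
  simp only [h2, ← ip_sum_right, h1]
  simp [ip]

end Calc

/-! ### Linear algebra in a null tetrad -/

/-- The metric in a null tetrad `(l, n, m, m̄)`. -/
def nullMetric : Mat ℂ := !![0, 1, 0, 0; 1, 0, 0, 0; 0, 0, 0, -1; 0, 0, -1, 0]

/-- Twice the dyad form in a null tetrad, with both indices up. -/
def nullForm : Mat ℂ := !![0, 1, 0, 0; -1, 0, 0, 0; 0, 0, 0, -1; 0, 0, 1, 0]

/-- Twice the dyad form in a null tetrad, as an endomorphism. -/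
def nullDiag : Mat ℂ := Matrix.diagonal ![-1, 1, -1, 1]

/-- Twice the conjugate dyad form in a null tetrad, as an endomorphism. -/
def nullDiagConj : Mat ℂ := Matrix.diagonal ![-1, 1, 1, -1]

lemma nullMetric_sq : nullMetric * nullMetric = 1 := by
  ext i k
  fin_cases i <;> fin_cases k <;> simp [nullMetric, Matrix.mul_apply, Fin.sum_univ_four]

lemma nullMetric_transpose : nullMetricᵀ = nullMetric := by
  ext i k
  fin_cases i <;> fin_cases k <;> simp [nullMetric]

lemma nullMetric_mul_nullForm : nullMetric * nullForm = nullDiag := by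
  ext i k
  fin_cases i <;> fin_cases k <;>
    simp [nullMetric, nullForm, nullDiag, Matrix.mul_apply, Fin.sum_univ_four]

lemma nullDiag_sq : nullDiag * nullDiag = 1 := by
  ext i k
  fin_cases i <;> fin_cases k <;> simp [nullDiag]

/-- An endomorphism that anticommutes with the diagonal matrix exchanges its two eigenspaces, `{0,
2}` and `{1, 3}`; the diagonal blocks are zero. In `nullDiag_entries_comm` the off-diagonal blocks
are zero. -/
lemma nullDiag_entries {N : Mat ℂ} (h : N * nullDiag = -(nullDiag * N)) :
    N 0 0 = 0 ∧ N 0 2 = 0 ∧ N 2 0 = 0 ∧ N 2 2 = 0 ∧ N 1 1 = 0 ∧ N 1 3 = 0 ∧ N 3 1 = 0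
      ∧ N 3 3 = 0 := by
  have e : ∀ i k, N i k * ![(-1 : ℂ), 1, -1, 1] k = -(![(-1 : ℂ), 1, -1, 1] i * N i k) := by
    intro i k
    have := congrFun (congrFun h i) k
    simpa [nullDiag] using this
  have h00 := e 0 0
  have h02 := e 0 2
  have h20 := e 2 0
  have h22 := e 2 2
  have h11 := e 1 1
  have h13 := e 1 3
  have h31 := e 3 1
  have h33 := e 3 3
  simp at h00 h02 h20 h22 h11 h13 h31 h33
  refine ⟨?_, ?_, ?_, ?_, ?_, ?_, ?_, ?_⟩ <;> grind

lemma nullDiag_entries_comm {X : Mat ℂ} (h : X * nullDiag = nullDiag * X) :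
    X 0 1 = 0 ∧ X 0 3 = 0 ∧ X 2 1 = 0 ∧ X 2 3 = 0 ∧ X 1 0 = 0 ∧ X 1 2 = 0 ∧ X 3 0 = 0
      ∧ X 3 2 = 0 := by
  have e : ∀ i k, X i k * ![(-1 : ℂ), 1, -1, 1] k = ![(-1 : ℂ), 1, -1, 1] i * X i k := by
    intro i k
    have := congrFun (congrFun h i) k
    simpa [nullDiag] using this
  have h00 := e 0 1
  have h02 := e 0 3
  have h20 := e 2 1
  have h22 := e 2 3
  have h11 := e 1 0
  have h13 := e 1 2
  have h31 := e 3 0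
  have h33 := e 3 2
  simp at h00 h02 h20 h22 h11 h13 h31 h33
  refine ⟨?_, ?_, ?_, ?_, ?_, ?_, ?_, ?_⟩ <;> grind

lemma nullMetric_skew_entries {X : Mat ℂ} (h : Xᵀ * nullMetric = -(nullMetric * X)) :
    X 1 0 = 0 ∧ X 0 1 = 0 ∧ X 3 2 = 0 ∧ X 2 3 = 0 ∧ X 1 1 = -X 0 0 ∧ X 3 3 = -X 2 2
      ∧ X 3 0 = X 1 2 ∧ X 2 0 = X 1 3 ∧ X 3 1 = X 0 2 ∧ X 2 1 = X 0 3 := by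
  have e : ∀ i k, (Xᵀ * nullMetric) i k = -(nullMetric * X) i k := fun i k =>
    congrFun (congrFun h i) k
  have h00 := e 0 0
  have h01 := e 0 1
  have h02 := e 0 2
  have h03 := e 0 3
  have h11 := e 1 1
  have h12 := e 1 2
  have h13 := e 1 3
  have h22 := e 2 2
  have h23 := e 2 3
  have h33 := e 3 3
  simp [Matrix.mul_apply, Fin.sum_univ_four, nullMetric] at h00 h01 h02 h03 h11 h12 h13 h22 h23 h33
  refine ⟨?_, ?_, ?_, ?_, ?_, ?_, ?_, ?_, ?_, ?_⟩ <;> grind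

/-- The skew endomorphisms split into two commuting copies of `sl₂`. Anticommuting with `nullDiag`
puts `N` into the copy that contains `nullDiag`; commuting with it and being trace-orthogonal to it
puts `X` into the other one. -/
lemma nullFrame_commute {X N : Mat ℂ} (hX : Xᵀ * nullMetric = -(nullMetric * X))
    (hXd : X * nullDiag = nullDiag * X) (htr : (X * nullDiag).trace = 0)
    (hN : Nᵀ * nullMetric = -(nullMetric * N)) (hNd : N * nullDiag = -(nullDiag * N)) :
    N * X = X * N := by
  obtain ⟨n1, n2, n3, n4, n5, n6, n7, n8⟩ := nullDiag_entries hNd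
  obtain ⟨x1, x2, x3, x4, x5, x6, x7, x8⟩ := nullDiag_entries_comm hXd
  obtain ⟨-, -, -, -, y1, y2, y3, y4, y5, y6⟩ := nullMetric_skew_entries hX
  obtain ⟨m1, m2, m3, m4, -, -, m5, m6, m7, m8⟩ := nullMetric_skew_entries hN
  simp [Matrix.trace, Fin.sum_univ_four, nullDiag, y1, y2] at htr
  have t : X 2 2 = -X 0 0 := by linear_combination -(1 / 2) * htr
  ext i k
  fin_cases i <;> fin_cases k <;>
    simp [Matrix.mul_apply, Fin.sum_univ_four, n1, n2, n3, n4, n5, n6, n7, n8, x1, x2, x3, x4, x5,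
      x6, x7, x8, y1, y2, y4, y5, m1, m2, m3, m4, m5, m8, t] <;> ring

/-- The left side is the derivative of `Calc.dual` in its first argument at `nullDiag`, in the
direction `N` tangent to the forms of the same duality and norm. -/
lemma nullFrame_dual_parallel {N T : Mat ℂ} (hN : Nᵀ * nullMetric = -(nullMetric * N))
    (hNd : N * nullDiag = -(nullDiag * N)) (hT : Tᵀ * nullMetric = -(nullMetric * T)) :
    (N * T).trace • nullDiag + (nullDiag * T).trace • N - (2 : ℂ) • (N * T * nullDiag)
      - (2 : ℂ) • (nullDiag * T * N) = 0 := by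
  obtain ⟨n1, n2, n3, n4, n5, n6, n7, n8⟩ := nullDiag_entries hNd
  obtain ⟨m1, m2, m3, m4, -, -, m5, m6, m7, m8⟩ := nullMetric_skew_entries hN
  obtain ⟨t1, t2, t3, t4, t5, t6, t7, t8, t9, t10⟩ := nullMetric_skew_entries hT
  have hd : ∀ Y : Mat ℂ, ∀ i k, (Y * nullDiag) i k = Y i k * ![(-1 : ℂ), 1, -1, 1] k := by
    intro Y i k; simp [nullDiag]
  have hd' : ∀ Y : Mat ℂ, ∀ i k, (nullDiag * Y) i k = ![(-1 : ℂ), 1, -1, 1] i * Y i k := by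
    intro Y i k; simp [nullDiag]
  have hdd : ∀ i k, nullDiag i k = if i = k then ![(-1 : ℂ), 1, -1, 1] i else 0 := by
    intro i k; simp [nullDiag, Matrix.diagonal_apply]
  ext i k
  simp only [Matrix.sub_apply, Matrix.add_apply, Matrix.smul_apply, smul_eq_mul, hd,
    mul_assoc nullDiag, hd', Matrix.trace, Matrix.diag, hdd, Matrix.zero_apply]
  fin_cases i <;> fin_cases k <;>
    simp [Matrix.mul_apply, Fin.sum_univ_four, n1, n2, n3, n4, n5, n6, n7, n8, m1, m2, m3, m4, m5,
      m8, t1, t2, t3, t4, t5, t6, t7, t8, t9, t10] <;> ring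

/-- The algebraic form of a curvature tensor of type D in a principal tetrad. -/
lemma nullFrame_weyl {c : Fin 4 → Fin 4 → Fin 4 → Fin 4 → ℂ} {ψ ψ' : ℂ}
    (h12 : ∀ i k m n, c i k m n = -c k i m n) (h34 : ∀ i k m n, c i k m n = -c i k n m)
    (hp : ∀ i k m n, c i k m n = c m n i k)
    (hc : ∀ i k m n, c i k m n + c k m i n + c m i k n = 0)
    (ht : ∀ i m, c i 0 m 1 + c i 1 m 0 - c i 2 m 3 - c i 3 m 2 = 0)
    (v0 : c 0 2 0 2 = 0) (v1 : c 0 2 0 1 = 0) (v1' : c 0 3 0 1 = 0)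
    (v2 : c 0 2 3 1 = ψ) (v2' : c 0 3 2 1 = ψ') (v3 : c 0 1 3 1 = 0) (v3' : c 0 1 2 1 = 0)
    (v4 : c 3 1 3 1 = 0) :
    (∀ i k, c i k 0 2 = ψ * (nullMetric i 0 * nullMetric k 2 - nullMetric i 2 * nullMetric k 0)) ∧
    (∀ i k, c i k 1 3 = ψ * (nullMetric i 1 * nullMetric k 3 - nullMetric i 3 * nullMetric k 1)) ∧
    (∀ i k, c i k 1 0 - c i k 0 1 + (c i k 2 3 - c i k 3 2)
      = 4 * ψ * (nullMetric * nullForm * nullMetric) i k) := by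
  have d12 : ∀ i m n, c i i m n = 0 := fun i m n => by have := h12 i i m n; grind
  have d34 : ∀ i k m, c i k m m = 0 := fun i k m => by have := h34 i k m m; grind
  -- The given components are the Weyl scalars and some of their conjugates. Trace-freeness and the
  -- pair symmetries express the other components through them, and the cyclic identity supplies `c
  -- 0 1 2 3`.
  have e1 : c 0 2 0 3 = 0 := by
    have := ht 0 0; have := hp 0 2 0 3; have := d12 0 0 1; have := d34 0 1 0; grind
  have e2 : c 1 2 1 3 = 0 := by
    have := ht 1 1; have := hp 1 2 1 3; have := d12 1 1 0; have := d34 1 0 1; grind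
  have e3 : c 0 2 1 2 = 0 := by
    have := ht 2 2; have := hp 0 2 1 2; have := h12 2 0 2 1; have := h12 2 1 2 0
    have := h34 0 2 2 1; have := h34 1 2 2 0; have := d12 2 2 3; have := d34 2 3 2; grind
  have e4 : c 0 3 1 3 = 0 := by
    have := ht 3 3; have := hp 0 3 1 3; have := h12 3 0 3 1; have := h12 3 1 3 0
    have := h34 0 3 3 1; have := h34 1 3 3 0; have := d12 3 3 2; have := d34 3 2 3; grind
  have e5 : c 0 1 0 1 = ψ + ψ' := by
    have := ht 0 1; have := h34 0 1 1 0; have := h34 0 2 1 3; have := h34 0 3 1 2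
    have := d12 0 1 1; grind
  have e6 : c 0 2 2 3 = 0 := by
    have := ht 0 2; have := d12 0 2 1; have := h34 0 1 2 0; have := hp 0 1 0 2
    have := d34 0 3 2; grind
  have e7 : c 0 3 2 3 = 0 := by
    have := ht 0 3; have := d12 0 3 1; have := h34 0 1 3 0; have := hp 0 1 0 3
    have := d34 0 2 3; have := h34 0 3 3 2; grind
  have e8 : c 1 2 2 3 = 0 := by
    have := ht 1 2; have := d12 1 2 0; have := h12 1 0 2 1; have := d34 1 3 2; grind
  have e9 : c 1 3 2 3 = 0 := by
    have := ht 1 3; have := d12 1 3 0; have := h12 1 0 3 1; have := d34 1 2 3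
    have := h34 1 3 3 2; grind
  have e10 : c 1 2 0 3 = -ψ' := by
    have := hp 1 2 0 3; have := h34 0 3 1 2; grind
  have e11 : c 0 2 1 3 = -ψ := by
    have := h34 0 2 1 3; grind
  have e12 : c 2 3 2 3 = ψ + ψ' := by
    have := ht 2 3; have := d12 2 3 3; have := h12 2 0 3 1; have := h12 2 1 3 0
    have := h34 1 2 3 0; have := h34 2 3 3 2; grind
  have e13 : c 0 1 2 3 = ψ' - ψ := by
    have := hc 0 1 2 3; have := h12 2 0 1 3; grind
  have p1 : c 0 1 0 2 = 0 := by rw [hp, v1]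
  have p2 : c 0 3 0 2 = 0 := by rw [hp, e1]
  have p3 : c 1 2 0 2 = 0 := by rw [hp, e3]
  have p4 : c 1 3 0 2 = -ψ := by rw [hp, e11]
  have p5 : c 2 3 0 2 = 0 := by rw [hp, e6]
  have p6 : c 0 1 1 3 = 0 := by rw [h34, v3, neg_zero]
  have p7 : c 1 3 1 3 = 0 := by rw [h12, h34, v4]; simp
  have p8 : c 2 3 1 3 = 0 := by rw [hp, e9]
  have p9 : c 0 1 1 2 = 0 := by rw [h34, v3', neg_zero]
  have q : ∀ i k, c i k 1 0 - c i k 0 1 + (c i k 2 3 - c i k 3 2)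
      = 2 * (c i k 2 3 - c i k 0 1) := fun i k => by rw [h34 i k 1 0, h34 i k 3 2]; ring
  have r1 : c 1 2 0 1 = 0 := by rw [hp, p9]
  have r2 : c 1 3 0 1 = 0 := by rw [hp, p6]
  have r3 : c 2 3 0 1 = ψ' - ψ := by rw [hp, e13]
  simp only [q]
  refine ⟨fun i k => ?_, fun i k => ?_, fun i k => ?_⟩
  · fin_cases i <;> fin_cases k <;>
      simp [nullMetric, d12, h12 1 0, h12 2 0, h12 2 1, h12 3 0, h12 3 1, h12 3 2, v0, p1, p2, p3,
        p4, p5]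
  · fin_cases i <;> fin_cases k <;>
      simp [nullMetric, d12, h12 1 0, h12 2 0, h12 2 1, h12 3 0, h12 3 1, h12 3 2, p6, e2, e4, e11,
        p7, p8]
  · fin_cases i <;> fin_cases k <;>
      simp [nullMetric, nullForm, Matrix.mul_apply, Fin.sum_univ_four, d12, h12 1 0, h12 2 0,
        h12 2 1, h12 3 0, h12 3 1, h12 3 2, e5, e6, e7, e8, e9, e12, e13, v1, v1', r1, r2, r3] <;>
      ring

/-! ### Change of frame -/

/-- The rows of `E` are a null tetrad for the metric `g` with inverse `h`. -/
structure IsFrame (g h E : Mat ℂ) : Prop where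
  gram : E * g * Eᵀ = nullMetric
  g_mul_h : g * h = 1
  g_symm : gᵀ = g

namespace IsFrame

variable {g h E : Mat ℂ}

lemma mul_inv (F : IsFrame g h E) : E * (g * Eᵀ * nullMetric) = 1 := by
  rw [← mul_assoc, ← mul_assoc, F.gram, nullMetric_sq]

lemma inv_mul (F : IsFrame g h E) : g * Eᵀ * nullMetric * E = 1 := mul_eq_one_comm.mp F.mul_inv

lemma h_eq (F : IsFrame g h E) : h = Eᵀ * nullMetric * E := by
  have h1 : g * (Eᵀ * nullMetric * E) = 1 := by
    have := F.inv_mul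
    simpa only [mul_assoc] using this
  have h2 : h * g = 1 := mul_eq_one_comm.mp F.g_mul_h
  calc h = h * (g * (Eᵀ * nullMetric * E)) := by rw [h1, mul_one]
    _ = _ := by rw [← mul_assoc, h2, one_mul]

/-- Conjugation by `E`, whose inverse is `g Eᵀ` times `nullMetric`, turns skewness for `h` into
skewness for the constant metric. With `conj_mul` and `conj_injective` it reduces identities at a
point to the null frame. -/
lemma transport_skew (F : IsFrame g h E) {X : Mat ℂ} (hX : Xᵀ * h = -(h * X)) :
    (E * X * (g * Eᵀ * nullMetric))ᵀ * nullMetric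
      = -(nullMetric * (E * X * (g * Eᵀ * nullMetric))) := by
  set Ei := g * Eᵀ * nullMetric with hEi
  have h1 : Ei * E = 1 := F.inv_mul
  have h0 : E * Ei = 1 := F.mul_inv
  have h1t : Eᵀ * Eiᵀ = 1 := by rw [← Matrix.transpose_mul, h1, Matrix.transpose_one]
  have h0t : Eiᵀ * Eᵀ = 1 := by rw [← Matrix.transpose_mul, h0, Matrix.transpose_one]
  rw [F.h_eq] at hX
  have h2 := congrArg (fun Y => Eiᵀ * Y * Ei) hX
  calc (E * X * Ei)ᵀ * nullMetric = Eiᵀ * (Xᵀ * (Eᵀ * nullMetric * E)) * Ei := by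
        rw [Matrix.transpose_mul (E * X) Ei, Matrix.transpose_mul E X]
        calc Eiᵀ * (Xᵀ * Eᵀ) * nullMetric = Eiᵀ * Xᵀ * Eᵀ * nullMetric * 1 := by
              noncomm_ring
          _ = _ := by rw [← h0]; noncomm_ring
    _ = Eiᵀ * -(Eᵀ * nullMetric * E * X) * Ei := by rw [hX]
    _ = -((Eiᵀ * Eᵀ) * nullMetric * (E * X * Ei)) := by noncomm_ring
    _ = _ := by rw [h0t, one_mul]

lemma conj_mul (F : IsFrame g h E) (X Y : Mat ℂ) : E * (X * Y) * (g * Eᵀ * nullMetric)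
    = E * X * (g * Eᵀ * nullMetric) * (E * Y * (g * Eᵀ * nullMetric)) := by
  set Ei := g * Eᵀ * nullMetric with hEi
  have h1 : Ei * E = 1 := F.inv_mul
  calc E * (X * Y) * Ei = E * X * 1 * Y * Ei := by noncomm_ring
    _ = _ := by rw [← h1]; noncomm_ring

lemma conj_injective (F : IsFrame g h E) {X Y : Mat ℂ}
    (hXY : E * X * (g * Eᵀ * nullMetric) = E * Y * (g * Eᵀ * nullMetric)) : X = Y := by
  set Ei := g * Eᵀ * nullMetric with hEi
  have h1 : Ei * E = 1 := F.inv_mul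
  have := congrArg (fun Z => Ei * Z * E) hXY
  calc X = (Ei * E) * X * (Ei * E) := by rw [h1, one_mul, mul_one]
    _ = Ei * (E * X * Ei) * E := by noncomm_ring
    _ = Ei * (E * Y * Ei) * E := by rw [hXY]
    _ = (Ei * E) * Y * (Ei * E) := by noncomm_ring
    _ = Y := by rw [h1, one_mul, mul_one]

lemma conj_trace (F : IsFrame g h E) (X : Mat ℂ) :
    (E * X * (g * Eᵀ * nullMetric)).trace = X.trace := by
  rw [Matrix.trace_mul_comm, ← mul_assoc, F.inv_mul, one_mul]

lemma conj_nullForm (F : IsFrame g h E) :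
    E * (g * Eᵀ * nullForm * E) * (g * Eᵀ * nullMetric) = nullDiag := by
  calc E * (g * Eᵀ * nullForm * E) * (g * Eᵀ * nullMetric)
      = (E * g * Eᵀ) * nullForm * (E * (g * Eᵀ * nullMetric)) := by noncomm_ring
    _ = nullDiag := by rw [F.gram, F.mul_inv, mul_one, nullMetric_mul_nullForm]

lemma sq (F : IsFrame g h E) : (g * Eᵀ * nullForm * E) * (g * Eᵀ * nullForm * E) = 1 := by
  refine F.conj_injective ?_
  rw [F.conj_mul, F.conj_nullForm, nullDiag_sq, mul_one, F.mul_inv]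

lemma commute_of (F : IsFrame g h E) {X N : Mat ℂ} (hX : Xᵀ * h = -(h * X))
    (hXj : X * (g * Eᵀ * nullForm * E) = g * Eᵀ * nullForm * E * X)
    (htr : (X * (g * Eᵀ * nullForm * E)).trace = 0) (hN : Nᵀ * h = -(h * N))
    (hNj : N * (g * Eᵀ * nullForm * E) = -(g * Eᵀ * nullForm * E * N)) : N * X = X * N := by
  refine F.conj_injective ?_
  rw [F.conj_mul, F.conj_mul]
  refine nullFrame_commute (F.transport_skew hX) ?_ ?_ (F.transport_skew hN) ?_
  · rw [← F.conj_nullForm, ← F.conj_mul, ← F.conj_mul, hXj]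
  · rw [← F.conj_nullForm, ← F.conj_mul, F.conj_trace, htr]
  · rw [← F.conj_nullForm, ← F.conj_mul, ← F.conj_mul, hNj, mul_neg, neg_mul]

lemma dual_parallel (F : IsFrame g h E) {N T : Mat ℂ} (hN : Nᵀ * h = -(h * N))
    (hNj : N * (g * Eᵀ * nullForm * E) = -(g * Eᵀ * nullForm * E * N))
    (hT : Tᵀ * h = -(h * T)) :
    (N * T).trace • (g * Eᵀ * nullForm * E) + (g * Eᵀ * nullForm * E * T).trace • N
      - (2 : ℂ) • (N * T * (g * Eᵀ * nullForm * E))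
      - (2 : ℂ) • (g * Eᵀ * nullForm * E * T * N) = 0 := by
  refine F.conj_injective ?_
  have h1 := nullFrame_dual_parallel (F.transport_skew hN)
    (by rw [← F.conj_nullForm, ← F.conj_mul, ← F.conj_mul, hNj, mul_neg, neg_mul])
    (F.transport_skew hT)
  rw [← F.conj_nullForm] at h1
  simp only [← F.conj_mul, F.conj_trace] at h1
  rw [mul_zero, zero_mul, ← h1]
  simp only [mul_add, add_mul, mul_sub, sub_mul, Matrix.mul_smul, Matrix.smul_mul]

lemma eq_zero_of_frame (F : IsFrame g h E) {f : Mat ℂ} (hf : E * f * Eᵀ = 0) : f = 0 := by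
  have h1 := F.inv_mul
  set Ei := g * Eᵀ * nullMetric with hEi
  have h1t : Eᵀ * Eiᵀ = 1 := by rw [← Matrix.transpose_mul, h1, Matrix.transpose_one]
  calc f = (Ei * E) * f * (Eᵀ * Eiᵀ) := by rw [h1, h1t, one_mul, mul_one]
    _ = Ei * (E * f * Eᵀ) * Eiᵀ := by noncomm_ring
    _ = 0 := by rw [hf, mul_zero, zero_mul]

/-- A family of matrices vanishes if its components in the frame vanish. -/
lemma family_eq_zero (F : IsFrame g h E) {f : Fin 4 → Fin 4 → Mat ℂ}
    (hf : ∀ i k, ∑ a, ∑ b, (E i a * E k b) • (E * f a b * Eᵀ) = 0) (a b : Fin 4) : f a b = 0 := by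
  have h1 : ∀ a b, E * f a b * Eᵀ = 0 := by
    intro a b
    ext c d
    have h2 : (Matrix.of fun a b => (E * f a b * Eᵀ) c d) = 0 := by
      refine F.eq_zero_of_frame ?_
      ext i k
      have := congrFun (congrFun (hf i k) c) d
      simp only [Matrix.sum_apply, Matrix.smul_apply, smul_eq_mul, Matrix.zero_apply] at this
      rw [Matrix.zero_apply, ← this]
      simp only [Matrix.mul_apply (M := E * _), Matrix.mul_apply (M := E), Matrix.transpose_apply,
        Matrix.of_apply, Finset.sum_mul]
      rw [Finset.sum_comm]
      exact Finset.sum_congr rfl fun a _ => Finset.sum_congr rfl fun b _ => by ring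
    have := congrFun (congrFun h2 a) b
    simpa using this
  exact F.eq_zero_of_frame (h1 a b)

end IsFrame

/-- The components of a tensor with four lower indices in the frame `E`. -/
def frame4 (E : Mat ℂ) (c : Fin 4 → Fin 4 → Fin 4 → Fin 4 → ℂ) (i k m n : Fin 4) : ℂ :=
  ∑ a, ∑ b, ∑ c', ∑ d, c a b c' d * E i a * E k b * E m c' * E n d

lemma frame4_eq (E : Mat ℂ) (c : Fin 4 → Fin 4 → Fin 4 → Fin 4 → ℂ) (i k m n : Fin 4) :
    frame4 E c i k m n
      = (∑ a, ∑ b, (E i a * E k b) • (E * (Matrix.of fun x y => c a b x y) * Eᵀ)) m n := by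
  simp only [frame4, Matrix.sum_apply, Matrix.smul_apply, smul_eq_mul, Matrix.mul_apply,
    Matrix.transpose_apply, Matrix.of_apply, Finset.sum_mul, Finset.mul_sum]
  refine Finset.sum_congr rfl fun a _ => Finset.sum_congr rfl fun b _ => ?_
  rw [Finset.sum_comm]
  exact Finset.sum_congr rfl fun x _ => Finset.sum_congr rfl fun y _ => by ring

lemma frame4_neg_of_swap12 {E : Mat ℂ} {c : Fin 4 → Fin 4 → Fin 4 → Fin 4 → ℂ}
    (h : ∀ a b x y, c a b x y = -c b a x y) (i k m n : Fin 4) :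
    frame4 E c i k m n = -frame4 E c k i m n := by
  rw [frame4, Finset.sum_comm, frame4]
  simp only [← Finset.sum_neg_distrib]
  refine Finset.sum_congr rfl fun a _ => Finset.sum_congr rfl fun b _ => Finset.sum_congr rfl
    fun x _ => Finset.sum_congr rfl fun y _ => ?_
  rw [h]; ring

lemma frame4_neg_of_swap34 {E : Mat ℂ} {c : Fin 4 → Fin 4 → Fin 4 → Fin 4 → ℂ}
    (h : ∀ a b x y, c a b x y = -c a b y x) (i k m n : Fin 4) :
    frame4 E c i k m n = -frame4 E c i k n m := by
  rw [frame4, frame4]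
  simp only [← Finset.sum_neg_distrib]
  refine Finset.sum_congr rfl fun a _ => Finset.sum_congr rfl fun b _ => ?_
  rw [Finset.sum_comm]
  refine Finset.sum_congr rfl fun x _ => Finset.sum_congr rfl fun y _ => ?_
  rw [h]; ring

lemma frame4_neg_of_swap23 {E : Mat ℂ} {c : Fin 4 → Fin 4 → Fin 4 → Fin 4 → ℂ}
    (h : ∀ a b x y, c a b x y = -c a x b y) (i k m n : Fin 4) :
    frame4 E c i k m n = -frame4 E c i m k n := by
  rw [frame4, frame4]
  simp only [← Finset.sum_neg_distrib]
  refine Finset.sum_congr rfl fun a _ => ?_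
  rw [Finset.sum_comm]
  refine Finset.sum_congr rfl fun b _ => Finset.sum_congr rfl fun x _ => Finset.sum_congr rfl
    fun y _ => ?_
  rw [h]; ring

lemma frame4_pair {E : Mat ℂ} {c : Fin 4 → Fin 4 → Fin 4 → Fin 4 → ℂ}
    (h : ∀ a b x y, c a b x y = c x y a b) (i k m n : Fin 4) :
    frame4 E c i k m n = frame4 E c m n i k := by
  have h1 : ∀ i k m n, frame4 E c i k m n
      = ∑ p : Fin 4 × Fin 4, ∑ q : Fin 4 × Fin 4,
        c p.1 p.2 q.1 q.2 * E i p.1 * E k p.2 * E m q.1 * E n q.2 := by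
    intro i k m n
    simp only [frame4, Fintype.sum_prod_type]
  rw [h1, h1, Finset.sum_comm]
  refine Finset.sum_congr rfl fun a _ => Finset.sum_congr rfl fun b _ => ?_
  rw [h]; ring

lemma frame4_cyclic {E : Mat ℂ} {c : Fin 4 → Fin 4 → Fin 4 → Fin 4 → ℂ}
    (h : ∀ a b x y, c a b x y + c b x a y + c x a b y = 0) (i k m n : Fin 4) :
    frame4 E c i k m n + frame4 E c k m i n + frame4 E c m i k n = 0 := by
  have h2 : frame4 E c k m i n
      = ∑ a, ∑ b, ∑ x, ∑ y, c b x a y * E i a * E k b * E m x * E n y := by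
    rw [frame4, Finset.sum_congr rfl fun a _ => Finset.sum_comm, Finset.sum_comm]
    refine Finset.sum_congr rfl fun a _ => Finset.sum_congr rfl fun b _ => Finset.sum_congr rfl
      fun x _ => Finset.sum_congr rfl fun y _ => ?_
    ring
  have h3 : frame4 E c m i k n
      = ∑ a, ∑ b, ∑ x, ∑ y, c x a b y * E i a * E k b * E m x * E n y := by
    rw [frame4, Finset.sum_comm, Finset.sum_congr rfl fun a _ => Finset.sum_comm]
    refine Finset.sum_congr rfl fun a _ => Finset.sum_congr rfl fun b _ => Finset.sum_congr rfl
      fun x _ => Finset.sum_congr rfl fun y _ => ?_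
    ring
  rw [h2, h3, frame4]
  simp only [← Finset.sum_add_distrib]
  refine Finset.sum_eq_zero fun a _ => Finset.sum_eq_zero fun b _ => Finset.sum_eq_zero fun x _ =>
    Finset.sum_eq_zero fun y _ => ?_
  linear_combination (E i a * E k b * E m x * E n y) * h a b x y

lemma frame4_contract {g h E : Mat ℂ} (F : IsFrame g h E)
    {c : Fin 4 → Fin 4 → Fin 4 → Fin 4 → ℂ}
    (hc : ∀ a x, ∑ b, ∑ y, h b y * c a b x y = 0) (i m : Fin 4) :
    frame4 E c i 0 m 1 + frame4 E c i 1 m 0 - frame4 E c i 2 m 3 - frame4 E c i 3 m 2 = 0 := by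
  have h1 : ∀ b y, h b y
      = E 0 b * E 1 y + E 1 b * E 0 y - E 2 b * E 3 y - E 3 b * E 2 y := by
    intro b y
    rw [F.h_eq]
    simp [Matrix.mul_apply, Fin.sum_univ_four, nullMetric]
    ring
  have h2 : ∑ a, ∑ x, E i a * E m x * ∑ b, ∑ y, h b y * c a b x y = 0 := by simp [hc]
  rw [← h2]
  simp only [frame4, Finset.mul_sum, ← Finset.sum_add_distrib, ← Finset.sum_sub_distrib]
  refine Finset.sum_congr rfl fun a _ => ?_
  rw [Finset.sum_comm]
  refine Finset.sum_congr rfl fun x _ => Finset.sum_congr rfl fun b _ => Finset.sum_congr rfl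
    fun y _ => ?_
  rw [h1]; ring

/-! ### The curvature of a type D background at a point -/

/-- The curvature with the constant curvature part removed, `R_{abcd} - μ (g_{ac} g_{bd} -
g_{ad} g_{bc})`. -/
def weylArray (g : Mat ℂ) (R : Fin 4 → Fin 4 → Mat ℂ) (μ : ℂ) (a b x y : Fin 4) : ℂ :=
  (R a b * g) x y - μ * (g a x * g b y - g a y * g b x)

/-- The algebraic symmetries of the curvature of an Einstein metric. -/
structure IsEinsteinCurv (g h : Mat ℂ) (R : Fin 4 → Fin 4 → Mat ℂ) (μ : ℂ) : Prop where
  swap : ∀ a b, R b a = -R a b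
  skew : ∀ a b, (R a b)ᵀ * h = -(h * R a b)
  cyclic : ∀ a b c d, R a b c d + R b c a d + R c a b d = 0
  ricci : ∀ a b, ∑ c, R a c b c = 3 * μ * g a b

/-- The frame `E` is a principal null tetrad of the Weyl tensor `w`. -/
structure IsPrincipalFrame (E : Mat ℂ) (w : Fin 4 → Fin 4 → Fin 4 → Fin 4 → ℂ) (ψ ψ' : ℂ) :
    Prop where
  v0 : frame4 E w 0 2 0 2 = 0
  v1 : frame4 E w 0 2 0 1 = 0
  v1' : frame4 E w 0 3 0 1 = 0
  v2 : frame4 E w 0 2 3 1 = ψ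
  v2' : frame4 E w 0 3 2 1 = ψ'
  v3 : frame4 E w 0 1 3 1 = 0
  v3' : frame4 E w 0 1 2 1 = 0
  v4 : frame4 E w 3 1 3 1 = 0

/-- The classical argument: four cyclic identities, one for each choice of the fixed index, combined
with the two antisymmetries. -/
lemma pair_symm {w : Fin 4 → Fin 4 → Fin 4 → Fin 4 → ℂ}
    (h12 : ∀ a b x y, w a b x y = -w b a x y) (h34 : ∀ a b x y, w a b x y = -w a b y x)
    (hc : ∀ a b x y, w a b x y + w b x a y + w x a b y = 0) (a b x y : Fin 4) :
    w a b x y = w x y a b := by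
  have e1 := hc a b x y
  have e2 := hc b x y a
  have e3 := hc x y a b
  have e4 := hc y a b x
  have f1 := h34 b x y a
  have f2 := h34 x y b a
  have f3 := h12 x a b y
  have f4 := h34 a x b y
  have f5 := h34 y b x a
  have f6 := h12 y b a x
  have f7 := h34 y a x b
  have f8 := h34 a b y x
  grind

variable {g h E : Mat ℂ} {R : Fin 4 → Fin 4 → Mat ℂ} {μ ψ ψ' : ℂ}

namespace IsFrame

lemma h_mul_g (F : IsFrame g h E) : h * g = 1 := mul_eq_one_comm.mp F.g_mul_h

lemma g_comm (F : IsFrame g h E) (a b : Fin 4) : g a b = g b a := congrFun (congrFun F.g_symm b) a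

end IsFrame

namespace IsEinsteinCurv

lemma swap12 (H : IsEinsteinCurv g h R μ) (a b x y : Fin 4) :
    weylArray g R μ a b x y = -weylArray g R μ b a x y := by
  simp only [weylArray, H.swap a b, neg_mul, Matrix.neg_apply]; ring

lemma swap34 (F : IsFrame g h E) (H : IsEinsteinCurv g h R μ) (a b x y : Fin 4) :
    weylArray g R μ a b x y = -weylArray g R μ a b y x := by
  have h1 : (R a b * g)ᵀ = -(R a b * g) := by
    calc (R a b * g)ᵀ = g * ((R a b)ᵀ * h) * g := by
          rw [Matrix.transpose_mul, F.g_symm, mul_assoc, mul_assoc, F.h_mul_g, mul_one]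
      _ = -(g * h * R a b * g) := by rw [H.skew]; noncomm_ring
      _ = _ := by rw [F.g_mul_h, one_mul]
  have h2 := congrFun (congrFun h1 y) x
  rw [Matrix.transpose_apply, Matrix.neg_apply] at h2
  simp only [weylArray, h2]; ring

lemma cyclic_array (F : IsFrame g h E) (H : IsEinsteinCurv g h R μ) (a b x y : Fin 4) :
    weylArray g R μ a b x y + weylArray g R μ b x a y + weylArray g R μ x a b y = 0 := by
  have h1 : (R a b * g) x y + (R b x * g) a y + (R x a * g) b y = 0 := by
    simp only [Matrix.mul_apply, ← Finset.sum_add_distrib]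
    refine Finset.sum_eq_zero fun e _ => ?_
    linear_combination g e y * H.cyclic a b x e
  simp only [weylArray]
  rw [F.g_comm b a, F.g_comm x a, F.g_comm x b]
  linear_combination h1

/-- The contraction of the constant curvature part is `(4 - 1) μ g`, which is exactly the Ricci
tensor. -/
lemma trace_array (F : IsFrame g h E) (H : IsEinsteinCurv g h R μ) (a x : Fin 4) :
    ∑ b, ∑ y, h b y * weylArray g R μ a b x y = 0 := by
  have hs : ∀ b y, h b y = h y b := by
    intro b y
    rw [F.h_eq]
    have : (Eᵀ * nullMetric * E)ᵀ = Eᵀ * nullMetric * E := by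
      rw [Matrix.transpose_mul, Matrix.transpose_mul, nullMetric_transpose,
        Matrix.transpose_transpose, mul_assoc]
    exact congrFun (congrFun this y) b
  have h1 : ∀ b, ∑ y, h b y * (R a b * g) x y = R a b x b := by
    intro b
    have : (R a b * g * h) x b = R a b x b := by rw [mul_assoc, F.g_mul_h, mul_one]
    rw [← this, Matrix.mul_apply]
    exact Finset.sum_congr rfl fun y _ => by rw [hs]; ring
  have h2 : ∀ b c, ∑ y, h b y * g c y = (1 : Mat ℂ) b c := by
    intro b c
    rw [← F.h_mul_g, Matrix.mul_apply]
    exact Finset.sum_congr rfl fun y _ => by rw [F.g_comm]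
  calc ∑ b, ∑ y, h b y * weylArray g R μ a b x y
      = ∑ b, (∑ y, h b y * (R a b * g) x y - μ * (g a x * ∑ y, h b y * g b y
          - g b x * ∑ y, h b y * g a y)) := by
        refine Finset.sum_congr rfl fun b _ => ?_
        simp only [weylArray, Finset.mul_sum, ← Finset.sum_sub_distrib]
        exact Finset.sum_congr rfl fun y _ => by ring
    _ = 0 := by
        simp only [h1, h2, Finset.sum_sub_distrib, ← Finset.mul_sum, H.ricci, Matrix.one_apply,
          if_true, mul_ite, mul_one, mul_zero, Finset.sum_ite_eq', Finset.mem_univ,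
          Finset.sum_const,
          Finset.card_univ, Fintype.card_fin, nsmul_eq_mul]
        push_cast
        ring

/-- The consequences of `nullFrame_weyl` for the components of the Weyl tensor. -/
lemma principal (F : IsFrame g h E) (H : IsEinsteinCurv g h R μ)
    (P : IsPrincipalFrame E (weylArray g R μ) ψ ψ') :
    (∀ i k, frame4 E (weylArray g R μ) i k 0 2
      = ψ * (nullMetric i 0 * nullMetric k 2 - nullMetric i 2 * nullMetric k 0)) ∧
    (∀ i k, frame4 E (weylArray g R μ) i k 1 3
      = ψ * (nullMetric i 1 * nullMetric k 3 - nullMetric i 3 * nullMetric k 1)) ∧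
    (∀ i k, frame4 E (weylArray g R μ) i k 1 0 - frame4 E (weylArray g R μ) i k 0 1
        + (frame4 E (weylArray g R μ) i k 2 3 - frame4 E (weylArray g R μ) i k 3 2)
      = 4 * ψ * (nullMetric * nullForm * nullMetric) i k) :=
  nullFrame_weyl (frame4_neg_of_swap12 H.swap12) (frame4_neg_of_swap34 (H.swap34 F))
    (frame4_pair (pair_symm H.swap12 (H.swap34 F) (H.cyclic_array F)))
    (frame4_cyclic (H.cyclic_array F)) (frame4_contract F (H.trace_array F))
    P.v0 P.v1 P.v1' P.v2 P.v2' P.v3 P.v3' P.v4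

end IsEinsteinCurv

lemma nullForm_mul_nullMetric : nullForm * nullMetric = -nullDiag := by
  ext i k
  fin_cases i <;> fin_cases k <;>
    simp [nullMetric, nullForm, nullDiag, Matrix.mul_apply, Fin.sum_univ_four]

lemma nullForm_transpose : nullFormᵀ = -nullForm := by
  ext i k
  fin_cases i <;> fin_cases k <;> simp [nullForm]

/-- The components of a product of bilinear forms in the frame `E`. -/
lemma frame4_gram (F : IsFrame g h E) (i k m n : Fin 4) :
    frame4 E (fun a b x y => g a x * g b y - g a y * g b x) i k m n
      = nullMetric i m * nullMetric k n - nullMetric i n * nullMetric k m := by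
  have e : ∀ i m, nullMetric i m = ∑ a, ∑ x, g a x * E i a * E m x := by
    intro i m
    rw [← F.gram, mul_assoc, Matrix.mul_apply]
    refine Finset.sum_congr rfl fun a _ => ?_
    rw [Matrix.mul_apply, Finset.mul_sum]
    exact Finset.sum_congr rfl fun x _ => by rw [Matrix.transpose_apply]; ring
  simp only [e, Fin.sum_univ_four, frame4]
  ring

lemma frame4_sub (c d : Fin 4 → Fin 4 → Fin 4 → Fin 4 → ℂ) (s : ℂ) (i k m n : Fin 4) :
    frame4 E (fun a b x y => c a b x y - s * d a b x y) i k m n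
      = frame4 E c i k m n - s * frame4 E d i k m n := by
  simp only [frame4, Finset.mul_sum, ← Finset.sum_sub_distrib]
  refine Finset.sum_congr rfl fun a _ => Finset.sum_congr rfl fun b _ => Finset.sum_congr rfl
    fun x _ => Finset.sum_congr rfl fun y _ => ?_
  ring

/-- `θ_a ∧ θ_b` as an endomorphism. -/
def wedgeθ (g : Mat ℂ) (a b : Fin 4) : Mat ℂ :=
  Matrix.of fun c d => g c a * (1 : Mat ℂ) b d - g c b * (1 : Mat ℂ) a d

lemma wedgeθ_mul_g (F : IsFrame g h E) (a b x y : Fin 4) :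
    (wedgeθ g a b * g) x y = g a x * g b y - g a y * g b x := by
  simp [wedgeθ, Matrix.mul_apply, sub_mul, Matrix.one_apply, F.g_comm x a, F.g_comm x b]
  ring

/-- The trace-free curvature commutes with the dyad two-form. -/
theorem curv_commute (F : IsFrame g h E) (H : IsEinsteinCurv g h R μ)
    (P : IsPrincipalFrame E (weylArray g R μ) ψ ψ') (a b : Fin 4) :
    (R a b - (ψ + μ) • wedgeθ g a b) * (g * Eᵀ * nullForm * E)
      = g * Eᵀ * nullForm * E * (R a b - (ψ + μ) • wedgeθ g a b) := by
  set S : Fin 4 → Fin 4 → Mat ℂ := fun a b => R a b - (ψ + μ) • wedgeθ g a b with hS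
  set s : Fin 4 → Fin 4 → Fin 4 → Fin 4 → ℂ := fun a b x y =>
    weylArray g R μ a b x y - ψ * (g a x * g b y - g a y * g b x) with hs
  have hSs : ∀ a b, S a b * g = Matrix.of fun x y => s a b x y := by
    intro a b
    ext x y
    simp only [hS, hs, sub_mul, Matrix.smul_mul, Matrix.sub_apply, Matrix.smul_apply,
      wedgeθ_mul_g F, smul_eq_mul, weylArray, Matrix.of_apply]
    ring
  obtain ⟨p1, p2, -⟩ := H.principal F P
  -- In the frame, the commutator with the dyad form multiplies the component `m n` by the sum of
  -- the eigenvalues of `m` and `n`. It is therefore zero as soon as the components `02` and `13`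
  -- vanish, and subtracting the multiple `ψ` of the constant curvature tensor achieves this.
  have q1 : ∀ i k, frame4 E s i k 0 2 = 0 := fun i k => by
    rw [hs, frame4_sub, frame4_gram F, p1, sub_self]
  have q2 : ∀ i k, frame4 E s i k 1 3 = 0 := fun i k => by
    rw [hs, frame4_sub, frame4_gram F, p2, sub_self]
  have hs34 : ∀ i k m n, frame4 E s i k m n = -frame4 E s i k n m := by
    refine frame4_neg_of_swap34 fun a b x y => ?_
    simp only [hs, H.swap34 F a b x y]; ring
  have hd : ∀ i k m, frame4 E s i k m m = 0 := fun i k m => by have := hs34 i k m m; grind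
  have h1 : S a b * g * (Eᵀ * nullForm * E) * g - g * (Eᵀ * nullForm * E) * (S a b * g) = 0 := by
    refine F.family_eq_zero (f := fun a b => S a b * g * (Eᵀ * nullForm * E) * g
      - g * (Eᵀ * nullForm * E) * (S a b * g)) (fun i k => ?_) a b
    have h2 : ∀ a b, E * (S a b * g * (Eᵀ * nullForm * E) * g
        - g * (Eᵀ * nullForm * E) * (S a b * g)) * Eᵀ
        = -(E * (S a b * g) * Eᵀ * nullDiag + nullDiag * (E * (S a b * g) * Eᵀ)) := by
      intro a b
      calc _ = E * (S a b * g) * Eᵀ * nullForm * (E * g * Eᵀ)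
            - (E * g * Eᵀ) * nullForm * (E * (S a b * g) * Eᵀ) := by noncomm_ring
        _ = E * (S a b * g) * Eᵀ * (nullForm * nullMetric)
            - (nullMetric * nullForm) * (E * (S a b * g) * Eᵀ) := by
            rw [F.gram, mul_assoc _ nullForm]
        _ = _ := by rw [nullForm_mul_nullMetric, nullMetric_mul_nullForm]; noncomm_ring
    simp only [h2]
    simp only [hSs]
    have h3 : ∀ m n, (∑ a, ∑ b, (E i a * E k b) • -(E * (Matrix.of fun x y => s a b x y) * Eᵀ
        * nullDiag + nullDiag * (E * (Matrix.of fun x y => s a b x y) * Eᵀ))) m n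
        = -(frame4 E s i k m n * ![(-1 : ℂ), 1, -1, 1] n
          + ![(-1 : ℂ), 1, -1, 1] m * frame4 E s i k m n) := by
      intro m n
      rw [frame4_eq]
      simp only [Matrix.sum_apply, Matrix.smul_apply, Matrix.neg_apply, Matrix.add_apply, nullDiag,
        Matrix.mul_diagonal, Matrix.diagonal_mul, smul_eq_mul, Finset.sum_mul, Finset.mul_sum,
        ← Finset.sum_add_distrib, ← Finset.sum_neg_distrib]
      exact Finset.sum_congr rfl fun a _ => Finset.sum_congr rfl fun b _ => by ring
    ext m n
    rw [h3]
    fin_cases m <;> fin_cases n <;>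
      simp [hd, q1, q2, hs34 i k 2 0, hs34 i k 3 1]
  have h2 := congrArg (· * h) (sub_eq_zero.mp h1)
  simp only [mul_assoc, F.g_mul_h, mul_one] at h2
  simp only [mul_assoc]
  exact h2

/-- The component of the curvature along the dyad two-form. -/
theorem curv_trace (F : IsFrame g h E) (H : IsEinsteinCurv g h R μ)
    (P : IsPrincipalFrame E (weylArray g R μ) ψ ψ') (a b : Fin 4) :
    (R a b * (g * Eᵀ * nullForm * E)).trace
      = (4 * ψ - 2 * μ) * (g * Eᵀ * nullForm * E * g) a b := by
  obtain ⟨-, -, p⟩ := H.principal F P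
  set w := weylArray g R μ with hw
  set U := Eᵀ * nullForm * E with hU
  have hUt : Uᵀ = -U := by
    rw [hU, Matrix.transpose_mul, Matrix.transpose_mul, nullForm_transpose,
      Matrix.transpose_transpose]
    noncomm_ring
  -- Contraction of the last pair with the dyad form is the combination of components in the third
  -- part of `IsEinsteinCurv.principal`.
  have h1 : (Matrix.of fun a b => ((Matrix.of fun x y => w a b x y) * U).trace)
      - (4 * ψ) • (g * U * g) = 0 := by
    refine F.eq_zero_of_frame ?_
    have e1 : E * (g * U * g) * Eᵀ = nullMetric * nullForm * nullMetric := by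
      calc _ = (E * g * Eᵀ) * nullForm * (E * g * Eᵀ) := by rw [hU]; noncomm_ring
        _ = _ := by rw [F.gram]
    have e2 : ∀ a b, ((Matrix.of fun x y => w a b x y) * U).trace
        = (E * (Matrix.of fun x y => w a b x y) * Eᵀ * nullForm).trace := by
      intro a b
      rw [hU, ← mul_assoc, Matrix.trace_mul_comm]
      simp only [mul_assoc]
    ext i k
    rw [mul_sub, sub_mul, Matrix.mul_smul, Matrix.smul_mul, e1, Matrix.sub_apply, Matrix.smul_apply,
      smul_eq_mul, ← p, Matrix.zero_apply, sub_eq_zero]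
    have e3 : (E * (Matrix.of fun a b => ((Matrix.of fun x y => w a b x y) * U).trace) * Eᵀ) i k
        = ((∑ a, ∑ b, (E i a * E k b) • (E * (Matrix.of fun x y => w a b x y) * Eᵀ))
          * nullForm).trace := by
      simp only [Finset.sum_mul, Matrix.trace_sum, Matrix.smul_mul, Matrix.trace_smul, ← e2,
        Matrix.mul_apply (M := E * _), Matrix.mul_apply (M := E), Matrix.transpose_apply,
        Matrix.of_apply, smul_eq_mul]
      rw [Finset.sum_comm]
      exact Finset.sum_congr rfl fun a _ => Finset.sum_congr rfl fun b _ => by ring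
    rw [e3]
    simp only [Matrix.trace, Matrix.diag, Matrix.mul_apply (N := nullForm), ← frame4_eq]
    simp [Fin.sum_univ_four, nullForm]
    ring
  have h2 : ((Matrix.of fun x y => w a b x y) * U).trace = 4 * ψ * (g * U * g) a b := by
    have := congrFun (congrFun h1 a) b
    simpa [sub_eq_zero] using this
  have h3 : (Matrix.of fun x y => w a b x y) = (R a b - μ • wedgeθ g a b) * g := by
    ext x y
    simp only [sub_mul, Matrix.smul_mul, Matrix.sub_apply, Matrix.smul_apply, wedgeθ_mul_g F,
      smul_eq_mul, hw, weylArray, Matrix.of_apply]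
  have h4 : (wedgeθ g a b * (g * U)).trace = -2 * (g * U * g) a b := by
    have e1 : (g * U * g) b a = -(g * U * g) a b := by
      have : (g * U * g)ᵀ = -(g * U * g) := by
        rw [Matrix.transpose_mul, Matrix.transpose_mul, hUt, F.g_symm]; noncomm_ring
      exact congrFun (congrFun this a) b
    have e2 : ∀ a b, ∑ x, ∑ d, g x a * (1 : Mat ℂ) b d * (g * U) d x = (g * U * g) b a := by
      intro a b
      rw [Matrix.mul_apply]
      refine Finset.sum_congr rfl fun x _ => ?_
      simp [Matrix.one_apply]; ring
    simp only [Matrix.trace, Matrix.diag, Matrix.mul_apply (M := wedgeθ g a b)]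
    simp only [wedgeθ, Matrix.of_apply, sub_mul, Finset.sum_sub_distrib, e2, e1]
    ring
  rw [h3, mul_assoc, sub_mul, Matrix.trace_sub, Matrix.smul_mul, Matrix.trace_smul, smul_eq_mul,
    h4] at h2
  have h5 : g * Eᵀ * nullForm * E = g * U := by rw [hU]; noncomm_ring
  rw [h5]
  linear_combination h2

/-! ### Complex conjugation of a tetrad -/

variable {g h E : Mat ℂ}

/-- The frame `E` has the form `(l, n, m, m̄)` with real `l` and `n`. -/
def IsConjFrame (E : Mat ℂ) : Prop :=
  ∀ a, conj (E 0 a) = E 0 a ∧ conj (E 1 a) = E 1 a ∧ conj (E 2 a) = E 3 a ∧ conj (E 3 a) = E 2 a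

/-- The entrywise complex conjugate. -/
def conjMat : Mat ℂ →+* Mat ℂ := (starRingEnd ℂ).mapMatrix

lemma conjMat_apply (X : Mat ℂ) (a b : Fin 4) : conjMat X a b = conj (X a b) := rfl

lemma conjMat_transpose (X : Mat ℂ) : conjMat Xᵀ = (conjMat X)ᵀ := rfl

lemma conjMat_nullMetric : conjMat nullMetric = nullMetric := by
  ext i k
  fin_cases i <;> fin_cases k <;> simp [conjMat_apply, nullMetric]

lemma conjMat_nullForm : conjMat nullForm = nullForm := by
  ext i k
  fin_cases i <;> fin_cases k <;> simp [conjMat_apply, nullForm]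

lemma IsFrame.conjFrame (F : IsFrame g h E) (hg : conjMat g = g) : IsFrame g h (conjMat E) where
  gram := by
    have := congrArg conjMat F.gram
    rwa [map_mul, map_mul, hg, conjMat_transpose, conjMat_nullMetric] at this
  g_mul_h := F.g_mul_h
  g_symm := F.g_symm

lemma conjMat_dyad (hg : conjMat g = g) :
    conjMat (g * Eᵀ * nullForm * E) = g * (conjMat E)ᵀ * nullForm * conjMat E := by
  simp only [map_mul, hg, conjMat_transpose, conjMat_nullForm]

/-- The conjugate dyad form in the original frame. -/
lemma IsConjFrame.nullForm_eq (hE : IsConjFrame E) :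
    (conjMat E)ᵀ * nullForm * conjMat E
      = Eᵀ * !![0, 1, 0, 0; -1, 0, 0, 0; 0, 0, 0, 1; 0, 0, -1, 0] * E := by
  ext a b
  simp [Matrix.mul_apply, Fin.sum_univ_four, nullForm, conjMat_apply, (hE a).1, (hE a).2.1,
    (hE a).2.2.1, (hE a).2.2.2, (hE b).1, (hE b).2.1, (hE b).2.2.1, (hE b).2.2.2]
  ring

lemma IsFrame.conj_nullFormConj (F : IsFrame g h E) (hE : IsConjFrame E) :
    E * (g * (conjMat E)ᵀ * nullForm * conjMat E) * (g * Eᵀ * nullMetric) = nullDiagConj := by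
  have h1 : g * (conjMat E)ᵀ * nullForm * conjMat E
      = g * Eᵀ * !![0, 1, 0, 0; -1, 0, 0, 0; 0, 0, 0, 1; 0, 0, -1, 0] * E := by
    rw [mul_assoc, mul_assoc, ← mul_assoc (conjMat E)ᵀ, hE.nullForm_eq]
    simp only [mul_assoc]
  rw [h1]
  calc _ = (E * g * Eᵀ) * !![0, 1, 0, 0; -1, 0, 0, 0; 0, 0, 0, 1; 0, 0, -1, 0]
        * (E * (g * Eᵀ * nullMetric)) := by noncomm_ring
    _ = nullDiagConj := by
      rw [F.gram, F.mul_inv, mul_one]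
      ext i k
      fin_cases i <;> fin_cases k <;>
        simp [nullMetric, nullDiagConj, Matrix.mul_apply, Fin.sum_univ_four]

/-- Both forms are diagonal in the same tetrad. -/
lemma IsFrame.commute_conj (F : IsFrame g h E) (hE : IsConjFrame E) :
    (g * Eᵀ * nullForm * E) * (g * (conjMat E)ᵀ * nullForm * conjMat E)
      = (g * (conjMat E)ᵀ * nullForm * conjMat E) * (g * Eᵀ * nullForm * E) := by
  refine F.conj_injective ?_
  rw [F.conj_mul (g * Eᵀ * nullForm * E), F.conj_mul (g * (conjMat E)ᵀ * nullForm * conjMat E),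
    F.conj_nullForm, F.conj_nullFormConj hE, nullDiag, nullDiagConj,
    Matrix.diagonal_mul_diagonal, Matrix.diagonal_mul_diagonal]
  congr 1
  ext i
  exact mul_comm _ _

lemma IsFrame.trace_mul_conj (F : IsFrame g h E) (hE : IsConjFrame E) :
    ((g * Eᵀ * nullForm * E) * (g * (conjMat E)ᵀ * nullForm * conjMat E)).trace = 0 := by
  rw [← F.conj_trace, F.conj_mul (g * Eᵀ * nullForm * E), F.conj_nullForm, F.conj_nullFormConj hE,
    nullDiag, nullDiagConj,
    Matrix.diagonal_mul_diagonal, Matrix.trace_diagonal]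
  simp [Fin.sum_univ_four]

lemma conj_frame4 {w : Fin 4 → Fin 4 → Fin 4 → Fin 4 → ℂ}
    (hw : ∀ a b x y, conj (w a b x y) = w a b x y) (i k m n : Fin 4) :
    conj (frame4 E w i k m n) = frame4 (conjMat E) w i k m n := by
  simp only [frame4, map_sum, map_mul, hw, conjMat_apply]

/-- A real tensor has conjugate components in the conjugate frame, and conjugation of the frame only
exchanges the legs `2` and `3`. -/
lemma isPrincipalFrame_of_real {w : Fin 4 → Fin 4 → Fin 4 → Fin 4 → ℂ} (hE : IsConjFrame E)
    (hw : ∀ a b x y, conj (w a b x y) = w a b x y) {ψ : ℂ}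
    (v0 : frame4 E w 0 2 0 2 = 0) (v1 : frame4 E w 0 2 0 1 = 0) (v2 : frame4 E w 0 2 3 1 = ψ)
    (v3 : frame4 E w 0 1 3 1 = 0) (v4 : frame4 E w 3 1 3 1 = 0) :
    IsPrincipalFrame E w ψ (conj ψ) where
  v0 := v0
  v1 := v1
  v2 := v2
  v3 := v3
  v4 := v4
  v1' := by
    have := conj_frame4 (E := E) hw 0 2 0 1
    rw [v1, map_zero] at this
    rw [this]
    simp [frame4, conjMat_apply, hE _]
  v2' := by
    have := conj_frame4 (E := E) hw 0 2 3 1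
    rw [v2] at this
    rw [this]
    simp [frame4, conjMat_apply, hE _]
  v3' := by
    have := conj_frame4 (E := E) hw 0 1 3 1
    rw [v3, map_zero] at this
    rw [this]
    simp [frame4, conjMat_apply, hE _]

lemma IsPrincipalFrame.conjFrame {w : Fin 4 → Fin 4 → Fin 4 → Fin 4 → ℂ}
    (hw : ∀ a b x y, conj (w a b x y) = w a b x y) {ψ ψ' : ℂ} (P : IsPrincipalFrame E w ψ ψ') :
    IsPrincipalFrame (conjMat E) w (conj ψ) (conj ψ') where
  v0 := by rw [← conj_frame4 hw, P.v0, map_zero]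
  v1 := by rw [← conj_frame4 hw, P.v1, map_zero]
  v1' := by rw [← conj_frame4 hw, P.v1', map_zero]
  v2 := by rw [← conj_frame4 hw, P.v2]
  v2' := by rw [← conj_frame4 hw, P.v2']
  v3 := by rw [← conj_frame4 hw, P.v3, map_zero]
  v3' := by rw [← conj_frame4 hw, P.v3', map_zero]
  v4 := by rw [← conj_frame4 hw, P.v4, map_zero]

/-! ### The Hodge dual -/

/-- An alternating array is determined by one component. -/
lemma alternating_eq_zero {f : Fin 4 → Fin 4 → Fin 4 → Fin 4 → ℂ}
    (h12 : ∀ a b x y, f a b x y = -f b a x y) (h23 : ∀ a b x y, f a b x y = -f a x b y)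
    (h34 : ∀ a b x y, f a b x y = -f a b y x) (h0 : f 0 1 2 3 = 0) (a b x y : Fin 4) :
    f a b x y = 0 := by
  have d12 : ∀ a x y, f a a x y = 0 := fun a x y => by have := h12 a a x y; grind
  have d23 : ∀ a b y, f a b b y = 0 := fun a b y => by have := h23 a b b y; grind
  have d34 : ∀ a b x, f a b x x = 0 := fun a b x => by have := h34 a b x x; grind
  have d13 : ∀ a b y, f a b a y = 0 := fun a b y => by rw [h23, d12, neg_zero]
  have d24 : ∀ a b x, f a b x b = 0 := fun a b x => by rw [h34, d23, neg_zero]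
  have d14 : ∀ a b x, f a b x a = 0 := fun a b x => by rw [h34, d13, neg_zero]
  have s12 : ∀ a b x y, f b a x y = 0 → f a b x y = 0 := fun a b x y h => by rw [h12, h, neg_zero]
  have s23 : ∀ a b x y, f a x b y = 0 → f a b x y = 0 := fun a b x y h => by rw [h23, h, neg_zero]
  have s34 : ∀ a b x y, f a b y x = 0 → f a b x y = 0 := fun a b x y h => by rw [h34, h, neg_zero]
  by_cases e12 : a = b
  · rw [e12, d12]
  by_cases e13 : a = x
  · rw [e13, d13]
  by_cases e14 : a = y
  · rw [e14, d14]
  by_cases e23 : b = x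
  · rw [e23, d23]
  by_cases e24 : b = y
  · rw [e24, d24]
  by_cases e34 : x = y
  · rw [e34, d34]
  fin_cases a <;> fin_cases b <;> simp at e12 <;> fin_cases x <;> simp at e13 e23 <;>
    fin_cases y <;> simp at e14 e24 e34 <;>
      simp only [Fin.zero_eta, Fin.mk_one, Fin.reduceFinMk] <;>
    grind

lemma dyad_transpose (hg : gᵀ = g) :
    (g * Eᵀ * nullForm * E * g)ᵀ = -(g * Eᵀ * nullForm * E * g) := by
  simp only [Matrix.transpose_mul, nullForm_transpose, Matrix.transpose_transpose, hg]
  noncomm_ring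

/-- The volume form in terms of the dyad form. -/
lemma vol_eq (F : IsFrame g h E) {v : Fin 4 → Fin 4 → Fin 4 → Fin 4 → ℂ}
    (h12 : ∀ a b x y, v a b x y = -v b a x y) (h23 : ∀ a b x y, v a b x y = -v a x b y)
    (h34 : ∀ a b x y, v a b x y = -v a b y x) (h0 : frame4 E v 0 1 2 3 = -Complex.I)
    {z : Mat ℂ} (hz : z = g * Eᵀ * nullForm * E * g) (a b x y : Fin 4) :
    v a b x y = Complex.I * (z a b * z x y - z a x * z b y + z a y * z b x) := by
  have zt : ∀ a b, z a b = -z b a := fun a b => by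
    have := congrFun (congrFun (dyad_transpose (E := E) F.g_symm) b) a
    rw [hz]; exact this
  have zf : ∀ i k, ∑ a, ∑ b, z a b * E i a * E k b = (nullMetric * nullForm * nullMetric) i k := by
    intro i k
    have e1 : E * z * Eᵀ = nullMetric * nullForm * nullMetric := by
      calc E * z * Eᵀ = (E * g * Eᵀ) * nullForm * (E * g * Eᵀ) := by rw [hz]; noncomm_ring
        _ = _ := by rw [F.gram]
    rw [← e1, mul_assoc, Matrix.mul_apply]
    refine Finset.sum_congr rfl fun a _ => ?_
    rw [Matrix.mul_apply, Finset.mul_sum]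
    exact Finset.sum_congr rfl fun x _ => by rw [Matrix.transpose_apply]; ring
  set q : Fin 4 → Fin 4 → Fin 4 → Fin 4 → ℂ := fun a b x y =>
    z a b * z x y - z a x * z b y + z a y * z b x with hq
  -- Only the product of the `ln` and `m m̄` components contributes, so `i q` has the same value
  -- `-i` as the volume form on the tetrad.
  have qf : frame4 E q 0 1 2 3 = -1 := by
    have e1 : frame4 E q 0 1 2 3
        = (∑ a, ∑ b, z a b * E 0 a * E 1 b) * (∑ a, ∑ b, z a b * E 2 a * E 3 b)
        - (∑ a, ∑ b, z a b * E 0 a * E 2 b) * (∑ a, ∑ b, z a b * E 1 a * E 3 b)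
        + (∑ a, ∑ b, z a b * E 0 a * E 3 b) * (∑ a, ∑ b, z a b * E 1 a * E 2 b) := by
      simp only [frame4, hq, Fin.sum_univ_four]
      ring
    rw [e1]
    simp only [zf]
    simp [nullMetric, nullForm, Matrix.mul_apply, Fin.sum_univ_four]
  -- The difference is alternating, so in dimension four its single independent component decides.
  set D : Fin 4 → Fin 4 → Fin 4 → Fin 4 → ℂ := fun a b x y =>
    v a b x y - Complex.I * q a b x y with hD
  have d12 : ∀ a b x y, D a b x y = -D b a x y := fun a b x y => by
    simp only [hD, hq]; rw [h12, zt a b]; ring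
  have d23 : ∀ a b x y, D a b x y = -D a x b y := fun a b x y => by
    simp only [hD, hq]; rw [h23, zt x b]; ring
  have d34 : ∀ a b x y, D a b x y = -D a b y x := fun a b x y => by
    simp only [hD, hq]; rw [h34, zt x y]; ring
  have Df : ∀ i k m n, frame4 E D i k m n = 0 := by
    refine alternating_eq_zero (frame4_neg_of_swap12 d12) (frame4_neg_of_swap23 d23)
      (frame4_neg_of_swap34 d34) ?_
    rw [hD, frame4_sub, h0, qf]; ring
  have h1 := F.family_eq_zero (f := fun a b => Matrix.of fun x y => D a b x y) (fun i k => by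
    ext m n
    rw [← frame4_eq, Df]; rfl) a b
  have h2 := congrFun (congrFun h1 x) y
  simp only [Matrix.of_apply, Matrix.zero_apply, hD, sub_eq_zero] at h2
  exact h2

/-- The Hodge dual of a two-form in terms of the dyad form. -/
lemma hodge_mul_h (F : IsFrame g h E) {v : Fin 4 → Fin 4 → Fin 4 → Fin 4 → ℂ}
    (h12 : ∀ a b x y, v a b x y = -v b a x y) (h23 : ∀ a b x y, v a b x y = -v a x b y)
    (h34 : ∀ a b x y, v a b x y = -v a b y x) (h0 : frame4 E v 0 1 2 3 = -Complex.I)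
    {T : Mat ℂ} (hT : Tᵀ = -T) {j : Mat ℂ} (hj : j = g * Eᵀ * nullForm * E) :
    (Matrix.of fun a b => (1 / 2) * ∑ c, ∑ d, v a b c d * ∑ e, ∑ f, h c e * h d f * T e f) * h
      = (-(Complex.I / 2)) • Calc.dual j (T * h) := by
  have hh : hᵀ = h := by
    rw [F.h_eq, Matrix.transpose_mul, Matrix.transpose_mul, nullMetric_transpose,
      Matrix.transpose_transpose, mul_assoc]
  set z := j * g with hz
  have hzt : zᵀ = -z := by rw [hz, hj]; exact dyad_transpose F.g_symm
  have hjz : j = z * h := by rw [hz, mul_assoc, F.g_mul_h, mul_one]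
  set Tu := h * T * h with hTu
  have hTut : ∀ a b, Tu a b = -Tu b a := fun a b => by
    have : Tuᵀ = -Tu := by
      simp only [hTu, Matrix.transpose_mul, hh, hT]; noncomm_ring
    exact congrFun (congrFun this b) a
  have hTu' : ∀ c d, ∑ e, ∑ f, h c e * h d f * T e f = Tu c d := by
    intro c d
    rw [hTu, mul_assoc, Matrix.mul_apply]
    refine Finset.sum_congr rfl fun e _ => ?_
    rw [Matrix.mul_apply, Finset.mul_sum]
    refine Finset.sum_congr rfl fun f _ => ?_
    have : h f d = h d f := congrFun (congrFun hh d) f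
    rw [this]; ring
  have h1 : (Matrix.of fun a b => (1 / 2) * ∑ c, ∑ d, v a b c d * ∑ e, ∑ f, h c e * h d f * T e f)
      = (Complex.I / 2) • ((zᵀ * Tu).trace • z + (2 : ℂ) • (z * Tu * z)) := by
    ext a b
    have e1 : (zᵀ * Tu).trace = ∑ c, ∑ d, z c d * Tu c d := by
      simp only [Matrix.trace, Matrix.diag, Matrix.mul_apply, Matrix.transpose_apply]
      exact Finset.sum_comm
    have e2 : (z * Tu * z) a b = ∑ c, ∑ d, z a c * Tu c d * z d b := by
      simp only [Matrix.mul_apply, Finset.sum_mul]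
      exact Finset.sum_comm
    have e3 : (z * Tu * z) a b = -∑ c, ∑ d, z a d * Tu c d * z c b := by
      rw [e2, Finset.sum_comm, ← Finset.sum_neg_distrib]
      refine Finset.sum_congr rfl fun c _ => ?_
      rw [← Finset.sum_neg_distrib]
      exact Finset.sum_congr rfl fun d _ => by rw [hTut d c]; ring
    have zt : ∀ a b, z a b = -z b a := fun a b => congrFun (congrFun hzt b) a
    simp only [Matrix.of_apply, hTu', Matrix.smul_apply, Matrix.add_apply, smul_eq_mul,
      vol_eq F h12 h23 h34 h0 (z := z) (by rw [hz, hj])]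
    rw [two_mul ((z * Tu * z) a b)]
    conv_rhs => rw [e1]; enter [2, 2, 1]; rw [e2]
    rw [e3, Finset.sum_mul, ← Finset.sum_neg_distrib]
    simp only [Finset.sum_mul, ← Finset.sum_neg_distrib, ← Finset.sum_add_distrib, Finset.mul_sum]
    refine Finset.sum_congr rfl fun c _ => Finset.sum_congr rfl fun d _ => ?_
    rw [zt b d, zt b c]; ring
  have h2 : (zᵀ * Tu).trace = -(j * (T * h)).trace := by
    rw [hzt, neg_mul, Matrix.trace_neg, hTu, hjz]
    simp only [mul_assoc]
  have h3 : z * Tu * z * h = j * (T * h) * j := by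
    rw [hTu, hjz]; simp only [mul_assoc]
  rw [h1, Matrix.smul_mul, add_mul, Matrix.smul_mul, Matrix.smul_mul, h3, ← hjz, h2, Calc.dual]
  module

/-- As the Hodge dual is `-i/2` times `dual j`, this says `*j = -i j`, that is, `j` is
anti-self-dual. In the same way `dual_conj` says `*j' = i j'`. -/
lemma dual_self {j : Mat ℂ} (hj : j * j = 1) : Calc.dual j j = (2 : ℂ) • j := by
  rw [Calc.dual, hj, one_mul, Matrix.trace_one, Fintype.card_fin]
  push_cast
  module

lemma dual_conj {j j' : Mat ℂ} (hj : j * j = 1) (hc : j * j' = j' * j) (ht : (j * j').trace = 0) :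
    Calc.dual j j' = -((2 : ℂ) • j') := by
  rw [Calc.dual, ht, hc, mul_assoc, hj, mul_one, zero_smul, zero_sub]

/-! ### Smooth functions on an open set -/

variable (U : TopologicalSpace.Opens E4)

/-- Extension by zero. -/
def extendZero (f : U → ℂ) : E4 → ℂ :=
  open scoped Classical in fun x => if h : x ∈ U then f ⟨x, h⟩ else 0

variable {U}

lemma extendZero_apply (f : U → ℂ) (x : U) : extendZero U f x = f x := by
  simp [extendZero]

lemma contDiffOn_congr {F G : E4 → ℂ} (hF : ContDiffOn ℝ ∞ F U) (h : ∀ x : U, G x = F x) :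
    ContDiffOn ℝ ∞ G U := hF.congr fun x hx => h ⟨x, hx⟩

lemma pd_congr {F G : E4 → ℂ} (h : ∀ x : U, F x = G x) (a : Fin 4) (x : U) :
    pd a F x = pd a G x := by
  have h1 : F =ᶠ[nhds (x : E4)] G := by
    filter_upwards [U.isOpen.mem_nhds x.2] with y hy using h ⟨y, hy⟩
  rw [pd, pd, h1.fderiv_eq]

lemma contDiffOn_pd {F : E4 → ℂ} (hF : ContDiffOn ℝ ∞ F U) (a : Fin 4) :
    ContDiffOn ℝ ∞ (pd a F) U :=
  (hF.fderiv_of_isOpen U.isOpen (m := ∞) (by simp)).clm_apply contDiffOn_const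

lemma differentiableAt_of_contDiffOn {F : E4 → ℂ} (hF : ContDiffOn ℝ ∞ F U) (x : U) :
    DifferentiableAt ℝ F x :=
  (hF.differentiableOn (by simp)).differentiableAt (U.isOpen.mem_nhds x.2)

variable (U) in
/-- The algebra of smooth complex functions on an open set. -/
def Smooth : Subalgebra ℂ (U → ℂ) where
  carrier := {f | ContDiffOn ℝ ∞ (extendZero U f) U}
  mul_mem' {f k} hf hk := contDiffOn_congr (ContDiffOn.mul hf hk) fun x => by
    simp [extendZero_apply]
  add_mem' {f k} hf hk := contDiffOn_congr (ContDiffOn.add hf hk) fun x => by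
    simp [extendZero_apply]
  algebraMap_mem' c := contDiffOn_congr (contDiffOn_const (c := c)) fun x => by
    rw [extendZero_apply]; rfl

namespace Smooth

/-- The function `F` represents `f` on the open set. -/
def Represents (f : Smooth U) (F : E4 → ℂ) : Prop := ∀ x : U, f.1 x = F x

/-- The element of the algebra given by a smooth function. -/
def mk (F : E4 → ℂ) (hF : ContDiffOn ℝ ∞ F U) : Smooth U :=
  ⟨fun x => F x, contDiffOn_congr hF fun x => extendZero_apply _ x⟩

lemma rep_mk (F : E4 → ℂ) (hF : ContDiffOn ℝ ∞ F U) : Represents (mk F hF) F := fun _ => rfl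

lemma rep_extendZero (f : Smooth U) : Represents f (extendZero U f.1) := fun x =>
  (extendZero_apply _ x).symm

/-- Evaluation at a point. -/
def ev (x : U) : Smooth U →+* ℂ :=
  (Pi.evalRingHom (fun _ : U => ℂ) x).comp (Smooth U).toSubring.subtype

lemma ev_apply (x : U) (f : Smooth U) : ev x f = f.1 x := rfl

lemma ext_ev {f k : Smooth U} (h : ∀ x, ev x f = ev x k) : f = k :=
  Subtype.ext (funext h)

lemma ev_algebraMap (x : U) (c : ℂ) : ev x (algebraMap ℂ (Smooth U) c) = c := rfl

lemma Represents.contDiffOn {f : Smooth U} {F : E4 → ℂ} (h : Represents f F) : ContDiffOn ℝ ∞ F U :=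
  contDiffOn_congr f.2 fun x => by rw [← h x, extendZero_apply]

/-- The partial derivative on the algebra. -/
def pderiv (a : Fin 4) (f : Smooth U) : Smooth U :=
  mk (pd a (extendZero U f.1)) (contDiffOn_pd f.2 a)

lemma Represents.pderiv {f : Smooth U} {F : E4 → ℂ} (h : Represents f F) (a : Fin 4) :
    Represents (Smooth.pderiv a f) (pd a F) := fun x =>
  pd_congr (fun y => by rw [extendZero_apply, h]) a x

lemma pderiv_apply {f : Smooth U} {F : E4 → ℂ} (h : Represents f F) (a : Fin 4) (x : U) :
    ev x (pderiv a f) = pd a F x := h.pderiv a x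

/-- The partial derivative as a derivation. -/
def pa (a : Fin 4) : Derivation ℂ (Smooth U) (Smooth U) :=
  Derivation.mk'
    { toFun := pderiv a
      map_add' := fun f k => ext_ev fun x => by
        have h1 : Represents (f + k) (fun y => extendZero U f.1 y + extendZero U k.1 y) :=
            fun y => by
          simp [extendZero_apply]
        rw [pderiv_apply h1, map_add, pderiv_apply (rep_extendZero f),
          pderiv_apply (rep_extendZero k),
          pd, fderiv_fun_add (differentiableAt_of_contDiffOn f.2 x)
            (differentiableAt_of_contDiffOn k.2 x)]
        rfl
      map_smul' := fun c f => ext_ev fun x => by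
        have h1 : Represents (c • f) (fun y => c • extendZero U f.1 y) := fun y => by
          simp [extendZero_apply]
        rw [pderiv_apply h1, pd, fderiv_fun_const_smul (differentiableAt_of_contDiffOn f.2 x)]
        rw [RingHom.id_apply, Algebra.smul_def, map_mul, ev_algebraMap,
          pderiv_apply (rep_extendZero f)]
        rfl }
    fun f k => ext_ev fun x => by
      have h1 : Represents (f * k) (fun y => extendZero U f.1 y * extendZero U k.1 y) := fun y => by
        simp [extendZero_apply]
      change ev x (pderiv a (f * k)) = ev x (f • pderiv a k + k • pderiv a f)
      rw [pderiv_apply h1, smul_eq_mul, smul_eq_mul, map_add, map_mul, map_mul,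
        pderiv_apply (rep_extendZero f), pderiv_apply (rep_extendZero k), pd,
        fderiv_fun_mul (differentiableAt_of_contDiffOn f.2 x)
            (differentiableAt_of_contDiffOn k.2 x)]
      simp [pd, ev_apply, extendZero_apply]

lemma Represents.pa {f : Smooth U} {F : E4 → ℂ} (h : Represents f F) (a : Fin 4) :
    Represents (Smooth.pa a f) (pd a F) := h.pderiv a

lemma Represents.add {f k : Smooth U} {F K : E4 → ℂ} (hf : Represents f F) (hk : Represents k K) :
    Represents (f + k) (fun x => F x + K x) := fun x => by simp [hf x, hk x]

lemma Represents.sub {f k : Smooth U} {F K : E4 → ℂ} (hf : Represents f F) (hk : Represents k K) :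
    Represents (f - k) (fun x => F x - K x) := fun x => by simp [hf x, hk x]

lemma Represents.mul {f k : Smooth U} {F K : E4 → ℂ} (hf : Represents f F) (hk : Represents k K) :
    Represents (f * k) (fun x => F x * K x) := fun x => by simp [hf x, hk x]

lemma Represents.sum {ι : Type*} [Fintype ι] {f : ι → Smooth U} {F : ι → E4 → ℂ}
    (h : ∀ i, Represents (f i) (F i)) : Represents (∑ i, f i) (fun x => ∑ i, F i x) := fun x => by
  have := map_sum (ev x) f Finset.univ
  rw [ev_apply] at this
  rw [this]
  exact Finset.sum_congr rfl fun i _ => h i x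

lemma rep_const (c : ℂ) : Represents (algebraMap ℂ (Smooth U) c) (fun _ => c) := fun _ => rfl

lemma Represents.ev {f : Smooth U} {F : E4 → ℂ} (hf : Represents f F) (x : U) : Smooth.ev x f = F x :=
  hf x

lemma pd_pd_comm {F : E4 → ℂ} (hF : ContDiffOn ℝ ∞ F U) (a b : Fin 4) (x : U) :
    pd a (pd b F) x = pd b (pd a F) x := by
  have h1 : ContDiffAt ℝ ∞ F x := hF.contDiffAt (U.isOpen.mem_nhds x.2)
  have h2 : IsSymmSndFDerivAt ℝ F x := h1.isSymmSndFDerivAt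
      (by simpa using WithTop.coe_le_coe.mpr (le_top (a := (2 : ℕ∞))))
  have h3 : DifferentiableAt ℝ (fderiv ℝ F) x :=
    (h1.fderiv_right (m := ∞) (by simp)).differentiableAt (by simp)
  have h4 : ∀ a b : Fin 4, pd a (pd b F) x = fderiv ℝ (fderiv ℝ F) x (EuclideanSpace.single a 1)
      (EuclideanSpace.single b 1) := by
    intro a b
    rw [pd]
    change fderiv ℝ (fun y => fderiv ℝ F y (EuclideanSpace.single b 1)) x _ = _
    rw [fderiv_clm_apply h3 (differentiableAt_const _)]
    simp
  rw [h4, h4, h2]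

lemma pa_comm (a b : Fin 4) (f : Smooth U) : pa a (pa b f) = pa b (pa a f) := ext_ev fun x => by
  have h := rep_extendZero f
  rw [((h.pa b).pa a).ev, ((h.pa a).pa b).ev, pd_pd_comm f.2]

/-- Complex conjugation on the algebra. -/
def conjS (f : Smooth U) : Smooth U :=
  mk (fun x => conj (extendZero U f.1 x)) (Complex.conjCLE.contDiff.comp_contDiffOn f.2)

lemma Represents.conjS {f : Smooth U} {F : E4 → ℂ} (hf : Represents f F) :
    Represents (Smooth.conjS f) (fun x => conj (F x)) := fun x => by
  change conj (extendZero U f.1 x) = _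
  rw [extendZero_apply, hf]

lemma ev_conjS (x : U) (f : Smooth U) : ev x (conjS f) = conj (ev x f) := by
  rw [ev_apply, ev_apply]
  change conj (extendZero U f.1 x) = _
  rw [extendZero_apply]

end Smooth

lemma pd_conj (F : E4 → ℂ) (a : Fin 4) (x : E4) :
    pd a (fun y => conj (F y)) x = conj (pd a F x) := by
  have := Complex.conjCLE.comp_fderiv (f := F) (x := x)
  rw [pd, pd]
  change fderiv ℝ (Complex.conjCLE ∘ F) x _ = _
  rw [this]
  rfl

namespace Smooth

lemma pa_conjS (a : Fin 4) (f : Smooth U) : pa a (conjS f) = conjS (pa a f) := ext_ev fun x => by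
  have h := rep_extendZero f
  rw [(h.conjS.pa a).ev, ev_conjS, (h.pa a).ev, pd_conj]

/-- A nowhere vanishing smooth function is invertible. -/
lemma exists_inv {f : Smooth U} (hf : ∀ x, ev x f ≠ 0) :
    ∃ k : Smooth U, f * k = 1 ∧ ∀ x, ev x k = (ev x f)⁻¹ := by
  refine ⟨mk (fun x => (extendZero U f.1 x)⁻¹) (ContDiffOn.inv f.2 fun x hx => ?_),
    ext_ev fun x => ?_,
    fun x => ?_⟩
  · have := hf ⟨x, hx⟩
    rwa [ev_apply, ← extendZero_apply f.1] at this
  · rw [map_mul, (rep_mk _ _).ev, map_one, extendZero_apply]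
    exact mul_inv_cancel₀ (hf x)
  · rw [(rep_mk _ _).ev, extendZero_apply]
    rfl

end Smooth

open Smooth

/-! ### The calculus of a smooth metric -/

/-- The components of a smooth nondegenerate symmetric form on an open set. -/
structure SmoothMetric (U : TopologicalSpace.Opens E4) (gt : Tens2) : Prop where
  smooth : ∀ a b, ContDiffOn ℝ ∞ (gt a b) U
  symm : ∀ a b, ∀ x : U, gt a b x = gt b a x
  det_ne_zero : ∀ x : U, (Matrix.of fun a b => gt a b x).det ≠ 0

/-- Evaluation of matrices at a point. -/
def evM {U : TopologicalSpace.Opens E4} (x : U) : Mat (Smooth U) →+* Mat ℂ := (ev x).mapMatrix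

namespace SmoothMetric

variable {U : TopologicalSpace.Opens E4} {gt : Tens2} (hm : SmoothMetric U gt)

/-- The metric over the ring of smooth functions. -/
def gA : Mat (Smooth U) := Matrix.of fun a b => Smooth.mk (gt a b) (hm.smooth a b)

lemma rep_g (a b : Fin 4) : Represents (hm.gA a b) (gt a b) := rep_mk _ (hm.smooth a b)

lemma isUnit_det : IsUnit hm.gA.det := by
  obtain ⟨k, hk, -⟩ := exists_inv (f := hm.gA.det) fun x => by
    rw [RingHom.map_det]
    exact hm.det_ne_zero x
  exact IsUnit.of_mul_eq_one _ hk

/-- The inverse metric over the ring of smooth functions. -/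
def hA : Mat (Smooth U) := hm.gA⁻¹

lemma gA_mul_hA : hm.gA * hm.hA = 1 := Matrix.mul_nonsing_inv _ hm.isUnit_det

lemma hA_mul_gA : hm.hA * hm.gA = 1 := Matrix.nonsing_inv_mul _ hm.isUnit_det

lemma rep_h (a b : Fin 4) : Represents (hm.hA a b) (ginv gt a b) := fun x => by
  have h1 : evM x hm.gA * evM x hm.hA = 1 := by rw [← map_mul, gA_mul_hA, map_one]
  have h2 := Matrix.inv_eq_right_inv h1
  exact (congrFun (congrFun h2 a) b).symm

lemma gA_transpose : hm.gAᵀ = hm.gA := by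
  ext a b
  exact congrFun (congrArg Subtype.val (ext_ev (f := hm.gA b a) (k := hm.gA a b)
    fun x => hm.symm b a x)) _

lemma gA_comm (a b : Fin 4) : hm.gA a b = hm.gA b a := congrFun (congrFun hm.gA_transpose b) a

/-- The connection matrices, `Γ a b c = Γ^c_{ab}`. -/
def ΓA (a b c : Fin 4) : Smooth U :=
  algebraMap ℂ (Smooth U) (1 / 2) * ∑ d, hm.hA c d
    * (pa a (hm.gA d b) + pa b (hm.gA d a) - pa d (hm.gA a b))

lemma rep_Γ (a b c : Fin 4) : Represents (hm.ΓA a b c) (christoffel gt c a b) :=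
  (rep_const (1 / 2)).mul (Represents.sum fun d => (hm.rep_h c d).mul
    ((((hm.rep_g d b).pa a).add ((hm.rep_g d a).pa b)).sub ((hm.rep_g a b).pa d)))

lemma sum_Γ_g (a b c : Fin 4) : ∑ e, hm.ΓA a b e * hm.gA e c
    = algebraMap ℂ (Smooth U) (1 / 2)
      * (pa a (hm.gA c b) + pa b (hm.gA c a) - pa c (hm.gA a b)) := by
  have h1 : ∀ d, ∑ e, hm.hA e d * hm.gA e c = (1 : Mat (Smooth U)) c d := by
    intro d
    rw [← hm.gA_mul_hA, Matrix.mul_apply]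
    exact Finset.sum_congr rfl fun e _ => by rw [hm.gA_comm c e, mul_comm]
  calc ∑ e, hm.ΓA a b e * hm.gA e c
      = ∑ d, algebraMap ℂ (Smooth U) (1 / 2) * ((∑ e, hm.hA e d * hm.gA e c)
        * (pa a (hm.gA d b) + pa b (hm.gA d a) - pa d (hm.gA a b))) := by
        simp only [ΓA, Finset.mul_sum, Finset.sum_mul]
        rw [Finset.sum_comm]
        exact Finset.sum_congr rfl fun d _ => Finset.sum_congr rfl fun e _ => by ring
    _ = _ := by
        simp only [h1, Matrix.one_apply, ite_mul, one_mul, zero_mul, mul_ite, mul_zero,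
          Finset.sum_ite_eq, Finset.mem_univ, if_true]

lemma half_add_half : algebraMap ℂ (Smooth U) (1 / 2) + algebraMap ℂ (Smooth U) (1 / 2) = 1 := by
  rw [← map_add]
  norm_num

/-- The calculus of the metric. -/
def toCalc : Calc (Smooth U) where
  pa := pa
  pa_comm := pa_comm
  g := hm.gA
  h := hm.hA
  g_symm := hm.gA_transpose
  g_mul_h := hm.gA_mul_hA
  G := fun a => Matrix.of fun b c => hm.ΓA a b c
  G_symm := fun a b c => by
    simp only [Matrix.of_apply, ΓA, hm.gA_comm a b]
    congr 1
    exact Finset.sum_congr rfl fun d _ => by ring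
  compat := fun c => by
    ext1 a b
    have h1 : (hm.gA * (Matrix.of fun b d => hm.ΓA c b d)ᵀ) a b
        = ∑ e, hm.ΓA c b e * hm.gA e a := by
      rw [Matrix.mul_apply]
      exact Finset.sum_congr rfl fun e _ => by
        rw [Matrix.transpose_apply, Matrix.of_apply, hm.gA_comm a e, mul_comm]
    rw [Matrix.add_apply, h1, sum_Γ_g, Matrix.mul_apply]
    simp only [Matrix.of_apply, sum_Γ_g, Matrix.map_apply]
    rw [hm.gA_comm b a, hm.gA_comm b c, hm.gA_comm a c]
    linear_combination -pa c (hm.gA a b) * half_add_half (U := U)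

/-! ### Translation into components -/

lemma rep_grd {f : Smooth U} {F : E4 → ℂ} (hf : Represents f F) (a : Fin 4) :
    Represents (hm.toCalc.grd f a) (grad F a) := hf.pa a

lemma rep_Dv {α : Cov (Smooth U)} {αt : Tens1} (hα : ∀ b, Represents (α b) (αt b)) (a b : Fin 4) :
    Represents (hm.toCalc.Dv a α b) (cov1 gt αt a b) :=
  ((hα b).pa a).sub (Represents.sum fun c => (hm.rep_Γ a b c).mul (hα c))

lemma rep_Dl {T : Mat (Smooth U)} {Tt : Tens2} (hT : ∀ a b, Represents (T a b) (Tt a b))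
    (c a b : Fin 4) : Represents (hm.toCalc.Dl c T a b) (cov2 gt Tt c a b) := by
  have h1 : hm.toCalc.Dl c T a b = pa c (T a b) - ∑ d, hm.ΓA c a d * T d b
      - ∑ d, hm.ΓA c b d * T a d := by
    have : ∑ d, hm.ΓA c b d * T a d = ∑ d, T a d * hm.ΓA c b d :=
      Finset.sum_congr rfl fun d _ => mul_comm _ _
    rw [this]
    rfl
  rw [h1]
  exact (((hT a b).pa c).sub (Represents.sum fun d => (hm.rep_Γ c a d).mul (hT d b))).sub
    (Represents.sum fun d => (hm.rep_Γ c b d).mul (hT a d))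

lemma rep_bx {f : Smooth U} {F : E4 → ℂ} (hf : Represents f F) :
    Represents (hm.toCalc.bx f) (box gt F) := by
  have h1 : hm.toCalc.bx f = ∑ a, ∑ b, hm.hA a b * hm.toCalc.Dv a (hm.toCalc.grd f) b := by
    rw [Calc.bx, Calc.dvg_eq]
    exact Finset.sum_congr rfl fun a _ => by rw [Calc.ip_δ]; rfl
  rw [h1]
  exact Represents.sum fun a => Represents.sum fun b => (hm.rep_h a b).mul
      (hm.rep_Dv (hm.rep_grd hf) a b)

/-- The minus sign arises because `div2` contracts the first index and `divM` the second. -/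
lemma rep_divM {T : Mat (Smooth U)} {Tt : Tens2} (hT : ∀ a b, Represents (T a b) (Tt a b))
    (hskew : Tᵀ = -T) (b : Fin 4) :
    Represents (-hm.toCalc.divM (T * hm.hA) b) (div2 gt Tt b) := by
  have hd : ∀ c a, hm.toCalc.Dl c T b a = -hm.toCalc.Dl c T a b := by
    intro c a
    have := Calc.Dl_transpose (C := hm.toCalc) hskew c
    exact congrFun (congrFun this a) b
  have h1 : -hm.toCalc.divM (T * hm.hA) b = ∑ a, ∑ c, hm.hA a c * hm.toCalc.Dl c T a b := by
    have e1 : ∀ c, hm.toCalc.Dm c (T * hm.hA) = hm.toCalc.Dl c T * hm.hA := fun c =>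
      Calc.Dm_mul_h (C := hm.toCalc) c T
    rw [Calc.divM, Finset.sum_apply, ← Finset.sum_neg_distrib, Finset.sum_comm]
    refine Finset.sum_congr rfl fun c _ => ?_
    rw [e1, Calc.mulVec_δ, Matrix.mul_apply, ← Finset.sum_neg_distrib]
    exact Finset.sum_congr rfl fun a _ => by rw [hd]; ring
  rw [h1]
  exact Represents.sum fun a => Represents.sum fun c => (hm.rep_h a c).mul (hm.rep_Dl hT c a b)

/-- `Rm` acts on covectors, so its products of connection matrices occur in the order opposite to
the curvature of vectors, and with the opposite sign. -/
lemma rep_Rm (a b c d : Fin 4) : Represents (hm.toCalc.Rm a b c d) (riemUp gt a b c d) := by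
  have h1 : hm.toCalc.Rm a b c d = pa a (hm.ΓA b c d) - pa b (hm.ΓA a c d)
      + ∑ e, (hm.ΓA a e d * hm.ΓA b c e - hm.ΓA b e d * hm.ΓA a c e) := by
    have : hm.toCalc.Rm a b c d = pa a (hm.ΓA b c d) - pa b (hm.ΓA a c d)
      - (∑ e, hm.ΓA a c e * hm.ΓA b e d - ∑ e, hm.ΓA b c e * hm.ΓA a e d) := rfl
    rw [this, Finset.sum_sub_distrib]
    simp only [mul_comm (hm.ΓA a c _), mul_comm (hm.ΓA b c _)]
    ring
  rw [h1]
  exact (((hm.rep_Γ b c d).pa a).sub ((hm.rep_Γ a c d).pa b)).add (Represents.sum fun e =>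
    ((hm.rep_Γ a e d).mul (hm.rep_Γ b c e)).sub ((hm.rep_Γ b e d).mul (hm.rep_Γ a c e)))

/-- The divergence of a vector field. -/
lemma rep_dvg {α : Cov (Smooth U)} {V : Fin 4 → E4 → ℂ}
    (hV : ∀ a, Represents ((hm.hA *ᵥ α) a) (V a)) : Represents (hm.toCalc.dvg α) (divVec gt V) := by
  set C := hm.toCalc
  have h0 : ∀ c, C.h *ᵥ C.Dv c α = C.dv c (C.h *ᵥ α) + (C.G c)ᵀ *ᵥ (C.h *ᵥ α) := by
    intro c
    rw [Calc.dv_mulVec, Calc.dm_h, Calc.Dv]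
    simp only [Matrix.mulVec_sub, Matrix.neg_mulVec, Matrix.add_mulVec, Matrix.mulVec_mulVec]
    abel
  have h1 : C.dvg α = ∑ a, (pa a ((hm.hA *ᵥ α) a) + ∑ b, hm.ΓA a b a * (hm.hA *ᵥ α) b) := by
    rw [Calc.dvg_eq]
    refine Finset.sum_congr rfl fun a _ => ?_
    rw [Calc.ip_δ, h0]
    rfl
  rw [h1]
  exact Represents.sum fun a => ((hV a).pa a).add
      (Represents.sum fun b => (hm.rep_Γ a b a).mul (hV b))

end SmoothMetric

/-! ### Evaluation of matrices of functions -/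

section Eval

variable {U : TopologicalSpace.Opens E4}

lemma evM_apply (x : U) (X : Mat (Smooth U)) (a b : Fin 4) : evM x X a b = ev x (X a b) := rfl

lemma evM_ext {X Y : Mat (Smooth U)} (h : ∀ x, evM x X = evM x Y) : X = Y := by
  ext1 a b
  exact ext_ev fun x => congrFun (congrFun (h x) a) b

lemma evM_transpose (x : U) (X : Mat (Smooth U)) : evM x Xᵀ = (evM x X)ᵀ := rfl

lemma evM_smul (x : U) (f : Smooth U) (X : Mat (Smooth U)) :
    evM x (f • X) = ev x f • evM x X := by
  ext a b
  simp [evM_apply]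

lemma evM_neg (x : U) (X : Mat (Smooth U)) : evM x (-X) = -evM x X := by
  ext a b
  simp [evM_apply]

lemma ev_trace (x : U) (X : Mat (Smooth U)) : ev x X.trace = (evM x X).trace := by
  simp [Matrix.trace, evM_apply]

lemma ev_mulVec (x : U) (X : Mat (Smooth U)) (v : Cov (Smooth U)) (a : Fin 4) :
    ev x ((X *ᵥ v) a) = (evM x X *ᵥ fun b => ev x (v b)) a := by
  simp [Matrix.mulVec, dotProduct, evM_apply]

end Eval

namespace SmoothMetric

variable {U : TopologicalSpace.Opens E4} {gt : Tens2} (hm : SmoothMetric U gt)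

lemma evM_wedge (x : U) (a b : Fin 4) :
    evM x (hm.toCalc.wedge (hm.toCalc.θ a) (hm.toCalc.θ b)) = wedgeθ (evM x hm.gA) a b := by
  ext c d
  have h1 : ∀ i k, ev x ((1 : Mat (Smooth U)) i k) = (1 : Mat ℂ) i k := fun i k => by
    have := congrFun (congrFun (map_one (evM x)) i) k
    exact this
  have h2 := hm.toCalc.tens_θ_apply a b c d
  have h3 := hm.toCalc.tens_θ_apply b a c d
  rw [evM_apply, Calc.wedge, Matrix.sub_apply, h2, h3, map_sub, map_mul, map_mul, h1, h1]
  rfl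

/-- A background of type D from principal null tetrads at all points. -/
theorem isTypeD_of_frames {j : Mat (Smooth U)} {ζ ζi : Smooth U} {μ : ℂ} (hζ : ζ * ζi = 1)
    (hcurv : ∀ x, IsEinsteinCurv (evM x hm.gA) (evM x hm.hA)
      (fun a b => evM x (hm.toCalc.Rm a b)) μ)
    (hfr : ∀ x, ∃ E ψ', IsFrame (evM x hm.gA) (evM x hm.hA) E ∧
      IsPrincipalFrame E (weylArray (evM x hm.gA) (fun a b => evM x (hm.toCalc.Rm a b)) μ)
        (ev x ζ ^ 3) ψ' ∧ evM x j = evM x hm.gA * Eᵀ * nullForm * E) :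
    hm.toCalc.IsTypeD j (ζ ^ 3) (algebraMap ℂ (Smooth U) μ) (fun c => pa c ζ * ζi) := by
  set C := hm.toCalc with hC
  have hg : C.g = hm.gA := rfl
  have hh : C.h = hm.hA := rfl
  have hsk : ∀ X : Mat (Smooth U), C.Skew X → ∀ x, (evM x X)ᵀ * evM x hm.hA
      = -(evM x hm.hA * evM x X) := by
    intro X hX x
    have := congrArg (evM x) hX
    rwa [evM_neg, map_mul, map_mul, evM_transpose, hh] at this
  have hμ : ∀ x, ev x (algebraMap ℂ (Smooth U) μ) = μ := fun x => ev_algebraMap x μ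
  have hpζ : ∀ c, pa c ζi = -(pa c ζ * ζi * ζi) := by
    intro c
    have h1 := (pa c).leibniz ζ ζi
    rw [hζ, Derivation.map_one_eq_zero, smul_eq_mul, smul_eq_mul] at h1
    linear_combination (-ζi) * h1 - pa c ζi * hζ
  -- The algebraic fields are identities between functions and are tested at one point at a time, so
  -- the tetrads may depend on the point without any regularity.
  refine ⟨?_, ?_, ?_, ?_, ?_, ?_, ?_, ?_, ?_, ?_, ?_⟩
  · refine evM_ext fun x => ?_
    obtain ⟨E, ψ', F, -, hj⟩ := hfr x
    rw [map_mul, evM_neg, map_mul, evM_transpose, hh, hj]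
    have e1 := F.g_mul_h
    have e2 := F.h_mul_g
    set g := evM x hm.gA
    set h := evM x hm.hA
    calc (g * Eᵀ * nullForm * E)ᵀ * h = Eᵀ * nullFormᵀ * E * (gᵀ * h) := by
          simp only [Matrix.transpose_mul, Matrix.transpose_transpose, mul_assoc]
      _ = -((h * g) * (Eᵀ * nullForm * E)) := by
          rw [F.g_symm, e1, e2, nullForm_transpose]; noncomm_ring
      _ = _ := by simp only [mul_assoc]
  · refine evM_ext fun x => ?_
    obtain ⟨E, ψ', F, -, hj⟩ := hfr x
    rw [map_mul, map_one, hj, F.sq]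
  · intro X N hX hXj htr hN hNj
    refine evM_ext fun x => ?_
    obtain ⟨E, ψ', F, -, hj⟩ := hfr x
    have h1 := congrArg (evM x) hXj
    have h2 := congrArg (ev x) htr
    have h3 := congrArg (evM x) hNj
    rw [map_mul, map_mul, hj] at h1
    rw [ev_trace, map_mul, hj, map_zero] at h2
    rw [evM_neg, map_mul, map_mul, hj] at h3
    rw [map_mul, map_mul]
    exact F.commute_of (hsk X hX x) h1 h2 (hsk N hN x) h3
  · intro N T hN hNj hT
    refine evM_ext fun x => ?_
    obtain ⟨E, ψ', F, -, hj⟩ := hfr x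
    have h3 := congrArg (evM x) hNj
    rw [evM_neg, map_mul, map_mul, hj] at h3
    have h4 := F.dual_parallel (hsk N hN x) h3 (hsk T hT x)
    simp only [map_sub, map_add, evM_smul, map_mul, ev_trace, hj, map_zero]
    rw [map_ofNat]
    exact h4
  · intro a b
    refine evM_ext fun x => ?_
    obtain ⟨E, ψ', F, P, hj⟩ := hfr x
    have h1 := curv_commute F (hcurv x) P a b
    simp only [map_mul, map_sub, evM_smul, map_add, map_pow, hμ, hj, hC, hm.evM_wedge]
    exact h1
  · intro a b
    refine ext_ev fun x => ?_
    obtain ⟨E, ψ', F, P, hj⟩ := hfr x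
    have h1 := curv_trace F (hcurv x) P a b
    have h2 : ev x ((j *ᵥ C.θ b) a) = (evM x j * evM x hm.gA) a b := by
      rw [C.θ_eq_mulVec_δ, Matrix.mulVec_mulVec, Calc.mulVec_δ, hg, ← map_mul, evM_apply]
    rw [map_mul, h2, ev_trace, map_mul, hj, map_sub, map_mul, map_mul, map_pow, hμ, map_ofNat,
      map_ofNat]
    exact h1
  · intro a
    ext1 b
    refine ext_ev fun x => ?_
    have h1 := (hcurv x).ricci a b
    have h2 : (∑ c, C.Rm a c *ᵥ Calc.δ c) b = ∑ c, C.Rm a c b c := by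
      rw [Finset.sum_apply]
      exact Finset.sum_congr rfl fun c _ => Calc.mulVec_δ _ _ _
    rw [h2, map_sum, Pi.smul_apply, smul_eq_mul, map_mul, map_mul, map_ofNat, hμ]
    exact h1
  · intro c
    change pa c (ζ ^ 3) = _
    rw [Derivation.leibniz_pow]
    simp only [smul_eq_mul, nsmul_eq_mul]
    push_cast
    linear_combination -3 * ζ ^ 2 * pa c ζ * hζ
  · intro c
    exact (pa c).map_algebraMap μ
  -- Closedness holds because `p` is the logarithmic derivative of `ζ`.
  · intro a b
    have h1 : ∀ a b, C.Dv a (fun c => pa c ζ * ζi) b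
        = pa a (pa b ζ) * ζi - pa a ζ * pa b ζ * ζi * ζi
          - ∑ c, C.G a b c * (pa c ζ * ζi) := by
      intro a b
      have : C.Dv a (fun c => pa c ζ * ζi) b = pa a (pa b ζ * ζi)
        - ∑ c, C.G a b c * (pa c ζ * ζi) := rfl
      rw [this, Derivation.leibniz, hpζ]
      simp only [smul_eq_mul]
      ring
    rw [h1, h1, Smooth.pa_comm a b]
    simp only [C.G_symm a b]
    ring
  · exact IsUnit.of_mul_eq_one (ζi ^ 3) (by rw [← mul_pow, hζ, one_pow])

end SmoothMetric

/-! ### Reality -/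

lemma pd_real {F : E4 → ℂ} (hF : ∀ x, conj (F x) = F x) (a : Fin 4) (x : E4) :
    conj (pd a F x) = pd a F x := by
  rw [← pd_conj]
  simp only [hF]

lemma conjMat_inv (X : Mat ℂ) : conjMat X⁻¹ = (conjMat X)⁻¹ := by
  have e1 : conjMat X.adjugate = (conjMat X).adjugate := RingHom.map_adjugate (starRingEnd ℂ) X
  have e2 : conj X.det = (conjMat X).det := RingHom.map_det (starRingEnd ℂ) X
  rw [Matrix.inv_def, Matrix.inv_def, ← e1, ← e2, Ring.inverse_eq_inv']
  ext i k
  simp [conjMat_apply]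

lemma ginv_real {gt : Tens2} (hreal : ∀ a b x, conj (gt a b x) = gt a b x) (a b : Fin 4) (x : E4) :
    conj (ginv gt a b x) = ginv gt a b x := by
  have h1 : conjMat (Matrix.of fun i k => gt i k x) = Matrix.of fun i k => gt i k x := by
    ext i k
    exact hreal i k x
  have h3 := congrFun (congrFun (conjMat_inv (Matrix.of fun i k => gt i k x)) a) b
  rw [h1] at h3
  exact h3

lemma christoffel_real {gt : Tens2} (hreal : ∀ a b x, conj (gt a b x) = gt a b x) (c a b : Fin 4)
    (x : E4) : conj (christoffel gt c a b x) = christoffel gt c a b x := by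
  simp [christoffel, map_ofNat, ginv_real hreal, pd_real (hreal _ _)]

lemma riemUp_real {gt : Tens2} (hreal : ∀ a b x, conj (gt a b x) = gt a b x) (a b c d : Fin 4)
    (x : E4) : conj (riemUp gt a b c d x) = riemUp gt a b c d x := by
  simp [riemUp, christoffel_real hreal, pd_real (christoffel_real hreal _ _ _)]

lemma cov1_real {gt : Tens2} (hreal : ∀ a b x, conj (gt a b x) = gt a b x) {α : Tens1}
    (hα : ∀ a x, conj (α a x) = α a x) (a b : Fin 4) (x : E4) :
    conj (cov1 gt α a b x) = cov1 gt α a b x := by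
  simp [cov1, christoffel_real hreal, pd_real (hα _), hα]

lemma div2_real {gt : Tens2} (hreal : ∀ a b x, conj (gt a b x) = gt a b x) {T : Tens2}
    (hT : ∀ a b x, conj (T a b x) = T a b x) (b : Fin 4) (x : E4) :
    conj (div2 gt T b x) = div2 gt T b x := by
  simp [div2, cov2, ginv_real hreal, christoffel_real hreal, pd_real (hT _ _), hT]

lemma hodge_real {gt : Tens2} (hreal : ∀ a b x, conj (gt a b x) = gt a b x) {vol : Tens4}
    (hvol : ∀ a b c d x, conj (vol a b c d x) = vol a b c d x) {T : Tens2}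
    (hT : ∀ a b x, conj (T a b x) = T a b x) (a b : Fin 4) (x : E4) :
    conj (hodge gt vol T a b x) = hodge gt vol T a b x := by
  simp [hodge, up2, map_ofNat, ginv_real hreal, hvol, hT]

/-! ### Null tetrads -/

/-- The components of a field at a point. -/
def at2 (T : Tens2) (x : E4) : Mat ℂ := Matrix.of fun a b => T a b x

/-- The matrix with rows `l`, `n`, `m`, `m̄`. -/
def tetrad (l n m : Fin 4 → ℂ) : Mat ℂ := Matrix.of ![l, n, m, fun a => conj (m a)]

lemma tetrad_zero (l n m : Fin 4 → ℂ) : tetrad l n m 0 = l := rfl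

lemma tetrad_one (l n m : Fin 4 → ℂ) : tetrad l n m 1 = n := rfl

lemma tetrad_two (l n m : Fin 4 → ℂ) : tetrad l n m 2 = m := rfl

lemma tetrad_three (l n m : Fin 4 → ℂ) : tetrad l n m 3 = fun a => conj (m a) := rfl

lemma gram_apply (gt : Tens2) (x : E4) (E : Mat ℂ) (i k : Fin 4) :
    (E * at2 gt x * Eᵀ) i k = ev2 gt x (E i) (E k) := by
  rw [mul_assoc, Matrix.mul_apply]
  refine Finset.sum_congr rfl fun a _ => ?_
  rw [Matrix.mul_apply, Finset.mul_sum]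
  exact Finset.sum_congr rfl fun b _ => by
    rw [Matrix.transpose_apply, at2, Matrix.of_apply]; ring

lemma ev2_comm {gt : Tens2} {x : E4} (hs : ∀ a b, gt a b x = gt b a x) (v w : Fin 4 → ℂ) :
    ev2 gt x v w = ev2 gt x w v := by
  rw [ev2, Finset.sum_comm]
  exact Finset.sum_congr rfl fun b _ => Finset.sum_congr rfl fun a _ => by rw [hs a b]; ring

lemma conj_ev2 {gt : Tens2} {x : E4} (hr : ∀ a b, conj (gt a b x) = gt a b x) (v w : Fin 4 → ℂ) :
    conj (ev2 gt x v w) = ev2 gt x (fun a => conj (v a)) (fun a => conj (w a)) := by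
  simp [ev2, hr]

namespace IsNullTetrad

variable {gt : Tens2} {vol : Tens4} {x : E4} {l n m : Fin 4 → ℂ}

lemma gram (H : IsNullTetrad gt vol x l n m) (hs : ∀ a b, gt a b x = gt b a x)
    (hr : ∀ a b, conj (gt a b x) = gt a b x) :
    tetrad l n m * at2 gt x * (tetrad l n m)ᵀ = nullMetric := by
  have hl : (fun a => conj (l a)) = l := funext H.l_real
  have hn : (fun a => conj (n a)) = n := funext H.n_real
  have hm : (fun a => conj (conj (m a))) = m := funext fun a => Complex.conj_conj _
  have lmb : ev2 gt x l (fun a => conj (m a)) = 0 := by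
    have := conj_ev2 hr l m
    rw [H.lm, hl, map_zero] at this
    exact this.symm
  have nmb : ev2 gt x n (fun a => conj (m a)) = 0 := by
    have := conj_ev2 hr n m
    rw [H.nm, hn, map_zero] at this
    exact this.symm
  have mbmb : ev2 gt x (fun a => conj (m a)) (fun a => conj (m a)) = 0 := by
    have := conj_ev2 hr m m
    rw [H.mm, map_zero] at this
    exact this.symm
  have nl := ev2_comm hs n l
  have ml := ev2_comm hs m l
  have mn := ev2_comm hs m n
  have mbl := ev2_comm hs (fun a => conj (m a)) l
  have mbn := ev2_comm hs (fun a => conj (m a)) n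
  have mbm := ev2_comm hs (fun a => conj (m a)) m
  ext i k
  rw [gram_apply]
  fin_cases i <;> fin_cases k <;>
    simp [tetrad_zero, tetrad_one, tetrad_two, tetrad_three, nullMetric, H.ll, H.nn, H.ln, H.lm,
      H.nm, H.mm, H.mmb, lmb, nmb, mbmb, nl, ml, mn,
      mbl, mbn, mbm]

lemma g_mul_inv (H : IsNullTetrad gt vol x l n m) (hs : ∀ a b, gt a b x = gt b a x)
    (hr : ∀ a b, conj (gt a b x) = gt a b x) :
    at2 gt x * ((tetrad l n m)ᵀ * nullMetric * tetrad l n m) = 1 := by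
  set E := tetrad l n m
  have h1 : E * (at2 gt x * Eᵀ * nullMetric) = 1 := by
    rw [← mul_assoc, ← mul_assoc, H.gram hs hr, nullMetric_sq]
  have h2 := mul_eq_one_comm.mp h1
  simpa only [mul_assoc] using h2

lemma det_ne_zero (H : IsNullTetrad gt vol x l n m) (hs : ∀ a b, gt a b x = gt b a x)
    (hr : ∀ a b, conj (gt a b x) = gt a b x) : (at2 gt x).det ≠ 0 := by
  have := congrArg Matrix.det (H.g_mul_inv hs hr)
  rw [Matrix.det_mul, Matrix.det_one] at this
  exact left_ne_zero_of_mul_eq_one this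

lemma isFrame (H : IsNullTetrad gt vol x l n m) (hs : ∀ a b, gt a b x = gt b a x)
    (hr : ∀ a b, conj (gt a b x) = gt a b x) :
    IsFrame (at2 gt x) (at2 (ginv gt) x) (tetrad l n m) where
  gram := H.gram hs hr
  g_mul_h := Matrix.mul_nonsing_inv (at2 gt x) (H.det_ne_zero hs hr).isUnit
  g_symm := by
    ext a b
    exact hs b a

lemma isConjFrame (H : IsNullTetrad gt vol x l n m) : IsConjFrame (tetrad l n m) := fun a => by
  refine ⟨H.l_real a, H.n_real a, rfl, Complex.conj_conj _⟩

end IsNullTetrad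

lemma dyadForm_eq (gt : Tens2) (x : E4) (hs : ∀ a b, gt a b x = gt b a x) (l n m : Fin 4 → ℂ)
    (a b : Fin 4) : dyadForm gt x l n m a b
      = (1 / 2) * (at2 gt x * (tetrad l n m)ᵀ * nullForm * tetrad l n m * at2 gt x) a b := by
  have h1 : ∀ i a, (at2 gt x * (tetrad l n m)ᵀ) a i = lower gt x (tetrad l n m i) a := by
    intro i a
    rfl
  have h2 : ∀ i a, (tetrad l n m * at2 gt x) i a = lower gt x (tetrad l n m i) a := by
    intro i a
    rw [Matrix.mul_apply]
    exact Finset.sum_congr rfl fun c _ => by rw [at2, Matrix.of_apply, hs c a]; ring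
  rw [mul_assoc _ (tetrad l n m), Matrix.mul_apply]
  simp only [Matrix.mul_apply (N := nullForm), h1, h2]
  simp [Fin.sum_univ_four, nullForm, tetrad_zero, tetrad_one, tetrad_two, tetrad_three, dyadForm]
  ring

/-! ### The background in a chart -/

section Chart

variable {M : Type*} [TopologicalSpace M] [ChartedSpace E4 M]

/-- The target of a chart as an open set. -/
def chartTarget (e : OpenPartialHomeomorph M E4) : TopologicalSpace.Opens E4 :=
  ⟨e.target, e.open_target⟩

namespace Spacetime

variable (S : Spacetime M) (e : OpenPartialHomeomorph M E4)

lemma g_real (a b : Fin 4) (x : E4) : conj (S.g e a b x) = S.g e a b x := Complex.conj_ofReal _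

lemma volC_real (a b c d : Fin 4) (x : E4) : conj (S.volC e a b c d x) = S.volC e a b c d x :=
  Complex.conj_ofReal _

lemma g_symm (a b : Fin 4) (x : E4) : S.g e a b x = S.g e b a x := by
  rw [g, S.metric_symm]; rfl

lemma volC_perm (p : M) (v : Fin 4 → TangentSpace (𝓡 4) p) {i k : Fin 4} (hik : i ≠ k) :
    S.vol p (v ∘ Equiv.swap i k) = -S.vol p v := (S.vol p).toAlternatingMap.map_swap v hik

lemma volC_swap12 (a b c d : Fin 4) (x : E4) : S.volC e a b c d x = -S.volC e b a c d x := by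
  rw [volC, volC, ← Complex.ofReal_neg, ← S.volC_perm _ _ (show (0 : Fin 4) ≠ 1 by decide)]
  congr 2
  ext i : 1
  fin_cases i <;> rfl

lemma volC_swap23 (a b c d : Fin 4) (x : E4) : S.volC e a b c d x = -S.volC e a c b d x := by
  rw [volC, volC, ← Complex.ofReal_neg, ← S.volC_perm _ _ (show (1 : Fin 4) ≠ 2 by decide)]
  congr 2
  ext i : 1
  fin_cases i <;> rfl

lemma volC_swap34 (a b c d : Fin 4) (x : E4) : S.volC e a b c d x = -S.volC e a b d c x := by
  rw [volC, volC, ← Complex.ofReal_neg, ← S.volC_perm _ _ (show (2 : Fin 4) ≠ 3 by decide)]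
  congr 2
  ext i : 1
  fin_cases i <;> rfl

end Spacetime

/-- The Ricci tensor of a vacuum metric. -/
lemma ricci_of_einstein {gt : Tens2} {lam : ℂ} {x : E4}
    (hg : at2 gt x * at2 (ginv gt) x = 1) (hs : ∀ a b, gt a b x = gt b a x)
    (hE : ∀ a b, einstein gt a b x + lam * gt a b x = 0) :
    scalarCurv gt x = 4 * lam ∧ ∀ a b, ricci gt a b x = lam * gt a b x := by
  have h1 : ∀ a b, ricci gt a b x = (1 / 2 * scalarCurv gt x - lam) * gt a b x := fun a b => by
    have := hE a b
    rw [einstein] at this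
    linear_combination this
  have h2 : ∑ a, ∑ b, ginv gt a b x * gt a b x = 4 := by
    have h3 : at2 (ginv gt) x * at2 gt x = 1 := mul_eq_one_comm.mp hg
    have h4 := congrArg Matrix.trace h3
    rw [Matrix.trace_one, Fintype.card_fin] at h4
    rw [Nat.cast_ofNat] at h4
    refine Eq.trans ?_ h4
    refine Finset.sum_congr rfl fun a _ => ?_
    rw [Matrix.diag_apply, Matrix.mul_apply]
    exact Finset.sum_congr rfl fun b _ => by rw [hs a b]; rfl
  have h5 : scalarCurv gt x = (1 / 2 * scalarCurv gt x - lam) * 4 := by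
    conv_lhs => rw [scalarCurv]
    rw [← h2, Finset.mul_sum]
    refine Finset.sum_congr rfl fun a _ => ?_
    rw [Finset.mul_sum]
    exact Finset.sum_congr rfl fun b _ => by rw [h1]; ring
  have h6 : scalarCurv gt x = 4 * lam := by linear_combination -h5
  refine ⟨h6, fun a b => ?_⟩
  rw [h1, h6]; ring

namespace TypeDStructure

variable {S : Spacetime M} {k : ℂ} {e : OpenPartialHomeomorph M E4}

/-- The metric in a chart is smooth and nondegenerate. -/
lemma smoothMetric (D : TypeDStructure S k) (he : e ∈ coords M) :
    SmoothMetric (chartTarget e) (S.g e) where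
  smooth a b := Complex.ofRealCLM.contDiff.comp_contDiffOn (S.metric_smooth e he a b)
  symm a b x := S.g_symm e a b x
  det_ne_zero x := by
    obtain ⟨l, n, m, H, -⟩ := D.principal e he x x.2
    exact H.det_ne_zero (fun a b => S.g_symm e a b x) fun a b => S.g_real e a b x

lemma ζ_ne_zero (D : TypeDStructure S k) (he : e ∈ coords M) (x : chartTarget e) :
    D.ζ (e.symm x) ≠ 0 := by
  obtain ⟨l, n, m, -, H, -⟩ := D.principal e he x x.2
  exact fun h => H.ne_zero (by rw [h]; simp)

end TypeDStructure

lemma SmoothMetric.evM_h {U : TopologicalSpace.Opens E4} {gt : Tens2} (hm : SmoothMetric U gt)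
    (x : U) : evM x hm.hA = at2 (ginv gt) x := by
  ext a b
  exact hm.rep_h a b x

/-- The curvature of a vacuum metric has the symmetries of an Einstein curvature tensor. -/
lemma SmoothMetric.isEinsteinCurv {U : TopologicalSpace.Opens E4} {gt : Tens2}
    (hm : SmoothMetric U gt) {lam : ℂ}
    (hE : ∀ x : U, ∀ a b, einstein gt a b x + lam * gt a b x = 0) (x : U) :
    IsEinsteinCurv (evM x hm.gA) (evM x hm.hA) (fun a b => evM x (hm.toCalc.Rm a b)) (lam / 3) where
  swap a b := by rw [hm.toCalc.Rm_swap, evM_neg]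
  skew a b := by
    have := congrArg (evM x) (hm.toCalc.skew_Rm a b)
    rwa [evM_neg, map_mul, map_mul, evM_transpose] at this
  cyclic a b c d := by
    have := congrArg (ev x) (hm.toCalc.bianchi_first a b c d)
    rwa [map_add, map_add, map_zero] at this
  ricci a b := by
    have hg : at2 gt x * at2 (ginv gt) x = 1 := by
      rw [← hm.evM_h]
      have := congrArg (evM x) hm.gA_mul_hA
      rwa [map_mul, map_one] at this
    have h1 := (ricci_of_einstein hg (fun a b => hm.symm a b x) (hE x)).2 a b
    rw [TypeD.ricci] at h1
    calc ∑ c, evM x (hm.toCalc.Rm a c) b c = ∑ c, riemUp gt a c b c x :=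
          Finset.sum_congr rfl fun c _ => hm.rep_Rm a c b c x
      _ = _ := by rw [h1]; change _ = 3 * (lam / 3) * gt a b x; ring

/-- The Weyl tensor of a vacuum metric. -/
lemma SmoothMetric.weyl_eq {U : TopologicalSpace.Opens E4} {gt : Tens2}
    (hm : SmoothMetric U gt) {lam : ℂ}
    (hE : ∀ x : U, ∀ a b, einstein gt a b x + lam * gt a b x = 0) (x : U) (a b c d : Fin 4) :
    weyl gt a b c d x
      = weylArray (evM x hm.gA) (fun a b => evM x (hm.toCalc.Rm a b)) (lam / 3) a b c d := by
  have hg : at2 gt x * at2 (ginv gt) x = 1 := by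
    rw [← hm.evM_h]
    have := congrArg (evM x) hm.gA_mul_hA
    rwa [map_mul, map_one] at this
  obtain ⟨h1, h2⟩ := ricci_of_einstein hg (fun a b => hm.symm a b x) (hE x)
  have h3 : (evM x (hm.toCalc.Rm a b) * evM x hm.gA) c d = riem gt a b c d x := by
    rw [Matrix.mul_apply, riem]
    exact Finset.sum_congr rfl fun i _ => congrArg (· * _) (hm.rep_Rm a b c i x)
  have h4 : ∀ a b, evM x hm.gA a b = gt a b x := fun _ _ => rfl
  rw [weyl, h1, h2, h2, h2, h2, weylArray, h3]
  simp only [h4]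
  ring

/-- The principal null tetrads in a chart. -/
lemma TypeDStructure.exists_frame {S : Spacetime M} {k : ℂ} (D : TypeDStructure S k)
    {e : OpenPartialHomeomorph M E4} (he : e ∈ coords M) {lam : ℝ} (hvac : S.IsLambdaVacuum lam)
    (hm : SmoothMetric (chartTarget e) (S.g e)) (x : chartTarget e) :
    ∃ E, IsFrame (evM x hm.gA) (evM x hm.hA) E ∧ IsConjFrame E ∧
      frame4 E (fun a b c d => S.volC e a b c d x) 0 1 2 3 = -Complex.I ∧
      IsPrincipalFrame E (weylArray (evM x hm.gA) (fun a b => evM x (hm.toCalc.Rm a b)) (lam / 3))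
        (D.ζ (e.symm x) ^ 3) (conj (D.ζ (e.symm x) ^ 3)) ∧
      at2 (D.KC e) x = (k * (D.ζ (e.symm x))⁻¹ * (1 / 2))
        • (evM x hm.gA * Eᵀ * nullForm * E * evM x hm.gA) := by
  obtain ⟨l, n, m, H, P, hK⟩ := D.principal e he x x.2
  have hs : ∀ a b, S.g e a b x = S.g e b a x := fun a b => S.g_symm e a b x
  have hr : ∀ a b, conj (S.g e a b x) = S.g e a b x := fun a b => S.g_real e a b x
  have hE : ∀ x : chartTarget e, ∀ a b, einstein (S.g e) a b x + (lam : ℂ) * S.g e a b x = 0 :=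
    fun x => hvac e he x x.2
  have hw : (fun a b c d => weyl (S.g e) a b c d x)
      = weylArray (evM x hm.gA) (fun a b => evM x (hm.toCalc.Rm a b)) (lam / 3) := by
    funext a b c d
    exact hm.weyl_eq hE x a b c d
  refine ⟨tetrad l n m, ?_, H.isConjFrame, H.oriented, ?_, ?_⟩
  · rw [hm.evM_h]
    exact H.isFrame hs hr
  · rw [← hw]
    refine isPrincipalFrame_of_real H.isConjFrame (fun a b c d => ?_) P.psi0 P.psi1 P.psi2 P.psi3
      P.psi4
    have hric : ∀ a b, conj (ricci (S.g e) a b x) = ricci (S.g e) a b x := fun a b => by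
      simp [ricci, riemUp_real (S.g_real e)]
    simp [weyl, riem, scalarCurv, riemUp_real (S.g_real e), hr, hric, ginv_real (S.g_real e),
      map_ofNat]
  · ext a b
    have h1 := hK a b
    rw [dyadForm_eq _ _ hs] at h1
    rw [at2, Matrix.of_apply, KC, h1, Matrix.smul_apply, smul_eq_mul]
    change _ = _ * (at2 (S.g e) x * (tetrad l n m)ᵀ * nullForm * tetrad l n m * at2 (S.g e) x) a b
    ring

end Chart

/-! ### The type D structure of a chart as algebraic data -/

section Background

variable {M : Type*} [TopologicalSpace M] [ChartedSpace E4 M]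

lemma contDiffOn_comp_symm [IsManifold (𝓡 4) ∞ M] {f : M → ℂ}
    (hf : ContMDiff (𝓡 4) 𝓘(ℝ, ℂ) ∞ f) {e : OpenPartialHomeomorph M E4} (he : e ∈ coords M) :
    ContDiffOn ℝ ∞ (f ∘ e.symm) e.target :=
  contMDiffOn_iff_contDiffOn.mp
    (hf.comp_contMDiffOn (contMDiffOn_symm_of_mem_maximalAtlas he))

/-- The type D structure of a chart, in terms of the ring of smooth functions: `κ j` is twice the
two-form `K` with its second index raised, and the primed quantities are the complex conjugates. -/
structure Background {S : Spacetime M} {k : ℂ} (D : TypeDStructure S k)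
    (e : OpenPartialHomeomorph M E4) (lam : ℝ) where
  hm : SmoothMetric (chartTarget e) (S.g e)
  (j j' : Mat (Smooth (chartTarget e)))
  (Ψ Ψ' κ κ' : Smooth (chartTarget e))
  (p p' : Cov (Smooth (chartTarget e)))
  isTypeD : hm.toCalc.IsTypeD j Ψ (algebraMap ℂ _ ((lam : ℂ) / 3)) p
  isTypeD' : hm.toCalc.IsTypeD j' Ψ' (algebraMap ℂ _ ((lam : ℂ) / 3)) p'
  pa_κ : ∀ c, hm.toCalc.pa c κ = -(κ * p c)
  pa_κ' : ∀ c, hm.toCalc.pa c κ' = -(κ' * p' c)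
  real : κ • (j *ᵥ p) = κ' • (j' *ᵥ p')
  rep_Ψ : Represents Ψ fun x => D.Ψ₂ (e.symm x)
  rep_Ψ' : Represents Ψ' fun x => conj (D.Ψ₂ (e.symm x))
  rep_κ : Represents κ fun x => k * (D.ζ (e.symm x))⁻¹
  rep_κ' : Represents κ' fun x => conj (k * (D.ζ (e.symm x))⁻¹)
  rep_p : ∀ c, Represents (p c) fun x => pd c (D.ζ ∘ e.symm) x * (D.ζ (e.symm x))⁻¹
  rep_p' : ∀ c, Represents (p' c) fun x => conj (pd c (D.ζ ∘ e.symm) x * (D.ζ (e.symm x))⁻¹)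
  ev_K : ∀ x, evM x (κ • j) = (2 : ℂ) • (at2 (D.KC e) x * at2 (ginv (S.g e)) x)
  ev_j' : ∀ x, evM x j' = conjMat (evM x j)
  frame : ∀ x, ∃ E, IsFrame (evM x hm.gA) (evM x hm.hA) E ∧ IsConjFrame E ∧
    frame4 E (fun a b c d => S.volC e a b c d x) 0 1 2 3 = -Complex.I ∧
    evM x j = evM x hm.gA * Eᵀ * nullForm * E

/-- The form `K` is skew. -/
lemma TypeDStructure.at2_KC_transpose {S : Spacetime M} {k : ℂ} (D : TypeDStructure S k)
    {e : OpenPartialHomeomorph M E4} (he : e ∈ coords M) (x : chartTarget e) :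
    (at2 (D.KC e) x)ᵀ = -at2 (D.KC e) x := by
  obtain ⟨l, n, m, H, P, hK⟩ := D.principal e he x x.2
  ext a b
  rw [Matrix.transpose_apply, Matrix.neg_apply, at2, Matrix.of_apply, Matrix.of_apply, KC, KC, hK,
    hK, dyadForm, dyadForm]
  ring

/-- All data are built from the smooth `ζ` and `K`; the primed ones are complex conjugates, and the
conjugate tetrads provide their type D structure. The assumption `k ≠ 0` is needed to recover `j`
from `K`. -/
theorem TypeDStructure.exists_background [IsManifold (𝓡 4) ∞ M] {S : Spacetime M} {lam : ℝ}
    (hvac : S.IsLambdaVacuum lam) {k : ℂ} (hk : k ≠ 0) (D : TypeDStructure S k) (hξ : D.XiReal)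
    {e : OpenPartialHomeomorph M E4} (he : e ∈ coords M) : Nonempty (Background D e lam) := by
  have hm := D.smoothMetric he
  have hgr : ∀ x : chartTarget e, conjMat (evM x hm.gA) = evM x hm.gA := fun x => by
    ext a b
    exact S.g_real e a b x
  let ζ : Smooth (chartTarget e) := Smooth.mk (D.ζ ∘ e.symm) (contDiffOn_comp_symm D.ζ_smooth he)
  have hζ : Represents ζ (D.ζ ∘ e.symm) := fun _ => rfl
  have evζ : ∀ x, ev x ζ = D.ζ (e.symm x) := fun x => rfl
  obtain ⟨ζi, hζi, evζi⟩ := exists_inv (f := ζ) fun x => D.ζ_ne_zero he x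
  let K : Mat (Smooth (chartTarget e)) := Matrix.of fun a b => Smooth.mk (D.KC e a b)
    (D.K_smooth e he a b)
  have evK : ∀ x, evM x K = at2 (D.KC e) x := fun x => rfl
  let κ : Smooth (chartTarget e) := algebraMap ℂ _ k * ζi
  let κ' : Smooth (chartTarget e) := conjS κ
  -- The scalar undoes the factor `k ζ⁻¹ / 2` of `K`. Defining `j` by `K` and not by the tetrads
  -- makes it smooth.
  let j : Mat (Smooth (chartTarget e)) := (algebraMap ℂ _ (2 * k⁻¹) * ζ) • (K * hm.hA)
  let j' : Mat (Smooth (chartTarget e)) := Matrix.of fun a b => conjS (j a b)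
  let ζ' := conjS ζ
  let ζi' := conjS ζi
  have hζi' : ζ' * ζi' = 1 := ext_ev fun x => by
    have := congrArg (fun f => conj (ev x f)) hζi
    rw [map_mul, ev_conjS, ev_conjS, ← map_mul, ← map_mul, this, map_one, map_one]
  let p : Cov (Smooth (chartTarget e)) := fun c => pa c ζ * ζi
  let p' : Cov (Smooth (chartTarget e)) := fun c => pa c ζ' * ζi'
  have evj' : ∀ x, evM x j' = conjMat (evM x j) := fun x => by
    ext a b
    exact ev_conjS x _
  have evκ : ∀ x, ev x κ = k * (D.ζ (e.symm x))⁻¹ := fun x => by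
    rw [map_mul, ev_algebraMap, evζi, evζ]
  have evs : ∀ x, ev x (algebraMap ℂ _ (2 * k⁻¹) * ζ) = 2 * k⁻¹ * D.ζ (e.symm x) := fun x =>
    (ev x).map_mul _ _
  have evKj : ∀ x, evM x (κ • j) = (2 : ℂ) • (at2 (D.KC e) x * at2 (ginv (S.g e)) x) := fun x => by
    have h0 := D.ζ_ne_zero he x
    rw [evM_smul, evκ, evM_smul, evs, map_mul, evK, hm.evM_h, smul_smul]
    congr 1
    field_simp
  have hcurv := hm.isEinsteinCurv (lam := (lam : ℂ)) fun x => hvac e he x x.2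
  have hfr : ∀ x, ∃ E, IsFrame (evM x hm.gA) (evM x hm.hA) E ∧ IsConjFrame E ∧
      frame4 E (fun a b c d => S.volC e a b c d x) 0 1 2 3 = -Complex.I ∧
      IsPrincipalFrame E (weylArray (evM x hm.gA) (fun a b => evM x (hm.toCalc.Rm a b)) (lam / 3))
        (ev x ζ ^ 3) (conj (ev x ζ ^ 3)) ∧ evM x j = evM x hm.gA * Eᵀ * nullForm * E := fun x => by
    obtain ⟨E, F, hE, hv, P, hK⟩ := D.exists_frame he hvac hm x
    refine ⟨E, F, hE, hv, P, ?_⟩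
    have h0 := D.ζ_ne_zero he x
    rw [evM_smul, evs, map_mul, evK, hK, Matrix.smul_mul, mul_assoc _ _ (evM x hm.hA), F.g_mul_h,
      mul_one, smul_smul]
    convert one_smul ℂ _
    field_simp
  have hreal : ∀ x a b c d, conj (weylArray (evM x hm.gA) (fun a b => evM x (hm.toCalc.Rm a b))
      (lam / 3) a b c d) = weylArray (evM x hm.gA) (fun a b => evM x (hm.toCalc.Rm a b))
      (lam / 3) a b c d := fun x a b c d => by
    have h1 : conjMat (evM x (hm.toCalc.Rm a b)) = evM x (hm.toCalc.Rm a b) := by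
      ext c d
      rw [conjMat_apply, evM_apply, (hm.rep_Rm a b c d).ev, riemUp_real (S.g_real e)]
    have h2 : ∀ a b, conj (evM x hm.gA a b) = evM x hm.gA a b := fun a b => S.g_real e a b x
    have h3 : conj ((evM x (hm.toCalc.Rm a b) * evM x hm.gA) c d)
        = (evM x (hm.toCalc.Rm a b) * evM x hm.gA) c d := by
      rw [← conjMat_apply, map_mul, h1, hgr]
    simp [weylArray, h2, h3, map_ofNat]
  have H : hm.toCalc.IsTypeD j (ζ ^ 3) (algebraMap ℂ _ ((lam : ℂ) / 3)) p := by
    refine hm.isTypeD_of_frames hζi hcurv fun x => ?_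
    obtain ⟨E, F, -, -, P, hj⟩ := hfr x
    exact ⟨E, _, F, P, hj⟩
  have H' : hm.toCalc.IsTypeD j' (ζ' ^ 3) (algebraMap ℂ _ ((lam : ℂ) / 3)) p' := by
    refine hm.isTypeD_of_frames hζi' hcurv fun x => ?_
    obtain ⟨E, F, -, -, P, hj⟩ := hfr x
    refine ⟨conjMat E, conj (conj (ev x ζ ^ 3)), F.conjFrame (hgr x), ?_, ?_⟩
    · rw [ev_conjS, ← map_pow]
      exact P.conjFrame (hreal x)
    · rw [evj', hj, conjMat_dyad (hgr x)]
  have hpζ : ∀ c, pa c ζi = -(ζi * (pa c ζ * ζi)) := by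
    intro c
    have h1 := (pa c).leibniz ζ ζi
    rw [hζi, Derivation.map_one_eq_zero, smul_eq_mul, smul_eq_mul] at h1
    linear_combination (-ζi) * h1 - pa c ζi * hζi
  have hκ : ∀ c, hm.toCalc.pa c κ = -(κ * p c) := by
    intro c
    change pa c (algebraMap ℂ _ k * ζi) = _
    rw [Derivation.leibniz, Derivation.map_algebraMap, smul_zero, add_zero, smul_eq_mul, hpζ]
    change _ = -(algebraMap ℂ _ k * ζi * (pa c ζ * ζi))
    ring
  have hpc : ∀ c x, ev x (p' c) = conj (ev x (p c)) := by
    intro c x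
    rw [map_mul, map_mul, map_mul, pa_conjS, ev_conjS, ev_conjS]
  have hκ' : ∀ c, hm.toCalc.pa c κ' = -(κ' * p' c) := by
    intro c
    refine ext_ev fun x => ?_
    calc ev x (pa c κ') = conj (ev x (pa c κ)) := by rw [pa_conjS, ev_conjS]
      _ = conj (ev x (-(κ * p c))) := congrArg (fun f => conj (ev x f)) (hκ c)
      _ = ev x (-(κ' * p' c)) := by
        rw [(ev x).map_neg, (ev x).map_neg, (ev x).map_mul κ, (ev x).map_mul κ', hpc, ev_conjS,
          map_neg, map_mul]
  refine ⟨⟨hm, j, j', ζ ^ 3, ζ' ^ 3, κ, κ', p, p', H, H', hκ, hκ', ?_, fun x => ?_, fun x => ?_,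
    evκ, fun x => ?_, fun c x => ?_, fun c x => ?_, evKj, evj', fun x => ?_⟩⟩
  · ext1 b
    refine ext_ev fun x => ?_
    have h1 : Kᵀ = -K := evM_ext fun x => by
      rw [evM_transpose, evM_neg, evK, D.at2_KC_transpose he]
    have h2 := (hm.rep_divM (T := K) (Tt := D.KC e) (fun a b => rep_mk _ (D.K_smooth e he a b))
        h1 b).ev x
    have h3 : κ • j = (2 : Smooth (chartTarget e)) • (K * hm.hA) := evM_ext fun x => by
      rw [evKj, evM_smul, map_mul, evK, hm.evM_h, map_ofNat]
    have h4 := congrFun (H.divM_K hκ) b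
    rw [h3, Calc.divM_two_smul] at h4
    have h5 := congrArg (ev x) h4
    have h6 : conj (div2 (S.g e) (D.KC e) b x) = div2 (S.g e) (D.KC e) b x :=
      Complex.conj_eq_iff_im.mpr (hξ e he x x.2 b)
    simp only [Pi.smul_apply, Pi.neg_apply, smul_eq_mul, map_neg, map_mul, map_ofNat] at h5 h2 ⊢
    -- `κ j p` is `2/3` of `ξ`: the form `κ j` is `2 K`, its divergence is `-3 κ j p`, and `div2`
    -- differs from `divM` by a sign. So reality of `ξ` is the field `real`.
    have h7 : ev x κ * ev x ((j *ᵥ p) b) = 2 / 3 * div2 (S.g e) (D.KC e) b x := by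
      linear_combination (1 / 3) * h5 + (2 / 3) * h2
    have h8 : ev x κ' * ev x ((j' *ᵥ p') b) = conj (ev x κ * ev x ((j *ᵥ p) b)) := by
      rw [map_mul, ev_conjS, ev_mulVec, ev_mulVec, evj']
      simp only [hpc, Matrix.mulVec, dotProduct, map_sum, map_mul, conjMat_apply]
    rw [h8, h7]
    simp [h6, map_ofNat]
  · exact map_pow (ev x) ζ 3
  · exact (map_pow (ev x) ζ' 3).trans (by rw [ev_conjS, ← map_pow]; rfl)
  · exact (ev_conjS x κ).trans (by rw [evκ])
  · exact (map_mul (ev x) _ _).trans (by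
      rw [evζi, (hζ.pa c).ev]; rfl)
  · exact (hpc c x).trans (by rw [(ev x).map_mul, evζi, (hζ.pa c).ev]; rfl)
  · obtain ⟨E, F, hE, hv, -, hj⟩ := hfr x
    exact ⟨E, F, hE, hv, hj⟩

end Background

/-! ### The dual and the Killing–Yano form in a chart -/

lemma conjMat_smul (s : ℂ) (X : Mat ℂ) : conjMat (s • X) = conj s • conjMat X := by
  ext a b
  simp [conjMat_apply]

lemma dual_add (j T T' : Mat ℂ) : Calc.dual j (T + T') = Calc.dual j T + Calc.dual j T' := by
  simp only [Calc.dual, mul_add, add_mul, Matrix.trace_add]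
  module

lemma dual_smul (j T : Mat ℂ) (s : ℂ) : Calc.dual j (s • T) = s • Calc.dual j T := by
  simp only [Calc.dual, Matrix.mul_smul, Matrix.smul_mul, Matrix.trace_smul, smul_eq_mul]
  module

/-- The factor four matches `** = -1`, since `(-i/2)² · 4 = -1`. -/
lemma dual_dual {j : Mat ℂ} (hj : j * j = 1) (T : Mat ℂ) :
    Calc.dual j (Calc.dual j T) = (4 : ℂ) • T := by
  have h1 : (j * (j * T * j)).trace = (j * T).trace := by
    rw [← mul_assoc, ← mul_assoc, hj, one_mul, Matrix.trace_mul_comm]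
  have h2 : j * (j * T * j) * j = T := by
    calc j * (j * T * j) * j = (j * j) * T * (j * j) := by noncomm_ring
      _ = T := by rw [hj, one_mul, mul_one]
  conv_lhs => rw [Calc.dual]
  rw [Calc.dual, mul_sub, sub_mul, Matrix.mul_smul, Matrix.mul_smul, Matrix.smul_mul,
    Matrix.smul_mul, Matrix.trace_sub, Matrix.trace_smul, Matrix.trace_smul, h1, h2, hj,
    Matrix.trace_one, Fintype.card_fin, one_mul]
  push_cast
  simp only [smul_eq_mul]
  module

lemma SmoothMetric.ginv_transpose {U : TopologicalSpace.Opens E4} {gt : Tens2}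
    (hm : SmoothMetric U gt) (x : U) : (at2 (ginv gt) x)ᵀ = at2 (ginv gt) x := by
  rw [← hm.evM_h, ← evM_transpose]
  exact congrArg (evM x) hm.toCalc.h_symm

namespace Background

variable {M : Type*} [TopologicalSpace M] [ChartedSpace E4 M] {S : Spacetime M} {k : ℂ}
  {D : TypeDStructure S k} {e : OpenPartialHomeomorph M E4} {lam : ℝ} (B : Background D e lam)

lemma h_mul_g (x : chartTarget e) : at2 (ginv (S.g e)) x * evM x B.hm.gA = 1 := by
  rw [← B.hm.evM_h, ← map_mul, B.hm.hA_mul_gA, map_one]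

lemma g_mul_h (x : chartTarget e) : evM x B.hm.gA * at2 (ginv (S.g e)) x = 1 :=
  mul_eq_one_comm.mp (B.h_mul_g x)

lemma j_sq (x : chartTarget e) : evM x B.j * evM x B.j = 1 := by
  rw [← map_mul, B.isTypeD.sq, map_one]

lemma ev_κ' (x : chartTarget e) : ev x B.κ' = conj (ev x B.κ) := by
  rw [B.rep_κ.ev, B.rep_κ'.ev]

lemma ev_K' (x : chartTarget e) : evM x (B.κ' • B.j') = conjMat (evM x (B.κ • B.j)) := by
  rw [evM_smul, evM_smul, conjMat_smul, B.ev_j', B.ev_κ']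

lemma commute (x : chartTarget e) : evM x B.j * evM x B.j' = evM x B.j' * evM x B.j := by
  obtain ⟨E, F, hE, -, hj⟩ := B.frame x
  have hgr : conjMat (evM x B.hm.gA) = evM x B.hm.gA := by
    ext a b
    exact S.g_real e a b x
  rw [B.ev_j', hj, conjMat_dyad hgr, F.commute_conj hE]

lemma trace_mul (x : chartTarget e) : (evM x B.j * evM x B.j').trace = 0 := by
  obtain ⟨E, F, hE, -, hj⟩ := B.frame x
  have hgr : conjMat (evM x B.hm.gA) = evM x B.hm.gA := by
    ext a b
    exact S.g_real e a b x
  rw [B.ev_j', hj, conjMat_dyad hgr, F.trace_mul_conj hE]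

/-- The Hodge dual in mixed form. -/
lemma ev_hodge {T : Tens2} {x : chartTarget e} (hT : (at2 T x)ᵀ = -at2 T x) :
    at2 (hodge (S.g e) (S.volC e) T) x * at2 (ginv (S.g e)) x
      = (-(Complex.I / 2)) • Calc.dual (evM x B.j) (at2 T x * at2 (ginv (S.g e)) x) := by
  obtain ⟨E, F, -, hv, hj⟩ := B.frame x
  rw [B.hm.evM_h] at F
  exact hodge_mul_h F (fun a b c d => S.volC_swap12 e a b c d x)
    (fun a b c d => S.volC_swap23 e a b c d x) (fun a b c d => S.volC_swap34 e a b c d x) hv hT hj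

/-- The Killing–Yano form with its second index raised. -/
def Y : Mat (Smooth (chartTarget e)) :=
  algebraMap ℂ (Smooth (chartTarget e)) (Complex.I / 2) • (B.κ • B.j - B.κ' • B.j')

lemma ev_Y (x : chartTarget e) :
    evM x B.Y = (Complex.I / 2) • (evM x (B.κ • B.j) - evM x (B.κ' • B.j')) := by
  rw [Y, evM_smul, map_sub, ev_algebraMap]

lemma ginv_conj (x : chartTarget e) :
    conjMat (at2 (ginv (S.g e)) x) = at2 (ginv (S.g e)) x := by
  ext a b
  exact ginv_real (S.g_real e) a b x

lemma at2_Y_mul (x : chartTarget e) :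
    at2 (D.Y e) x * at2 (ginv (S.g e)) x = evM x B.Y := by
  have h1 : at2 (D.Y e) x = Complex.I • at2 (D.KC e) x - Complex.I • conjMat (at2 (D.KC e) x) := by
    ext a b
    rfl
  rw [ev_Y, B.ev_K', B.ev_K, conjMat_smul, map_mul, ginv_conj, h1, map_ofNat, sub_mul,
    Matrix.smul_mul, Matrix.smul_mul]
  module

lemma rep_Y (a b : Fin 4) : Represents (B.Y a b) (upSnd (S.g e) (D.Y e) a b) := fun x => by
  have := congrFun (congrFun (B.at2_Y_mul x) a) b
  exact this.symm

lemma at2_Y (x : chartTarget e) : at2 (D.Y e) x = evM x B.Y * evM x B.hm.gA := by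
  rw [← B.at2_Y_mul, mul_assoc, B.h_mul_g, mul_one]

lemma skew_Y : B.hm.toCalc.Skew B.Y :=
  ((B.isTypeD.skew.smul _).sub (B.isTypeD'.skew.smul _)).smul _

lemma skew_lower {X : Mat (Smooth (chartTarget e))} (hX : B.hm.toCalc.Skew X) :
    (X * B.hm.gA)ᵀ = -(X * B.hm.gA) := by
  refine evM_ext fun x => ?_
  have h1 := congrArg (evM x) hX
  rw [evM_neg, map_mul, map_mul, evM_transpose] at h1
  have h2 : evM x B.hm.toCalc.h = at2 (ginv (S.g e)) x := B.hm.evM_h x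
  have h3 : (evM x B.hm.gA)ᵀ = evM x B.hm.gA := congrArg (evM x) B.hm.gA_transpose
  rw [h2] at h1
  rw [evM_transpose, evM_neg, map_mul, Matrix.transpose_mul, h3]
  have hgh := B.g_mul_h x
  have hhg := B.h_mul_g x
  set g := evM x B.hm.gA
  set h := at2 (ginv (S.g e)) x
  calc g * (evM x X)ᵀ = g * ((evM x X)ᵀ * h) * g := by
        rw [mul_assoc, mul_assoc, hhg, mul_one]
    _ = -((g * h) * evM x X * g) := by rw [h1]; noncomm_ring
    _ = _ := by rw [hgh, one_mul]

lemma at2_Y_transpose (B : Background D e lam) (x : chartTarget e) :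
    (at2 (D.Y e) x)ᵀ = -at2 (D.Y e) x := by
  have := congrArg (evM x) (B.skew_lower B.skew_Y)
  rwa [evM_transpose, evM_neg, map_mul, ← B.at2_Y] at this

/-- The dual of the Killing–Yano form. -/
lemma at2_starY_mul (x : chartTarget e) :
    at2 (D.starY e) x * at2 (ginv (S.g e)) x
      = (1 / 2 : ℂ) • (evM x (B.κ • B.j) + evM x (B.κ' • B.j')) := by
  rw [TypeDStructure.starY, B.ev_hodge (B.at2_Y_transpose x), B.at2_Y_mul, ev_Y, sub_eq_add_neg,
    ← neg_one_smul ℂ (evM x (B.κ' • B.j')), evM_smul, evM_smul, dual_smul, dual_add, dual_smul,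
    dual_smul, dual_smul, dual_self (B.j_sq x), dual_conj (B.j_sq x) (B.commute x) (B.trace_mul x)]
  match_scalars <;> ring_nf <;> simp <;> ring

end Background

/-! ### Constant factors and contractions with an exterior derivative -/

namespace Calc

variable {A : Type*} [CommRing A] [Algebra ℂ A] {C : Calc A}

lemma Dv_const_smul {s : A} (hs : ∀ c, C.pa c s = 0) (c : Fin 4) (V : Cov A) :
    C.Dv c (s • V) = s • C.Dv c V := by
  rw [Dv_smul, hs, zero_smul, zero_add]

lemma exd_const_smul {s : A} (hs : ∀ c, C.pa c s = 0) (V : Cov A) :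
    C.exd (s • V) = s • C.exd V := by
  ext a b
  simp only [exd, Matrix.of_apply, Matrix.smul_apply, Dv_const_smul hs, Pi.smul_apply, smul_sub]

lemma exd_add (V W : Cov A) : C.exd (V + W) = C.exd V + C.exd W := by
  ext a b
  simp only [exd, Matrix.of_apply, Matrix.add_apply, Dv_add, Pi.add_apply]
  ring

lemma grd_add (f k : A) : C.grd (f + k) = C.grd f + C.grd k := by
  ext a; simp [grd]

lemma grd_const_mul {s : A} (hs : ∀ c, C.pa c s = 0) (f : A) : C.grd (s * f) = s • C.grd f := by
  ext a; simp [grd, Derivation.leibniz, hs]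

lemma bx_const_mul {s : A} (hs : ∀ c, C.pa c s = 0) (f : A) : C.bx (s * f) = s * C.bx f := by
  simp only [bx, dvg_eq, grd_const_mul hs, Dv_const_smul hs, ip_smul_left, Finset.mul_sum]

lemma divM_const_smul {s : A} (hs : ∀ c, C.pa c s = 0) (M : Mat A) :
    C.divM (s • M) = s • C.divM M := by
  have : C.grd s = 0 := by
    ext a; exact hs a
  rw [divM_smul, this, Matrix.mulVec_zero, zero_add]

/-- A skew `X` sees only the antisymmetric part of `∇V`. Through this lemma the symmetry operator
depends on `V` only by its exterior derivative. -/
lemma Skew.two_mul_sum_ip {X : Mat A} (hX : C.Skew X) (V : Cov A) :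
    2 * ∑ c, C.ip (X *ᵥ C.Dv c V) (δ c) = -(X * (C.exd V * C.h)).trace := by
  have hs : ∀ a b, (C.h * X) a b = -(C.h * X) b a := fun a b => by
    have := congrFun (congrFun hX.h_mul_transpose b) a
    rwa [Matrix.transpose_apply, Matrix.neg_apply] at this
  have h1 : ∑ c, C.ip (X *ᵥ C.Dv c V) (δ c) = ∑ c, ∑ b, (C.h * X) c b * C.Dv c V b :=
    Finset.sum_congr rfl fun c _ => by
      rw [ip_δ, Matrix.mulVec_mulVec]; rfl
  have h2 : ∑ c, ∑ b, (C.h * X) c b * C.Dv b V c = -∑ c, ∑ b, (C.h * X) c b * C.Dv c V b := by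
    rw [Finset.sum_comm, ← Finset.sum_neg_distrib]
    refine Finset.sum_congr rfl fun c _ => ?_
    rw [← Finset.sum_neg_distrib]
    exact Finset.sum_congr rfl fun b _ => by rw [hs b c]; ring
  have h3 : (X * (C.exd V * C.h)).trace = ∑ c, ∑ b, (C.h * X) c b * (C.Dv b V c - C.Dv c V b) := by
    rw [← mul_assoc, Matrix.trace_mul_comm, ← mul_assoc]
    rfl
  rw [h1, h3]
  simp only [mul_sub, Finset.sum_sub_distrib, h2]
  ring

/-- For divergence-free `Y` the tensor may be moved under the divergence; this relates the two forms
of the Carter operator. -/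
lemma Skew.dvg_mulVec_eq {Y : Mat A} (hY : C.Skew Y) (hdiv : C.divM Y = 0) (V : Cov A) :
    C.dvg (Y *ᵥ V) = ∑ c, C.ip (Y *ᵥ C.Dv c V) (δ c) := by
  have e1 : ∑ c, C.ip (C.Dm c Y *ᵥ V) (δ c) = -C.ip V (C.divM Y) := by
    rw [divM, ip_sum_right, ← Finset.sum_neg_distrib]
    exact Finset.sum_congr rfl fun c _ => (hY.Dm c).ip_mulVec _ _
  rw [dvg_eq]
  simp only [Dv_mulVec, ip_add_left, Finset.sum_add_distrib, e1, hdiv]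
  simp [ip]

end Calc

lemma up2_eq {gt : Tens2} {x : E4} (hh : (at2 (ginv gt) x)ᵀ = at2 (ginv gt) x) (T : Tens2) :
    at2 (up2 gt T) x = at2 (ginv gt) x * (at2 T x * at2 (ginv gt) x) := by
  ext a b
  rw [Matrix.mul_apply, at2, Matrix.of_apply, up2]
  refine Finset.sum_congr rfl fun c _ => ?_
  rw [Matrix.mul_apply, Finset.mul_sum]
  refine Finset.sum_congr rfl fun d _ => ?_
  have : at2 (ginv gt) x d b = ginv gt b d x := congrFun (congrFun hh b) d
  rw [this]
  simp only [at2, Matrix.of_apply]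
  ring

/-- Contraction of a two-form with a covariant derivative. -/
lemma SmoothMetric.sum_up2 {U : TopologicalSpace.Opens E4} {gt : Tens2} (hm : SmoothMetric U gt)
    {x : U} {X : Mat (Smooth U)} {T : Tens2} (hX : evM x X = at2 T x * at2 (ginv gt) x)
    {V : Cov (Smooth U)} {Vt : Tens1} (hV : ∀ b, Represents (V b) (Vt b)) :
    ∑ a, ∑ b, up2 gt T a b x * cov1 gt Vt a b x
      = ev x (∑ c, hm.toCalc.ip (X *ᵥ hm.toCalc.Dv c V) (Calc.δ c)) := by
  rw [map_sum]
  refine Finset.sum_congr rfl fun a _ => ?_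
  have h1 : evM x (hm.hA * X) = at2 (up2 gt T) x := by
    rw [up2_eq (hm.ginv_transpose x), map_mul, hm.evM_h, hX]
  have h2 : hm.toCalc.ip (X *ᵥ hm.toCalc.Dv a V) (Calc.δ a)
      = ((hm.hA * X) *ᵥ hm.toCalc.Dv a V) a := by
    rw [Calc.ip_δ, Matrix.mulVec_mulVec]; rfl
  rw [h2, ev_mulVec, h1]
  exact Finset.sum_congr rfl fun b _ => congrArg _ ((hm.rep_Dv hV a b).ev x).symm

/-! ### The symmetry operator in a chart -/

namespace Background

variable {M : Type*} [TopologicalSpace M] [ChartedSpace E4 M] {S : Spacetime M} {k : ℂ}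
  {D : TypeDStructure S k} {e : OpenPartialHomeomorph M E4} {lam : ℝ} (B : Background D e lam)

/-- A constant function. -/
def cst (e : OpenPartialHomeomorph M E4) (c : ℂ) : Smooth (chartTarget e) := algebraMap ℂ _ c

lemma ev_cst (x : chartTarget e) (c : ℂ) : ev x (cst e c) = c := rfl

lemma pa_cst (c : ℂ) (a : Fin 4) : B.hm.toCalc.pa a (cst e c) = 0 := (pa a).map_algebraMap c

/-- The one-form `Y_b^c ∇_c f`. -/
def V (Φ : Smooth (chartTarget e)) : Cov (Smooth (chartTarget e)) := B.Y *ᵥ B.hm.toCalc.grd Φ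

lemma V_eq (Φ : Smooth (chartTarget e)) : B.V Φ = cst e (Complex.I / 2)
    • ((B.κ • B.j - B.κ' • B.j') *ᵥ B.hm.toCalc.grd Φ) := by
  rw [V, Y, Matrix.smul_mulVec]; rfl

variable {f : M → ℂ} {Φ : Smooth (chartTarget e)}

lemma rep_V {F : E4 → ℂ} (hf : Represents Φ F) (b : Fin 4) :
    Represents (B.V Φ b) (D.Ygrad e F b) :=
  Represents.sum fun c => (B.rep_Y b c).mul (B.hm.rep_grd hf c)

/-- The dual of the Killing–Yano form with its second index raised. -/
def starY : Mat (Smooth (chartTarget e)) := cst e (1 / 2) • (B.κ • B.j + B.κ' • B.j')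

lemma ev_starY (x : chartTarget e) :
    evM x B.starY = at2 (D.starY e) x * at2 (ginv (S.g e)) x := by
  rw [B.at2_starY_mul, starY, evM_smul, map_add, ev_cst]

/-- The two-form `∇_a (Y_b^c ∇_c f) - ∇_b (Y_a^c ∇_c f)` up to a factor, with its second index
raised. -/
def T (Φ : Smooth (chartTarget e)) : Mat (Smooth (chartTarget e)) :=
  B.hm.toCalc.exd ((B.κ • B.j - B.κ' • B.j') *ᵥ B.hm.toCalc.grd Φ) * B.hm.hA

lemma exd_V (Φ : Smooth (chartTarget e)) :
    B.hm.toCalc.exd (B.V Φ) * B.hm.hA = cst e (Complex.I / 2) • B.T Φ := by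
  rw [V_eq, Calc.exd_const_smul (B.pa_cst _), T, Matrix.smul_mul]

/-- The symmetry operator in the ring of smooth functions. -/
def symOp (Φ : Smooth (chartTarget e)) : Smooth (chartTarget e) :=
  cst e (-1 / 8) * (B.κ * (2 * (B.j * B.T Φ).trace + 8 * (B.Ψ - B.Ψ') * Φ * B.κ))

lemma ev_im (x : chartTarget e) :
    (((D.Ψ₂ (e.symm x)).im : ℝ) : ℂ) = -(Complex.I / 2) * (ev x B.Ψ - ev x B.Ψ') := by
  rw [B.rep_Ψ.ev, B.rep_Ψ'.ev, Complex.im_eq_sub_conj, div_eq_iff (by simp)]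
  linear_combination (D.Ψ₂ (e.symm x) - conj (D.Ψ₂ (e.symm x))) * Complex.I_mul_I

/-- The self-dual parts cancel in `Y + i *Y = i κ j`, so the operator is `-1/4` of `κ tr (j T)`
minus `κ² (Ψ - Ψ') Φ`. This is `-1/8` times the function to which `IsTypeD.symmetry_operator`
applies. -/
lemma rep_symOp (hf : Represents Φ (f ∘ e.symm)) : Represents (B.symOp Φ) (D.symOpIn e f) := by
  intro x
  have hV := B.rep_V hf
  have h1 := B.hm.sum_up2 (B.at2_Y_mul x).symm hV
  have h2 := B.hm.sum_up2 (B.ev_starY x) hV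
  have h3 := congrArg (ev x) (B.isTypeD.skew.two_mul_sum_ip (B.V Φ))
  have h4 : ∀ c, B.hm.toCalc.ip (B.Y *ᵥ B.hm.toCalc.Dv c (B.V Φ)) (Calc.δ c)
      + cst e Complex.I * B.hm.toCalc.ip (B.starY *ᵥ B.hm.toCalc.Dv c (B.V Φ)) (Calc.δ c)
      = cst e Complex.I * (B.κ * B.hm.toCalc.ip (B.j *ᵥ B.hm.toCalc.Dv c (B.V Φ)) (Calc.δ c)) := by
    intro c
    have e1 : B.Y + cst e Complex.I • B.starY = (cst e Complex.I * B.κ) • B.j := evM_ext fun x => by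
      simp only [starY, map_add, map_mul, evM_smul, ev_Y, ev_cst]
      module
    rw [← Calc.ip_smul_left, ← Matrix.smul_mulVec, ← Calc.ip_add_left, ← Matrix.add_mulVec, e1,
      Matrix.smul_mulVec, Calc.ip_smul_left, mul_assoc]
  have h5 : (∑ a, ∑ b, (up2 (S.g e) (D.Y e) a b x + Complex.I * up2 (S.g e) (D.starY e) a b x)
      * cov1 (S.g e) (D.Ygrad e (f ∘ e.symm)) a b x)
      = Complex.I * (ev x B.κ * ev x (∑ c, B.hm.toCalc.ip (B.j *ᵥ B.hm.toCalc.Dv c (B.V Φ))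
        (Calc.δ c))) := by
    have e1 := congrArg (ev x) (Finset.sum_congr rfl fun c (_ : c ∈ Finset.univ) => h4 c)
    rw [Finset.sum_add_distrib, ← Finset.mul_sum, ← Finset.mul_sum, ← Finset.mul_sum, map_add,
      map_mul, ← h1, ← h2, map_mul, map_mul, ev_cst] at e1
    rw [← e1, Finset.mul_sum, ← Finset.sum_add_distrib]
    refine Finset.sum_congr rfl fun a _ => ?_
    rw [Finset.mul_sum, ← Finset.sum_add_distrib]
    exact Finset.sum_congr rfl fun b _ => by ring
  have h6 : (B.j * (B.hm.toCalc.exd (B.V Φ) * B.hm.toCalc.h)).trace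
      = cst e (Complex.I / 2) * (B.j * B.T Φ).trace := by
    have : B.hm.toCalc.exd (B.V Φ) * B.hm.toCalc.h = cst e (Complex.I / 2) • B.T Φ := B.exd_V Φ
    rw [this, Matrix.mul_smul, Matrix.trace_smul, smul_eq_mul]
  rw [h6, map_mul, map_neg, map_mul, ev_cst, map_ofNat] at h3
  rw [TypeDStructure.symOpIn, h5, B.ev_im]
  have h7 : ev x B.κ = k * (D.ζ (e.symm x))⁻¹ := B.rep_κ.ev x
  -- Here `Im Ψ₂ = -(i/2)(Ψ - Ψ')` and `k ζ⁻¹ = κ`, so the potential term has coefficient one for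
  -- every `k`.
  have h8 : 8 * Complex.I * (k / 2) ^ 2 * (-(Complex.I / 2) * (ev x B.Ψ - ev x B.Ψ'))
      * (D.ζ (e.symm x) ^ 2)⁻¹ * f (e.symm x)
      = ev x B.κ ^ 2 * (ev x B.Ψ - ev x B.Ψ') * ev x Φ := by
    rw [h7, hf.ev x, mul_pow, inv_pow, Function.comp_apply]
    linear_combination (-k ^ 2 * (ev x B.Ψ - ev x B.Ψ') * (D.ζ (e.symm x) ^ 2)⁻¹ * f (e.symm x))
      * Complex.I_mul_I
  rw [h8, ← ev_apply, symOp]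
  simp only [map_mul, map_add, map_sub, ev_cst, map_ofNat]
  linear_combination (Complex.I / 2 * ev x B.κ) * h3
    - (1 / 4 * ev x B.κ * ev x (B.j * B.T Φ).trace) * Complex.I_mul_I

/-- A solution of the conjugate Fackerell–Ipser equation in a chart. -/
lemma bx_eq (hf : Represents Φ (f ∘ e.symm)) (hbox : ∀ x ∈ e.target,
    box (S.g e) (f ∘ e.symm) x + (2 * conj (D.Ψ₂ (e.symm x)) + 2 / 3 * lam) * f (e.symm x) = 0) :
    B.hm.toCalc.bx Φ = -2 * (B.Ψ' + algebraMap ℂ _ ((lam : ℂ) / 3)) * Φ := ext_ev fun x => by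
  have h1 := hbox x x.2
  rw [(B.hm.rep_bx hf).ev, map_mul, map_mul, map_add, map_neg, map_ofNat, ev_algebraMap, hf.ev,
    B.rep_Ψ'.ev]
  simp only [Function.comp_apply]
  linear_combination h1

/-- The symmetry operator in a chart maps solutions to solutions. -/
theorem bx_symOp (hΦ : B.hm.toCalc.bx Φ = -2 * (B.Ψ' + algebraMap ℂ _ ((lam : ℂ) / 3)) * Φ)
    (x : chartTarget e) {F : E4 → ℂ} (hF : Represents (B.symOp Φ) F) :
    box (S.g e) F x + (2 * D.Ψ₂ (e.symm x) + 2 / 3 * lam) * F x = 0 := by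
  have h1 := B.isTypeD.symmetry_operator B.isTypeD' B.pa_κ B.pa_κ' B.real hΦ
    (T := B.T Φ) rfl
  have h2 : B.hm.toCalc.bx (B.symOp Φ)
      = -2 * (B.Ψ + algebraMap ℂ _ ((lam : ℂ) / 3)) * B.symOp Φ := by
    rw [symOp, Calc.bx_const_mul (B.pa_cst _), h1, mul_left_comm]
  have h3 := congrArg (ev x) h2
  rw [(B.hm.rep_bx hF).ev, map_mul, map_mul, map_add, map_neg, map_ofNat, ev_algebraMap, hF.ev,
    B.rep_Ψ.ev] at h3
  linear_combination h3

end Background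

/-! ### Reality and the Maxwell field in a chart -/

lemma evM_dual {U : TopologicalSpace.Opens E4} (x : U) (j T : Mat (Smooth U)) :
    evM x (Calc.dual j T) = Calc.dual (evM x j) (evM x T) := by
  rw [Calc.dual, Calc.dual, map_sub, evM_smul, evM_smul, ev_trace, map_mul, map_mul, map_mul,
    map_ofNat]

namespace TypeDStructure

variable {M : Type*} [TopologicalSpace M] [ChartedSpace E4 M] {S : Spacetime M} {k : ℂ}
  (D : TypeDStructure S k) (e : OpenPartialHomeomorph M E4)

lemma Y_real (a b : Fin 4) (x : E4) : conj (D.Y e a b x) = D.Y e a b x := by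
  simp only [Y, map_sub, map_mul, Complex.conj_I, Complex.conj_conj]
  ring

lemma starY_real (a b : Fin 4) (x : E4) : conj (D.starY e a b x) = D.starY e a b x :=
  hodge_real (S.g_real e) (S.volC_real e) (D.Y_real e) a b x

lemma Ygrad_real {f : E4 → ℂ} (hf : ∀ x, conj (f x) = f x) (a : Fin 4) (x : E4) :
    conj (D.Ygrad e f a x) = D.Ygrad e f a x := by
  simp [Ygrad, upSnd, grad, D.Y_real e, ginv_real (S.g_real e), pd_real hf]

lemma starE_real (w : M → ℝ) (a b : Fin 4) (x : E4) :
    conj (D.starE e w a b x) = D.starE e w a b x := by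
  simp [starE, alt2, D.starY_real e, map_ofNat, cov1_real (S.g_real e)
    (D.Ygrad_real e fun x => Complex.conj_ofReal (w (e.symm x)))]

lemma F_real (u v : M → ℝ) (a b : Fin 4) (x : E4) : conj (D.F u v e a b x) = D.F u v e a b x := by
  rw [F, EForm, map_sub, map_neg, hodge_real (S.g_real e) (S.volC_real e) (D.starE_real e u),
    D.starE_real]

end TypeDStructure

namespace Background

variable {M : Type*} [TopologicalSpace M] [ChartedSpace E4 M] {S : Spacetime M} {k : ℂ}
  {D : TypeDStructure S k} {e : OpenPartialHomeomorph M E4} {lam : ℝ} (B : Background D e lam)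

/-- A two-form with its second index raised, in the ring of smooth functions. -/
structure Mixed (X : Mat (Smooth (chartTarget e))) (T : Tens2) : Prop where
  skew : B.hm.toCalc.Skew X
  eq : ∀ x : chartTarget e, at2 T x * at2 (ginv (S.g e)) x = evM x X

namespace Mixed

variable {B} {X X' : Mat (Smooth (chartTarget e))} {T T' : Tens2}

lemma lower (h : B.Mixed X T) (x : chartTarget e) : at2 T x = evM x (X * B.hm.gA) := by
  rw [map_mul, ← h.eq, mul_assoc, B.h_mul_g, mul_one]

lemma rep (h : B.Mixed X T) (a b : Fin 4) : Represents ((X * B.hm.gA) a b) (T a b) := fun x =>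
  (congrFun (congrFun (h.lower x) a) b).symm

lemma transpose (h : B.Mixed X T) (x : chartTarget e) : (at2 T x)ᵀ = -at2 T x := by
  rw [h.lower, ← evM_transpose, B.skew_lower h.skew, evM_neg]

lemma div2_eq (h : B.Mixed X T) (b : Fin 4) (x : chartTarget e) :
    div2 (S.g e) T b x = -ev x (B.hm.toCalc.divM X b) := by
  have h1 := (B.hm.rep_divM h.rep (B.skew_lower h.skew) b).ev x
  have h2 : X * B.hm.gA * B.hm.hA = X := by
    rw [Matrix.mul_assoc, B.hm.gA_mul_hA, Matrix.mul_one]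
  rw [h2, map_neg] at h1
  exact h1.symm

lemma hodge (h : B.Mixed X T) : B.Mixed (cst e (-(Complex.I / 2)) • Calc.dual B.j X)
    (hodge (S.g e) (S.volC e) T) where
  skew := (B.isTypeD.skew_dual h.skew).smul _
  eq x := by rw [B.ev_hodge (h.transpose x), h.eq, evM_smul, evM_dual, ev_cst]

lemma neg (h : B.Mixed X T) : B.Mixed (-X) (fun a b x => -T a b x) where
  skew := h.skew.neg
  eq x := by
    rw [evM_neg, ← h.eq, ← neg_mul]; rfl

lemma sub (h : B.Mixed X T) (h' : B.Mixed X' T') :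
    B.Mixed (X - X') (fun a b x => T a b x - T' a b x) where
  skew := h.skew.sub h'.skew
  eq x := by
    rw [map_sub, ← h.eq, ← h'.eq, ← sub_mul]; rfl

end Mixed

/-- The two-form `*E` of a function, with its second index raised. -/
def starE (W : Smooth (chartTarget e)) : Mat (Smooth (chartTarget e)) :=
  cst e (-Complex.I) • B.T W
    + (cst e (-Complex.I) * (B.Ψ - B.Ψ') * W) • (B.κ • B.j + B.κ' • B.j')

lemma mixed_starE {W : Smooth (chartTarget e)} {w : M → ℝ}
    (hW : Represents W fun x => (w (e.symm x) : ℂ)) : B.Mixed (B.starE W) (D.starE e w) where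
  skew := ((Calc.skew_mul_h (Calc.exd_transpose _)).smul _).add
    (((B.isTypeD.skew.smul _).add (B.isTypeD'.skew.smul _)).smul _)
  eq x := by
    have h1 : at2 (D.starE e w) x = (-2 : ℂ) • evM x (B.hm.toCalc.exd (B.V W))
        + (4 * (((D.Ψ₂ (e.symm x)).im : ℝ) : ℂ) * (w (e.symm x) : ℂ)) • at2 (D.starY e) x := by
      ext a b
      have e1 := (B.hm.rep_Dv (B.rep_V hW) a b).ev x
      have e2 := (B.hm.rep_Dv (B.rep_V hW) b a).ev x
      have e3 : evM x (B.hm.toCalc.exd (B.V W)) a b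
          = ev x (B.hm.toCalc.Dv a (B.V W) b) - ev x (B.hm.toCalc.Dv b (B.V W) a) := rfl
      rw [Matrix.add_apply, Matrix.smul_apply, Matrix.smul_apply, e3, e1, e2]
      simp only [at2, Matrix.of_apply, TypeDStructure.starE, alt2, smul_eq_mul]
      ring
    have h2 : evM x (B.hm.toCalc.exd (B.V W)) * at2 (ginv (S.g e)) x
        = (Complex.I / 2) • evM x (B.T W) := by
      rw [← B.hm.evM_h, ← map_mul, B.exd_V, evM_smul, ev_cst]
    rw [h1, add_mul, Matrix.smul_mul, Matrix.smul_mul, h2, B.at2_starY_mul, B.ev_im, ← hW.ev x,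
      starE]
    simp only [map_add, evM_smul, map_mul, map_sub, ev_cst]
    module

lemma T_add (f k : Smooth (chartTarget e)) : B.T (f + k) = B.T f + B.T k := by
  rw [T, T, T, Calc.grd_add, Matrix.mulVec_add, Calc.exd_add, add_mul]

lemma T_const_mul (c : ℂ) (f : Smooth (chartTarget e)) : B.T (cst e c * f) = cst e c • B.T f := by
  rw [T, T, Calc.grd_const_mul (B.pa_cst c), Matrix.mulVec_smul, Calc.exd_const_smul (B.pa_cst c),
    Matrix.smul_mul]

/-- The map `T ↦ T + dual j T / 2` is twice the projection to anti-self-dual forms: it doubles `j`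
and removes `j'`. The result is the Maxwell field of `IsTypeD.divM_asd` up to a constant. -/
lemma ev_starE_add_dual (W : Smooth (chartTarget e)) (x : chartTarget e) :
    evM x (B.starE W) + (1 / 2 : ℂ) • Calc.dual (evM x B.j) (evM x (B.starE W))
      = (-(Complex.I / 2)) • evM x ((2 : Smooth (chartTarget e)) • B.T W + Calc.dual B.j (B.T W)
        + (4 * (B.Ψ - B.Ψ') * W) • (B.κ • B.j)) := by
  simp only [starE, map_add, evM_smul, evM_dual, map_mul, map_sub, ev_cst, dual_add, dual_smul,
    dual_self (B.j_sq x), dual_conj (B.j_sq x) (B.commute x) (B.trace_mul x), map_ofNat]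
  module

/-- The Maxwell field of a solution in a chart. -/
theorem isMaxwell {U W : Smooth (chartTarget e)} {u v : M → ℝ}
    (hU : Represents U fun x => (u (e.symm x) : ℂ)) (hW : Represents W fun x => (v (e.symm x) : ℂ))
    (hΦ : B.hm.toCalc.bx (U + cst e Complex.I * W)
      = -2 * (B.Ψ' + algebraMap ℂ _ ((lam : ℂ) / 3)) * (U + cst e Complex.I * W)) :
    (∀ a b, ContDiffOn ℝ ∞ (D.F u v e a b) e.target) ∧ ∀ x ∈ e.target, ∀ b,
      div2 (S.g e) (D.F u v e) b x = 0 ∧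
      div2 (S.g e) (hodge (S.g e) (S.volC e) (D.F u v e)) b x = 0 := by
  have hF : B.Mixed _ (D.F u v e) := (B.mixed_starE hU).hodge.neg.sub (B.mixed_starE hW)
  have hsF := hF.hodge
  set X := -(cst e (-(Complex.I / 2)) • Calc.dual B.j (B.starE U)) - B.starE W with hX
  set X' := cst e (-(Complex.I / 2)) • Calc.dual B.j X with hX'
  -- With `** = -1` one has `*F - iF = *E(Φ) + i **E(Φ)` for `Φ = u + iv`, and this is the
  -- projection in `ev_starE_add_dual`.
  have h1 : X' = cst e Complex.I • X + cst e (-(Complex.I / 2)) • ((2 : Smooth (chartTarget e))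
      • B.T (U + cst e Complex.I * W) + Calc.dual B.j (B.T (U + cst e Complex.I * W))
        + (4 * (B.Ψ - B.Ψ') * (U + cst e Complex.I * W)) • (B.κ • B.j)) := evM_ext fun x => by
    have e1 : evM x (B.starE (U + cst e Complex.I * W))
        = evM x (B.starE U) + Complex.I • evM x (B.starE W) := by
      simp only [starE, T_add, T_const_mul, map_add, evM_smul, map_mul, map_sub, ev_cst]
      module
    have e2 : evM x X = (Complex.I / 2) • Calc.dual (evM x B.j) (evM x (B.starE U))
        - evM x (B.starE W) := by
      rw [hX, map_sub, evM_neg, evM_smul, evM_dual, ev_cst]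
      module
    rw [hX', evM_smul, evM_dual, ev_cst, e2, map_add, evM_smul, evM_smul, ev_cst, ev_cst, e2,
      ← B.ev_starE_add_dual, e1, sub_eq_add_neg,
      ← neg_one_smul ℂ (evM x (B.starE W)), dual_add, dual_add, dual_smul, dual_smul, dual_smul,
      dual_dual (B.j_sq x)]
    match_scalars <;> ring_nf <;> simp
  have h2 : B.hm.toCalc.divM X' = cst e Complex.I • B.hm.toCalc.divM X := by
    rw [h1, Calc.divM_add, Calc.divM_const_smul (B.pa_cst _), Calc.divM_const_smul (B.pa_cst _),
      B.isTypeD.divM_asd B.isTypeD' B.pa_κ B.pa_κ' B.real hΦ (T := B.T _) rfl, smul_zero, add_zero]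
  refine ⟨fun a b => (hF.rep a b).contDiffOn, fun x hx b => ?_⟩
  -- The two divergences differ by the factor `i`, but both are real; hence both are zero.
  have h3 : div2 (S.g e) (hodge (S.g e) (S.volC e) (D.F u v e)) b x
      = Complex.I * div2 (S.g e) (D.F u v e) b x := by
    have e1 := hF.div2_eq b ⟨x, hx⟩
    have e2 := hsF.div2_eq b ⟨x, hx⟩
    rw [h2, Pi.smul_apply, smul_eq_mul, map_mul, ev_cst] at e2
    rw [e1, e2, mul_neg]
  have h4 := div2_real (S.g_real e) (D.F_real e u v) b x
  have h5 := div2_real (S.g_real e) (hodge_real (S.g_real e) (S.volC_real e) (D.F_real e u v)) b x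
  rw [h3, map_mul, Complex.conj_I, h4] at h5
  have h6 : div2 (S.g e) (D.F u v e) b x = 0 := by
    have : Complex.I * div2 (S.g e) (D.F u v e) b x = 0 := by linear_combination (-1 / 2) * h5
    exact (mul_eq_zero.mp this).resolve_left Complex.I_ne_zero
  exact ⟨h6, by rw [h3, h6, mul_zero]⟩

end Background

/-! ### The Carter operator in a chart -/

namespace Background

variable {M : Type*} [TopologicalSpace M] [ChartedSpace E4 M] {S : Spacetime M} {k : ℂ}
  {D : TypeDStructure S k} {e : OpenPartialHomeomorph M E4} {lam : ℝ}
  {f : M → ℂ} {Φ : Smooth (chartTarget e)}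

lemma divM_Y (B : Background D e lam) : B.hm.toCalc.divM B.Y = 0 := by
  have h1 := B.isTypeD.divM_Y B.isTypeD' B.pa_κ B.pa_κ' B.real
  have h2 := Calc.divM_const_smul (B.pa_cst (Complex.I / 2)) (B.κ • B.j - B.κ' • B.j')
  rw [h1, smul_zero] at h2
  exact h2

lemma carterYIn_eq (B : Background D e lam) (hf : Represents Φ (f ∘ e.symm))
    (x : chartTarget e) :
    D.carterYIn e f x
      = -ev x (∑ c, B.hm.toCalc.ip (B.Y *ᵥ B.hm.toCalc.Dv c (B.V Φ)) (Calc.δ c)) := by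
  rw [TypeDStructure.carterYIn, B.hm.sum_up2 (B.at2_Y_mul x).symm (B.rep_V hf)]

/-- The two forms of the Carter operator agree. -/
theorem carterIn_eq (B : Background D e lam) (hf : Represents Φ (f ∘ e.symm))
    (x : chartTarget e) :
    D.carterIn e f x = D.carterYIn e f x := by
  have h1 : ∀ a, Represents ((B.hm.hA *ᵥ (B.Y *ᵥ B.V Φ)) a)
      (fun y => ∑ c, D.killingH e a c y * grad (f ∘ e.symm) c y) := by
    intro a y
    have e1 : at2 (up2 (S.g e) (D.Y e)) y = evM y (B.hm.hA * B.Y) := by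
      rw [up2_eq (B.hm.ginv_transpose y), map_mul, B.hm.evM_h, B.at2_Y_mul]
    rw [Matrix.mulVec_mulVec, ← ev_apply, ev_mulVec, ← e1]
    simp only [TypeDStructure.killingH, Finset.sum_mul, Matrix.mulVec, dotProduct]
    rw [Finset.sum_comm]
    refine Finset.sum_congr rfl fun b _ => ?_
    have e2 : ev y (B.V Φ b) = D.Ygrad e (f ∘ e.symm) b y := (B.rep_V hf b).ev y
    rw [e2, TypeDStructure.Ygrad, Finset.mul_sum]
    simp only [mul_assoc]
    rfl
  have h2 := (B.hm.rep_dvg h1).ev x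
  rw [TypeDStructure.carterIn, B.carterYIn_eq hf, ← h2, B.skew_Y.dvg_mulVec_eq B.divM_Y]

/-- In the real case the symmetry operator is the Carter operator. -/
theorem symOpIn_eq_carterYIn (B : Background D e lam) (hk : k.im = 0)
    (hζ : ∀ p, (D.ζ p).im = 0)
    (hf : Represents Φ (f ∘ e.symm)) (x : chartTarget e) :
    D.symOpIn e f x = D.carterYIn e f x := by
  have hk' : conj k = k := Complex.conj_eq_iff_im.mpr hk
  have hζ' : ∀ p, conj (D.ζ p) = D.ζ p := fun p => Complex.conj_eq_iff_im.mpr (hζ p)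
  have hκ : B.κ' = B.κ := ext_ev fun y => by
    rw [B.rep_κ.ev, B.rep_κ'.ev, map_mul, map_inv₀, hζ', hk']
  have hp : B.p' = B.p := funext fun c => ext_ev fun y => by
    rw [(B.rep_p c).ev, (B.rep_p' c).ev, map_mul, map_inv₀, hζ',
      pd_real (F := D.ζ ∘ e.symm) fun z => hζ' _]
  have hjj : B.j * B.j' = B.j' * B.j := evM_ext fun y => by
    rw [map_mul, map_mul, B.commute]
  have hΨ : (D.Ψ₂ (e.symm x)).im = 0 := by
    rw [← Complex.conj_eq_iff_im, TypeDStructure.Ψ₂, map_pow, hζ']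
  have h1 := B.isTypeD.carter (hp ▸ B.isTypeD') B.pa_κ hjj Φ
  have h2 : ∑ c, B.hm.toCalc.ip (B.starY *ᵥ B.hm.toCalc.Dv c (B.V Φ)) (Calc.δ c) = 0 := by
    rw [V_eq, starY, hκ]
    simp only [Calc.Dv_const_smul (B.pa_cst _), Matrix.smul_mulVec, Matrix.mulVec_smul,
      Calc.ip_smul_left, ← Finset.mul_sum, h1, mul_zero]
  have h3 := B.hm.sum_up2 (B.ev_starY x) (B.rep_V hf)
  rw [h2, map_zero] at h3
  rw [TypeDStructure.symOpIn, TypeDStructure.carterYIn, hΨ]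
  simp only [add_mul, Finset.sum_add_distrib, mul_assoc, ← Finset.mul_sum, h3]
  simp

end Background

/-! ### Changes of coordinates -/

/-- The Jacobian matrix `∂_a t^c` of a map of coordinate spaces; the first index is `c`. -/
def jacobian (t : E4 → E4) (x : E4) : Mat ℂ :=
  Matrix.of fun c a => ((fderiv ℝ t x (EuclideanSpace.single a 1) c : ℝ) : ℂ)

lemma conjMat_jacobian (t : E4 → E4) (x : E4) : conjMat (jacobian t x) = jacobian t x := by
  ext c a
  exact Complex.conj_ofReal _

lemma pd_ofReal_apply {t : E4 → E4} {x : E4} (ht : DifferentiableAt ℝ t x) (a c : Fin 4) :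
    pd a (fun y => ((t y c : ℝ) : ℂ)) x = jacobian t x c a := by
  have h1 : HasFDerivAt (fun y => ((t y c : ℝ) : ℂ))
      ((Complex.ofRealCLM.comp (EuclideanSpace.proj c : E4 →L[ℝ] ℝ)).comp (fderiv ℝ t x)) x :=
    (Complex.ofRealCLM.comp (EuclideanSpace.proj c : E4 →L[ℝ] ℝ)).hasFDerivAt.comp x
      ht.hasFDerivAt
  rw [pd, h1.fderiv]
  rfl

lemma clm_apply_eq_sum {F : Type*} [NormedAddCommGroup F] [NormedSpace ℝ F] (L : E4 →L[ℝ] F)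
    (v : E4) : L v = ∑ c, v c • L (EuclideanSpace.single c (1 : ℝ)) := by
  have h1 : v = ∑ c, v c • EuclideanSpace.single c (1 : ℝ) := by
    ext i
    simp [Pi.single_apply]
  conv_lhs => rw [h1]
  simp only [map_sum, map_smul]

/-- The chain rule. -/
lemma pd_comp {t : E4 → E4} {x : E4} (ht : DifferentiableAt ℝ t x) {G : E4 → ℂ}
    (hG : DifferentiableAt ℝ G (t x)) (a : Fin 4) :
    pd a (G ∘ t) x = ∑ c, jacobian t x c a * pd c G (t x) := by
  rw [pd, fderiv_comp x hG ht, ContinuousLinearMap.comp_apply, clm_apply_eq_sum]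
  exact Finset.sum_congr rfl fun c _ => Complex.real_smul

lemma pd_mul {F G : E4 → ℂ} {x : E4} (hF : DifferentiableAt ℝ F x) (hG : DifferentiableAt ℝ G x)
    (a : Fin 4) : pd a (fun y => F y * G y) x = pd a F x * G x + F x * pd a G x := by
  rw [pd, fderiv_fun_mul hF hG]
  simp [pd]
  ring

lemma pd_sum {F : Fin 4 → E4 → ℂ} {x : E4} (hF : ∀ c, DifferentiableAt ℝ (F c) x)
    (a : Fin 4) : pd a (fun y => ∑ c, F c y) x = ∑ c, pd a (F c) x := by
  rw [pd, fderiv_fun_sum fun c _ => hF c]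
  simp [pd]

/-- The components `∂_a V_b - ∂_b V_a` of the exterior derivative. -/
def ext1 (V : Tens1) : Tens2 := fun a b x => pd a (V b) x - pd b (V a) x

/-- The exterior derivative commutes with changes of coordinates. -/
lemma ext1_pullback {U : TopologicalSpace.Opens E4} {t : E4 → E4} (ht : ContDiffOn ℝ ∞ t U)
    {V V' : Tens1} (x : U) (hV' : ∀ b, DifferentiableAt ℝ (V' b) (t x))
    (hV : ∀ (y : U) b, V b y = ∑ d, jacobian t y d b * V' d (t y)) :
    at2 (ext1 V) x = (jacobian t x)ᵀ * at2 (ext1 V') (t x) * jacobian t x := by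
  have htc : ∀ c, ContDiffOn ℝ ∞ (fun y => ((t y c : ℝ) : ℂ)) U := fun c =>
    (Complex.ofRealCLM.comp (EuclideanSpace.proj c : E4 →L[ℝ] ℝ)).contDiff.comp_contDiffOn ht
  have htd : ∀ y : U, DifferentiableAt ℝ t y := fun y =>
    ((ht y y.2).contDiffAt (U.isOpen.mem_nhds y.2)).differentiableAt (by simp)
  have h1 : ∀ a b, pd a (V b) x = ∑ d, (pd a (pd b fun y => ((t y d : ℝ) : ℂ)) x * V' d (t x)
      + jacobian t x d b * ∑ c, jacobian t x c a * pd c (V' d) (t x)) := by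
    intro a b
    have e1 : pd a (V b) x
        = pd a (fun y => ∑ d, pd b (fun y => ((t y d : ℝ) : ℂ)) y * (V' d ∘ t) y) x :=
      pd_congr (fun y => by
        rw [hV y b]
        exact Finset.sum_congr rfl fun d _ => by rw [pd_ofReal_apply (htd y)]; rfl) a x
    have e2 : ∀ d, DifferentiableAt ℝ (pd b fun y => ((t y d : ℝ) : ℂ)) x := fun d =>
      differentiableAt_of_contDiffOn (contDiffOn_pd (htc d) b) x
    have e3 : ∀ d, DifferentiableAt ℝ (V' d ∘ t) x := fun d => (hV' d).comp _ (htd x)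
    have e4 : ∀ d, DifferentiableAt ℝ
        (fun y => pd b (fun y => ((t y d : ℝ) : ℂ)) y * (V' d ∘ t) y) x := fun d =>
      (e2 d).mul (e3 d)
    rw [e1, pd_sum e4]
    refine Finset.sum_congr rfl fun d _ => ?_
    rw [pd_mul (e2 d) (e3 d), pd_comp (htd x) (hV' d), pd_ofReal_apply (htd x)]
    rfl
  ext a b
  -- The second derivatives of `t` are symmetric and cancel in the exterior derivative; the
  -- Christoffel symbols never have to be transformed.
  have h2 : at2 (ext1 V) x a b = ∑ d, ∑ c, (jacobian t x d b * jacobian t x c a * pd c (V' d) (t x)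
      - jacobian t x d a * jacobian t x c b * pd c (V' d) (t x)) := by
    rw [at2, Matrix.of_apply, ext1, h1, h1, ← Finset.sum_sub_distrib]
    refine Finset.sum_congr rfl fun d _ => ?_
    rw [Finset.sum_sub_distrib, pd_pd_comm (htc d) a b x, Finset.mul_sum, Finset.mul_sum]
    simp only [mul_assoc]
    ring
  rw [h2]
  simp only [Finset.sum_sub_distrib, Matrix.mul_apply, Matrix.transpose_apply, at2,
    Matrix.of_apply, ext1, Finset.sum_mul, mul_sub, sub_mul]
  congr 1
  · exact Finset.sum_congr rfl fun d _ => Finset.sum_congr rfl fun c _ => by ring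
  · rw [Finset.sum_comm]
    exact Finset.sum_congr rfl fun d _ => Finset.sum_congr rfl fun c _ => by ring

section Transition

variable {M : Type*} [TopologicalSpace M] [ChartedSpace E4 M]

/-- The coordinates of the overlap of two charts. -/
def overlap (e e' : OpenPartialHomeomorph M E4) : TopologicalSpace.Opens E4 :=
  ⟨(e.symm.trans e').source, (e.symm.trans e').open_source⟩

variable {e e' : OpenPartialHomeomorph M E4}

lemma mem_target (x : overlap e e') : (x : E4) ∈ e.target := x.2.1

lemma mem_source (x : overlap e e') : e.symm x ∈ e'.source := x.2.2

lemma symm_transition (x : overlap e e') : e'.symm (e' (e.symm x)) = e.symm x :=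
  e'.left_inv (mem_source x)

variable [IsManifold (𝓡 4) ∞ M]

lemma contDiffOn_transition (he : e ∈ coords M) (he' : e' ∈ coords M) :
    ContDiffOn ℝ ∞ (e' ∘ e.symm) (overlap e e') :=
  contMDiffOn_iff_contDiffOn.mp ((contMDiffOn_of_mem_maximalAtlas he').comp
    ((contMDiffOn_symm_of_mem_maximalAtlas he).mono fun _ hx => hx.1) fun _ hx => hx.2)

lemma differentiableAt_transition (he : e ∈ coords M) (he' : e' ∈ coords M) (x : overlap e e') :
    DifferentiableAt ℝ (e' ∘ e.symm) x :=
  (((contDiffOn_transition he he') x x.2).contDiffAt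
    ((overlap e e').isOpen.mem_nhds x.2)).differentiableAt (by simp)

/-- Coordinate vectors of two charts. -/
lemma coordVec_eq (he : e ∈ coords M) (he' : e' ∈ coords M) (x : overlap e e') (a : Fin 4) :
    (coordVec e x a : E4) = ∑ c, (fderiv ℝ (e' ∘ e.symm) x (EuclideanSpace.single a 1) c)
      • (coordVec e' ((e' ∘ e.symm) x) c : E4) := by
  have h1 : (e.symm : E4 → M) =ᶠ[nhds (x : E4)] e'.symm ∘ (e' ∘ e.symm) :=
    Filter.eventuallyEq_of_mem ((overlap e e').isOpen.mem_nhds x.2) fun y hy =>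
      (symm_transition ⟨y, hy⟩).symm
  have ht := differentiableAt_transition he he' x
  have hy : (e' ∘ e.symm) x ∈ e'.target := e'.map_source (mem_source x)
  have hs : MDifferentiableAt (𝓡 4) (𝓡 4) e'.symm ((e' ∘ e.symm) x) :=
    ((contMDiffOn_symm_of_mem_maximalAtlas he').contMDiffAt
      (e'.open_target.mem_nhds hy)).mdifferentiableAt (by simp)
  have h2 : (mfderiv (𝓡 4) (𝓡 4) e.symm (x : E4) : E4 →L[ℝ] E4)
      = (mfderiv (𝓡 4) (𝓡 4) e'.symm ((e' ∘ e.symm) x) : E4 →L[ℝ] E4).comp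
        (fderiv ℝ (e' ∘ e.symm) x) := by
    have e1 : (mfderiv (𝓡 4) (𝓡 4) e.symm (x : E4) : E4 →L[ℝ] E4)
        = (mfderiv (𝓡 4) (𝓡 4) (e'.symm ∘ (e' ∘ e.symm)) (x : E4) : E4 →L[ℝ] E4) :=
      h1.mfderiv_eq
    have e2 := mfderiv_comp (x : E4) hs ht.mdifferentiableAt
    rw [e1]
    refine e2.trans ?_
    rw [mfderiv_eq_fderiv]
    rfl
  have h3 : (coordVec e x a : E4) = (mfderiv (𝓡 4) (𝓡 4) e'.symm ((e' ∘ e.symm) x) : E4 →L[ℝ] E4)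
      (fderiv ℝ (e' ∘ e.symm) x (EuclideanSpace.single a 1)) :=
    congrArg (fun L : E4 →L[ℝ] E4 => L (EuclideanSpace.single a 1)) h2
  exact h3.trans (clm_apply_eq_sum (F := E4)
    (mfderiv (𝓡 4) (𝓡 4) e'.symm ((e' ∘ e.symm) x) : E4 →L[ℝ] E4) _)

end Transition

variable {M : Type*} [TopologicalSpace M] [ChartedSpace E4 M] [IsManifold (𝓡 4) ∞ M]
  {e e' : OpenPartialHomeomorph M E4}

lemma clm_apply_sum_sum {N : Type*} [NormedAddCommGroup N] [NormedSpace ℝ N]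
    (q : E4 →L[ℝ] E4 →L[ℝ] N) (r s : Fin 4 → ℝ) (w : Fin 4 → E4) :
    q (∑ c, r c • w c) (∑ d, s d • w d) = ∑ c, ∑ d, (r c * s d) • q (w c) (w d) := by
  simp only [map_sum, map_smul, _root_.sum_apply, _root_.smul_apply, Finset.smul_sum, smul_smul]
  rw [Finset.sum_comm]
  simp only [mul_comm]

/-- The components of a bilinear form in two charts. -/
lemma bilin_transform {N : Type*} [NormedAddCommGroup N] [NormedSpace ℝ N]
    (Q : ∀ p : M, TangentSpace (𝓡 4) p →L[ℝ] TangentSpace (𝓡 4) p →L[ℝ] N) (he : e ∈ coords M)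
    (he' : e' ∈ coords M) (x : overlap e e') (a b : Fin 4) :
    Q (e.symm x) (coordVec e x a) (coordVec e x b)
      = ∑ c, ∑ d, (fderiv ℝ (e' ∘ e.symm) x (EuclideanSpace.single a 1) c
          * fderiv ℝ (e' ∘ e.symm) x (EuclideanSpace.single b 1) d)
        • Q (e'.symm ((e' ∘ e.symm) x)) (coordVec e' ((e' ∘ e.symm) x) c)
          (coordVec e' ((e' ∘ e.symm) x) d) := by
  let Q' : M → E4 →L[ℝ] E4 →L[ℝ] N := Q
  have h0 : Q' (e'.symm ((e' ∘ e.symm) x)) = Q' (e.symm x) :=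
    congrArg Q' (symm_transition x)
  have h1 : Q' (e.symm x) (coordVec e x a : E4) (coordVec e x b : E4)
      = ∑ c, ∑ d, (fderiv ℝ (e' ∘ e.symm) x (EuclideanSpace.single a 1) c
          * fderiv ℝ (e' ∘ e.symm) x (EuclideanSpace.single b 1) d)
        • Q' (e'.symm ((e' ∘ e.symm) x)) (coordVec e' ((e' ∘ e.symm) x) c : E4)
          (coordVec e' ((e' ∘ e.symm) x) d : E4) := by
    rw [h0, coordVec_eq he he' x a, coordVec_eq he he' x b]
    exact clm_apply_sum_sum (Q' (e.symm x)) _ _ fun c => coordVec e' ((e' ∘ e.symm) x) c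
  exact h1

lemma at2_transform {T T' : Tens2} {J : Mat ℂ} {x y : E4}
    (h : ∀ a b, T a b x = ∑ c, ∑ d, J c a * J d b * T' c d y) :
    at2 T x = Jᵀ * at2 T' y * J := by
  ext a b
  rw [at2, Matrix.of_apply, h, Finset.sum_comm]
  simp only [Matrix.mul_apply, Matrix.transpose_apply, at2, Matrix.of_apply, Finset.sum_mul]
  exact Finset.sum_congr rfl fun d _ => Finset.sum_congr rfl fun c _ => by ring

lemma Spacetime.g_transform (S : Spacetime M) (he : e ∈ coords M) (he' : e' ∈ coords M)
    (x : overlap e e') :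
    at2 (S.g e) x = (jacobian (e' ∘ e.symm) x)ᵀ * at2 (S.g e') ((e' ∘ e.symm) x)
      * jacobian (e' ∘ e.symm) x :=
  at2_transform fun a b => by
    rw [Spacetime.g, bilin_transform S.metric he he' x a b]
    simp only [smul_eq_mul, Complex.ofReal_sum, Complex.ofReal_mul]
    rfl

namespace TypeDStructure

variable {S : Spacetime M} {k : ℂ} (D : TypeDStructure S k)

lemma KC_transform (he : e ∈ coords M) (he' : e' ∈ coords M) (x : overlap e e') :
    at2 (D.KC e) x = (jacobian (e' ∘ e.symm) x)ᵀ * at2 (D.KC e') ((e' ∘ e.symm) x)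
      * jacobian (e' ∘ e.symm) x :=
  at2_transform fun a b => by
    rw [KC, bilin_transform D.K he he' x a b]
    simp only [Complex.real_smul, Complex.ofReal_mul]
    rfl

lemma at2_Y_eq (e : OpenPartialHomeomorph M E4) (x : E4) :
    at2 (D.Y e) x = Complex.I • at2 (D.KC e) x - Complex.I • conjMat (at2 (D.KC e) x) := rfl

lemma Y_transform (he : e ∈ coords M) (he' : e' ∈ coords M) (x : overlap e e') :
    at2 (D.Y e) x = (jacobian (e' ∘ e.symm) x)ᵀ * at2 (D.Y e') ((e' ∘ e.symm) x)
      * jacobian (e' ∘ e.symm) x := by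
  have hJ : conjMat (jacobian (e' ∘ e.symm) x)ᵀ = (jacobian (e' ∘ e.symm) x)ᵀ :=
    congrArg Matrix.transpose (conjMat_jacobian (e' ∘ e.symm) x)
  rw [at2_Y_eq, at2_Y_eq, D.KC_transform he he' x, map_mul, map_mul, hJ, conjMat_jacobian, mul_sub,
    sub_mul, Matrix.mul_smul, Matrix.mul_smul, Matrix.smul_mul, Matrix.smul_mul]

/-- The Jacobian is invertible because the metric is nondegenerate in the first chart, so the
transformation law of `g` can be inverted. -/
lemma ginv_transform (D : TypeDStructure S k) (he : e ∈ coords M) (he' : e' ∈ coords M)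
    (x : overlap e e') :
    jacobian (e' ∘ e.symm) x * at2 (ginv (S.g e)) x * (jacobian (e' ∘ e.symm) x)ᵀ
      = at2 (ginv (S.g e')) ((e' ∘ e.symm) x) := by
  have h1 := S.g_transform he he' x
  have h2 : (at2 (S.g e) x).det ≠ 0 := (D.smoothMetric he).det_ne_zero ⟨x, mem_target x⟩
  have h3 : at2 (ginv (S.g e)) x = (at2 (S.g e) x)⁻¹ := rfl
  have h4 : at2 (ginv (S.g e')) ((e' ∘ e.symm) x) = (at2 (S.g e') ((e' ∘ e.symm) x))⁻¹ := rfl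
  have h5 : IsUnit (jacobian (e' ∘ e.symm) x).det := by
    rw [h1, Matrix.det_mul] at h2
    exact (right_ne_zero_of_mul h2).isUnit
  have h6 : IsUnit ((jacobian (e' ∘ e.symm) x)ᵀ).det := by rwa [Matrix.det_transpose]
  rw [h3, h4, h1, Matrix.mul_inv_rev, Matrix.mul_inv_rev, ← mul_assoc, Matrix.mul_nonsing_inv _ h5,
    one_mul, mul_assoc, Matrix.nonsing_inv_mul _ h6, mul_one]

lemma Ygrad_eq (e : OpenPartialHomeomorph M E4) (F : E4 → ℂ) (b : Fin 4) (x : E4) :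
    D.Ygrad e F b x = ((at2 (D.Y e) x * at2 (ginv (S.g e)) x) *ᵥ fun c => pd c F x) b := rfl

lemma Ygrad_transform (he : e ∈ coords M) (he' : e' ∈ coords M) {f : M → ℂ}
    (hf : ContMDiff (𝓡 4) 𝓘(ℝ, ℂ) ∞ f) (x : overlap e e') (b : Fin 4) :
    D.Ygrad e (f ∘ e.symm) b x = ∑ d, jacobian (e' ∘ e.symm) x d b
      * D.Ygrad e' (f ∘ e'.symm) d ((e' ∘ e.symm) x) := by
  have h1 : (fun c => pd c (f ∘ e.symm) x) = (jacobian (e' ∘ e.symm) x)ᵀ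
      *ᵥ fun c => pd c (f ∘ e'.symm) ((e' ∘ e.symm) x) := by
    funext c
    have e1 : pd c (f ∘ e.symm) x = pd c ((f ∘ e'.symm) ∘ (e' ∘ e.symm)) x :=
      pd_congr (U := overlap e e') (fun y => (congrArg f (symm_transition y)).symm) c x
    rw [e1, pd_comp (differentiableAt_transition he he' x)
      (differentiableAt_of_contDiffOn (U := chartTarget e') (contDiffOn_comp_symm hf he')
        ⟨(e' ∘ e.symm) x, e'.map_source (mem_source x)⟩)]
    rfl
  have h2 : ∀ J h h' Y' : Mat ℂ, J * h * Jᵀ = h' → Jᵀ * Y' * J * h * Jᵀ = Jᵀ * (Y' * h') := by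
    rintro J h h' Y' rfl
    simp only [mul_assoc]
  rw [Ygrad_eq, h1, D.Y_transform he he' x, Matrix.mulVec_mulVec,
    h2 _ _ _ _ (ginv_transform D he he' x), ← Matrix.mulVec_mulVec]
  rfl

end TypeDStructure

namespace Background

variable {S : Spacetime M} {k : ℂ} {D : TypeDStructure S k} {lam : ℝ} {f : M → ℂ}

/-- The symmetry operator in terms of an exterior derivative. -/
lemma symOpIn_eq (B : Background D e lam) {Φ : Smooth (chartTarget e)}
    (hf : Represents Φ (f ∘ e.symm)) (x : chartTarget e) :
    D.symOpIn e f x = Complex.I * (at2 (D.KC e) x * at2 (ginv (S.g e)) x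
        * (at2 (ext1 (D.Ygrad e (f ∘ e.symm))) x * at2 (ginv (S.g e)) x)).trace
      - (D.Ψ₂ (e.symm x) - conj (D.Ψ₂ (e.symm x))) * (k * (D.ζ (e.symm x))⁻¹) ^ 2
        * f (e.symm x) := by
  have h1 : at2 (ext1 (D.Ygrad e (f ∘ e.symm))) x = evM x (B.hm.toCalc.exd (B.V Φ)) := by
    ext a b
    have e1 := (B.hm.rep_Dv (B.rep_V hf) a b).ev x
    have e2 := (B.hm.rep_Dv (B.rep_V hf) b a).ev x
    have e3 : evM x (B.hm.toCalc.exd (B.V Φ)) a b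
        = ev x (B.hm.toCalc.Dv a (B.V Φ) b) - ev x (B.hm.toCalc.Dv b (B.V Φ) a) := rfl
    -- The Christoffel terms are symmetric and cancel in the antisymmetrised covariant derivative.
    have e4 : ∀ c, christoffel (S.g e) c a b x = christoffel (S.g e) c b a x := fun c => by
      simp only [christoffel]
      congr 1
      refine Finset.sum_congr rfl fun d _ => ?_
      have : S.g e a b = S.g e b a := funext fun y => S.g_symm e a b y
      rw [this]
      ring
    rw [e3, e1, e2, cov1, cov1]
    simp only [e4, at2, ext1, Matrix.of_apply]
    ring
  have h2 : at2 (ext1 (D.Ygrad e (f ∘ e.symm))) x * at2 (ginv (S.g e)) x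
      = (Complex.I / 2) • evM x (B.T Φ) := by
    rw [h1, ← B.hm.evM_h, ← map_mul, B.exd_V, evM_smul, ev_cst]
  have h3 : at2 (D.KC e) x * at2 (ginv (S.g e)) x = (1 / 2 : ℂ) • ev x B.κ • evM x B.j := by
    rw [← evM_smul, B.ev_K]
    module
  rw [← (B.rep_symOp hf).ev x, h2, h3, symOp]
  simp only [map_mul, map_add, map_sub, ev_cst, map_ofNat, ev_trace, Matrix.smul_mul,
    Matrix.mul_smul, Matrix.trace_smul, smul_eq_mul, B.rep_Ψ.ev, B.rep_Ψ'.ev, B.rep_κ.ev, hf.ev x,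
    Function.comp_apply]
  linear_combination (-(1 / 4) * (k * (D.ζ (e.symm x))⁻¹) * (evM x B.j * evM x (B.T Φ)).trace)
    * Complex.I_mul_I

/-- The symmetry operator does not depend on the chart. -/
lemma symOpIn_transition (B : Background D e lam) (B' : Background D e' lam) (he : e ∈ coords M)
    (he' : e' ∈ coords M) (hf : ContMDiff (𝓡 4) 𝓘(ℝ, ℂ) ∞ f) (x : overlap e e') :
    D.symOpIn e f x = D.symOpIn e' f ((e' ∘ e.symm) x) := by
  have hy : (e' ∘ e.symm) x ∈ e'.target := e'.map_source (mem_source x)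
  have hp : e'.symm ((e' ∘ e.symm) x) = e.symm x := symm_transition x
  have hr := rep_mk (U := chartTarget e) _ (contDiffOn_comp_symm hf he)
  have hr' := rep_mk (U := chartTarget e') _ (contDiffOn_comp_symm hf he')
  have h1 := ext1_pullback (contDiffOn_transition he he')
    (V := D.Ygrad e (f ∘ e.symm)) (V' := D.Ygrad e' (f ∘ e'.symm)) x
    (fun b => differentiableAt_of_contDiffOn (B'.rep_V hr' b).contDiffOn
      ⟨(e' ∘ e.symm) x, hy⟩)
    (fun y b => D.Ygrad_transform he he' hf y b)
  -- The full contraction of two covariant tensors with two inverse metrics is invariant: the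
  -- Jacobians combine with the inverse metrics.
  have h2 : ∀ J h h' K V : Mat ℂ, J * h * Jᵀ = h' →
      (Jᵀ * K * J * h * (Jᵀ * V * J * h)).trace = (K * h' * (V * h')).trace := by
    rintro J h h' K V rfl
    rw [mul_assoc, mul_assoc, mul_assoc, Matrix.trace_mul_comm]
    simp only [mul_assoc]
  rw [B.symOpIn_eq hr ⟨x, mem_target x⟩, B'.symOpIn_eq hr' ⟨_, hy⟩]
  simp only
  rw [h1, D.KC_transform he he' x, h2 _ _ _ _ _ (D.ginv_transform he he' x), hp]

end Background

/-! ### The degenerate normalization `k = 0` -/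

lemma pd_eq_zero {U : TopologicalSpace.Opens E4} {F : E4 → ℂ} (hF : ∀ y : U, F y = 0) (a : Fin 4)
    (x : U) : pd a F x = 0 := by
  rw [pd_congr (G := fun _ => 0) hF, pd, fderiv_const_apply]
  rfl

lemma cov1_eq_zero {U : TopologicalSpace.Opens E4} (gt : Tens2) {α : Tens1}
    (hα : ∀ b (y : U), α b y = 0) (a b : Fin 4) (x : U) : cov1 gt α a b x = 0 := by
  simp [cov1, pd_eq_zero (hα b), hα]

lemma div2_eq_zero {U : TopologicalSpace.Opens E4} (gt : Tens2) {T : Tens2}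
    (hT : ∀ a b (y : U), T a b y = 0) (b : Fin 4) (x : U) : div2 gt T b x = 0 := by
  simp [div2, cov2, pd_eq_zero (hT _ _), hT]

lemma hodge_eq_zero {gt : Tens2} {vol : Tens4} {T : Tens2} {x : E4} (hT : ∀ a b, T a b x = 0)
    (a b : Fin 4) : hodge gt vol T a b x = 0 := by
  simp [hodge, up2, hT]

variable {M : Type*} [TopologicalSpace M] [ChartedSpace E4 M] {S : Spacetime M}

namespace TypeDStructure

section Zero

variable (D : TypeDStructure S 0) {e : OpenPartialHomeomorph M E4}

lemma Y_eq_zero (he : e ∈ coords M) (x : chartTarget e) (a b : Fin 4) : D.Y e a b x = 0 := by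
  obtain ⟨l, n, m, -, -, hK⟩ := D.principal e he x x.2
  simp [Y, KC, hK]

lemma starY_eq_zero (he : e ∈ coords M) (x : chartTarget e) (a b : Fin 4) :
    D.starY e a b x = 0 := hodge_eq_zero (D.Y_eq_zero he x) a b

lemma Ygrad_eq_zero (he : e ∈ coords M) (x : chartTarget e) (F : E4 → ℂ) (a : Fin 4) :
    D.Ygrad e F a x = 0 := by
  simp [Ygrad, upSnd, D.Y_eq_zero he x]

lemma symOpIn_eq_zero (he : e ∈ coords M) (x : chartTarget e) (f : M → ℂ) :
    D.symOpIn e f x = 0 := by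
  simp [symOpIn, up2, D.Y_eq_zero he x, D.starY_eq_zero he x]

lemma carterYIn_eq_zero (he : e ∈ coords M) (x : chartTarget e) (f : M → ℂ) :
    D.carterYIn e f x = 0 := by
  simp [carterYIn, up2, D.Y_eq_zero he x]

lemma carterIn_eq_zero (he : e ∈ coords M) (x : chartTarget e) (f : M → ℂ) :
    D.carterIn e f x = 0 := by
  have h1 : ∀ a (y : chartTarget e), ∑ c, D.killingH e a c y * grad (f ∘ e.symm) c y = 0 :=
    fun a y => by simp [killingH, upSnd, D.Y_eq_zero he y]
  have h2 : ∀ a, pd a (fun y => ∑ c, D.killingH e a c y * grad (f ∘ e.symm) c y) x = 0 :=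
    fun a => pd_eq_zero (h1 a) a x
  simp [carterIn, divVec, h2, h1]

lemma F_eq_zero (he : e ∈ coords M) (x : chartTarget e) (u v : M → ℝ) (a b : Fin 4) :
    D.F u v e a b x = 0 := by
  have h1 : ∀ (w : M → ℝ) a b, D.starE e w a b x = 0 := fun w a b => by
    simp [starE, alt2, D.starY_eq_zero he x,
      cov1_eq_zero (U := chartTarget e) (S.g e) (fun c y => D.Ygrad_eq_zero he y _ c)]
  simp [F, EForm, h1, hodge_eq_zero (h1 u)]

end Zero

/-! ### The three assertions -/

variable [IsManifold (𝓡 4) ∞ M] {lam : ℝ} {k : ℂ} {D : TypeDStructure S k} {f : M → ℂ}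

/-- The symmetry operator may be computed in any chart. -/
lemma symOp_symm (hvac : S.IsLambdaVacuum lam) (hξ : D.XiReal)
    (hf : ContMDiff (𝓡 4) 𝓘(ℝ, ℂ) ∞ f) {e : OpenPartialHomeomorph M E4} (he : e ∈ coords M)
    (x : chartTarget e) : D.symOp f (e.symm x) = D.symOpIn e f x := by
  have he' : chartAt E4 (e.symm x) ∈ coords M := IsManifold.chart_mem_maximalAtlas _
  by_cases hk : k = 0
  · subst hk
    rw [D.symOpIn_eq_zero he]
    exact D.symOpIn_eq_zero he' ⟨_, mem_chart_target E4 _⟩ f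
  · obtain ⟨B⟩ := D.exists_background hvac hk hξ he
    obtain ⟨B'⟩ := D.exists_background hvac hk hξ he'
    exact (B.symOpIn_transition B' he he' hf ⟨x, x.2, mem_chart_source E4 _⟩).symm

theorem isMaxwell_F (hvac : S.IsLambdaVacuum lam) (hξ : D.XiReal) {u v : M → ℝ}
    (h : S.SolvesFI lam (fun p => conj (D.Ψ₂ p)) fun p => (u p : ℂ) + Complex.I * v p) :
    S.IsMaxwell (D.F u v) := by
  intro e he
  by_cases hk : k = 0
  · subst hk
    refine ⟨fun a b => contDiffOn_const.congr fun x hx => D.F_eq_zero he ⟨x, hx⟩ u v a b,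
      fun x hx b => ⟨?_, ?_⟩⟩
    · exact div2_eq_zero (U := chartTarget e) _ (fun a b y => D.F_eq_zero he y u v a b) b ⟨x, hx⟩
    · exact div2_eq_zero (U := chartTarget e) _
        (fun a b y => hodge_eq_zero (D.F_eq_zero he y u v) a b) b ⟨x, hx⟩
  · obtain ⟨B⟩ := D.exists_background hvac hk hξ he
    set Φ : Smooth (chartTarget e) := Smooth.mk _ (contDiffOn_comp_symm h.1 he) with hΦdef
    have hΦ : Represents Φ ((fun p => (u p : ℂ) + Complex.I * v p) ∘ e.symm) := rep_mk _ _
    -- Smoothness is assumed for `Φ` only; `u` and `v` inherit it as its real and imaginary parts.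
    set U := Background.cst e (1 / 2) * (Φ + conjS Φ) with hU
    set W := Background.cst e (-(Complex.I / 2)) * (Φ - conjS Φ) with hW
    have repU : Represents U fun x => (u (e.symm x) : ℂ) := fun x => by
      rw [← ev_apply, hU, map_mul, map_add, ev_conjS, Background.ev_cst, hΦ.ev x]
      simp only [Function.comp_apply, map_add, map_mul, Complex.conj_ofReal, Complex.conj_I]
      ring
    have repW : Represents W fun x => (v (e.symm x) : ℂ) := fun x => by
      rw [← ev_apply, hW, map_mul, map_sub, ev_conjS, Background.ev_cst, hΦ.ev x]
      simp only [Function.comp_apply, map_add, map_mul, Complex.conj_ofReal, Complex.conj_I]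
      linear_combination (-(v (e.symm x) : ℂ)) * Complex.I_mul_I
    have hsum : U + Background.cst e Complex.I * W = Φ := ext_ev fun x => by
      rw [map_add, repU.ev, map_mul, Background.ev_cst, repW.ev, hΦ.ev]
      rfl
    refine B.isMaxwell repU repW ?_
    rw [hsum]
    exact B.bx_eq hΦ (h.2 e he)

theorem solvesFI_symOp (hvac : S.IsLambdaVacuum lam) (hξ : D.XiReal)
    (h : S.SolvesFI lam (fun p => conj (D.Ψ₂ p)) f) : S.SolvesFI lam D.Ψ₂ (D.symOp f) := by
  by_cases hk : k = 0
  · subst hk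
    have h0 : D.symOp f = fun _ => 0 := funext fun p =>
      D.symOpIn_eq_zero (IsManifold.chart_mem_maximalAtlas p) ⟨_, mem_chart_target E4 p⟩ f
    rw [h0]
    refine ⟨contMDiff_const, fun e he x hx => ?_⟩
    have h1 : box (S.g e) ((fun _ => 0 : M → ℂ) ∘ e.symm) x = 0 := by
      have := cov1_eq_zero (U := ⊤) (S.g e) (α := grad ((fun _ => 0 : M → ℂ) ∘ e.symm))
        (fun b y => pd_eq_zero (U := ⊤) (fun _ => rfl) b y)
      simp [box, this _ _ ⟨x, trivial⟩]
    rw [h1, mul_zero, add_zero]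
  -- The function on `M` is defined with a chart that depends on the point. By chart independence it
  -- is given on the whole of each chart by one smooth expression, which yields both smoothness and
  -- the differential equation.
  · have hrep : ∀ e (he : e ∈ coords M), ∃ B : Background D e lam,
        Represents (B.symOp (Smooth.mk _ (contDiffOn_comp_symm h.1 he))) (D.symOp f ∘ e.symm) := by
      intro e he
      obtain ⟨B⟩ := D.exists_background hvac hk hξ he
      refine ⟨B, fun x => ?_⟩
      exact (B.rep_symOp (rep_mk _ _) x).trans (symOp_symm hvac hξ h.1 he x).symm
    refine ⟨fun p => ?_, fun e he x hx => ?_⟩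
    · have he : chartAt E4 p ∈ coords M := IsManifold.chart_mem_maximalAtlas p
      obtain ⟨B, hB⟩ := hrep _ he
      have h1 : ContMDiffOn (𝓡 4) 𝓘(ℝ, ℂ) ∞ ((D.symOp f ∘ (chartAt E4 p).symm) ∘ chartAt E4 p)
          (chartAt E4 p).source :=
        (contMDiffOn_iff_contDiffOn.mpr hB.contDiffOn).comp
          (contMDiffOn_of_mem_maximalAtlas he) fun q hq => (chartAt E4 p).map_source hq
      have h2 := (chartAt E4 p).open_source.mem_nhds (mem_chart_source E4 p)
      refine (h1.contMDiffAt h2).congr_of_eventuallyEq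
        (Filter.eventuallyEq_of_mem h2 fun q hq => ?_)
      rw [Function.comp_apply, Function.comp_apply, (chartAt E4 p).left_inv hq]
    · obtain ⟨B, hB⟩ := hrep _ he
      exact B.bx_symOp (B.bx_eq (rep_mk _ _) (h.2 e he)) ⟨x, hx⟩ hB

theorem symOp_eq_carter (hvac : S.IsLambdaVacuum lam) (hξ : D.XiReal) (hk : k.im = 0)
    (hζ : ∀ p, (D.ζ p).im = 0) (hf : ContMDiff (𝓡 4) 𝓘(ℝ, ℂ) ∞ f)
    {e : OpenPartialHomeomorph M E4} (he : e ∈ coords M) (x : chartTarget e) :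
    D.symOp f (e.symm x) = D.carterYIn e f x ∧ D.symOp f (e.symm x) = D.carterIn e f x := by
  rw [symOp_symm hvac hξ hf he]
  by_cases hk0 : k = 0
  · subst hk0
    rw [D.symOpIn_eq_zero he, D.carterYIn_eq_zero he, D.carterIn_eq_zero he]
    exact ⟨rfl, rfl⟩
  · obtain ⟨B⟩ := D.exists_background hvac hk0 hξ he
    have hr := rep_mk (U := chartTarget e) _ (contDiffOn_comp_symm hf he)
    rw [B.carterIn_eq hr, B.symOpIn_eq_carterYIn hk hζ hr]
    exact ⟨rfl, rfl⟩

end TypeDStructure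

end TypeD
end

theorem mainTheorem9 {M : Type*} [TopologicalSpace M] [ChartedSpace TypeD.E4 M]
    [IsManifold (modelWithCornersSelf ℝ TypeD.E4) (⊤ : ℕ∞) M]
    (S : TypeD.Spacetime M) (lam : ℝ) (hvac : S.IsLambdaVacuum lam)
    (k : ℂ) (D : TypeD.TypeDStructure S k) (hξ : D.XiReal) :
    -- the Maxwell field generated by a solution
    (∀ u v : M → ℝ,
      S.SolvesFI lam (fun p => (starRingEnd ℂ) (D.Ψ₂ p)) (fun p => (u p : ℂ) + Complex.I * v p) →
      S.IsMaxwell (D.F u v)) ∧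
    -- the symmetry operator
    (∀ Φ : M → ℂ,
      S.SolvesFI lam (fun p => (starRingEnd ℂ) (D.Ψ₂ p)) Φ →
      S.SolvesFI lam D.Ψ₂ (D.symOp Φ)) ∧
    -- the reduction to the Carter operator
    (k.im = 0 → (∀ p, (D.ζ p).im = 0) →
      ∀ Φ : M → ℂ, ContMDiff (modelWithCornersSelf ℝ TypeD.E4) (modelWithCornersSelf ℝ ℂ) (⊤ : ℕ∞) Φ →
        ∀ e ∈ TypeD.coords M, ∀ x ∈ e.target,
          D.symOp Φ (e.symm x) = D.carterYIn e Φ x ∧ D.symOp Φ (e.symm x) = D.carterIn e Φ x) :=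
  ⟨fun _ _ h => TypeD.TypeDStructure.isMaxwell_F hvac hξ h,
    fun _ h => TypeD.TypeDStructure.solvesFI_symOp hvac hξ h,
    fun hk hζ _ hf _ he x hx => TypeD.TypeDStructure.symOp_eq_carter hvac hξ hk hζ hf he ⟨x, hx⟩⟩
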